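/- **Model.** Consider a single-server first-come-first-served GI/GI/1 queue with parameter $\vartheta=(\mu,p)\in\mathcal B=[\underline\mu,\bar\mu]\times[\underline p,\bar p]$: inter-arrival times are $U_n/\lambda(p)$ and service times are $V_n/\mu$, where $(U_n)$ and $(V_n)$ are independent i.i.d. sequences of nonnegative random variables with $\mathbb E U_n=\mathbb E V_n=1$. Let $f(\mu,p)=h_0\,\mathbb E[Q_\infty(\mu,p)]+c(\mu)-p\lambda(p)$, where $\mathbb E[Q_\infty(\mu,p)]$ is the steady-state (long-run time-average) mean number of customers in the system. For a state $x=(w,y)\in\mathcal X=[0,\infty)^2$ let $P_\vartheta(x,\cdot)$ be the law of $$\Big(w',\ \big(y+\tfrac{U}{\lambda(p)}\big)\mathbf 1(w'>0)\Big),\qquad w'=\Big(w-\tfrac{U}{\lambda(p)}+\tfrac{V}{\mu}\Big)_+,$$ and put $$H(\vartheta,x)=\Big(c'(\mu)-h_0\tfrac{\lambda(p)}{\mu}\big(w+y+\tfrac1\mu\big),\ -\lambda(p)-p\lambda'(p)+h_0\lambda'(p)\big(w+y+\tfrac1\mu\big)\Big).$$ **Assumptions.** 1. $\lambda>0$ is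 $C^1$ and non-increasing on $[\underline p,\bar p]$, $c$ is $C^1$ and non-decreasing on $[\underline\mu,\bar\mu]$, and $\lambda(\underline p)<\underline\mu$. 2. There is $\eta>0$ with $\mathbb E e^{\eta U}<\infty$, $\mathbb E e^{\eta V}<\infty$, and there are $0<\theta<\eta/(2\bar\mu)$, $0<a<(\underline\mu-\lambda(\underline p))/(\underline\mu+\lambda(\underline p))$, $\gamma>0$ with $\phi_U(-\theta/(1-a))<-\theta-\gamma/2$ and $\phi_V(\theta/(1+a))<\theta-\gamma/2$, where $\phi_U,\phi_V$ are the cumulant generating functions. The law of $V$ has no atoms (in particular, a bounded density of $V$ suffices). 3. $\vartheta^\star$ minimizes $f$ over $\mathcal B$ and is an interior point of $\mathcal B$, and there are $0<K_0\le1$ and $K_1>K_0$ with $\langle\vartheta-\vartheta^\star,\nabla f(\vartheta)\rangle\ge K_0\|\vartheta-\vartheta^\star\|^2$ and $\|\nabla f(\vartheta)\|\le K_1\|\vartheta-\vartheta^\star\|$ for all $\vartheta\in\mathcal B$. 4. There are a positive definite matrix $G$ and constants $L_G$, $\delta_G>0$ with $\|\nabla f(\vartheta)-G(\vartheta-\vartheta^\star)\|\le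 L_G\|\vartheta-\vartheta^\star\|^2$ for all $\vartheta\in\mathcal B$ with $\|\vartheta-\vartheta^\star\|\le\delta_G$. 5. The step sizes $\eta_t>0$, $t\ge1$, satisfy $\eta_t\downarrow0$, $t\eta_t\uparrow\infty$, $(\eta_{t-1}-\eta_t)/\eta_{t-1}=o(\eta_{t-1})$, $\sum_t\eta_t=\infty$ and $\sum_t\eta_t^{1.5}<\infty$. **Algorithm.** Starting from $x_0=(0,0)$ and $\vartheta_1\in\mathcal B$, for $t\ge1$ draw $x_t\sim P_{\vartheta_t}(x_{t-1},\cdot)$ (that is, apply the above one-step recursion with parameter $\vartheta_t$ and fresh $(U_t,V_t)$) and set $\vartheta_{t+1}=\Pi_{\mathcal B}(\vartheta_t-\eta_tH(\vartheta_t,x_t))$, where $\Pi_{\mathcal B}$ is the Euclidean projection. **Claim.** For every $x\in\mathcal X$ the series $$U(\vartheta^\star,x)=\sum_{n=0}^\infty\big(P_{\vartheta^\star}^nH(\vartheta^\star,\cdot)(x)-\nabla f(\vartheta^\star)\big)$$ converges (absolutely), it solves the Poisson equation $H(\vartheta^\star,x)-\nabla f(\vartheta^\star)=U(\vartheta^\star,x)-P_{\vartheta^\star}U(\vartheta^\star,x)$,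 and $U(\vartheta^\star,\cdot)$ is square integrable with respect to $P_\vartheta(x,\cdot)$ for all $\vartheta\in\mathcal B$, $x\in\mathcal X$. With $$\mathrm{Var}_\vartheta(U(\vartheta^\star,x))=P_\vartheta\big(U(\vartheta^\star,\cdot)U(\vartheta^\star,\cdot)^\top\big)(x)-\big(P_\vartheta U(\vartheta^\star,\cdot)(x)\big)\big(P_\vartheta U(\vartheta^\star,\cdot)(x)\big)^\top,$$ there is a deterministic positive semidefinite matrix $S$, depending on the model only (not on the step sizes or on $\vartheta_1$), such that, as $T\to\infty$, $$\frac1T\sum_{t=1}^T\mathrm{Var}_{\vartheta_t}(U(\vartheta^\star,x_{t-1}))\ \longrightarrow\ S\quad\text{in probability.}$$ -/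

import Mathlib

open MeasureTheory ProbabilityTheory Filter Topology Asymptotics

noncomputable section

/-- The data of a GI/GI/1 queue with price-dependent demand and controllable service rate: the
demand rate `lam`, the staffing cost `cost`, the holding cost `h0`, the bounds of the feasible box
`[muLo, muHi] × [pLo, pHi]`, and the laws of the unscaled inter-arrival times `U` and of the
unscaled service times `V`. -/
structure GIGI1 where
  lam : ℝ → ℝ
  cost : ℝ → ℝ
  h0 : ℝ
  muLo : ℝ
  muHi : ℝ
  pLo : ℝ
  pHi : ℝ
  lawU : Measure ℝ
  lawV : Measure ℝ
  isProbU : IsProbabilityMeasure lawU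
  isProbV : IsProbabilityMeasure lawV

attribute [instance] GIGI1.isProbU GIGI1.isProbV

/-- Control parameters `ϑ = (μ, p)` with the Euclidean norm: `ϑ 0 = μ` is the service rate and
`ϑ 1 = p` is the price. -/
abbrev Param : Type := EuclideanSpace ℝ (Fin 2)

/-- The state space of pairs `x = (w, y)` (waiting time, observed busy period). -/
def stateSpace : Set (ℝ × ℝ) := {x | 0 ≤ x.1 ∧ 0 ≤ x.2}

namespace GIGI1

variable (M : GIGI1)

/-- The feasible set `[muLo, muHi] × [pLo, pHi]`. -/
def box : Set Param := {ϑ | ϑ 0 ∈ Set.Icc M.muLo M.muHi ∧ ϑ 1 ∈ Set.Icc M.pLo M.pHi}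

/-- The Euclidean projection onto the feasible box, which acts coordinatewise. -/
def proj (ϑ : Param) : Param :=
  !₂[max M.muLo (min M.muHi (ϑ 0)), max M.pLo (min M.pHi (ϑ 1))]

/-- The derivative `λ'` of the demand rate on `[pLo, pHi]` (one-sided at the end points). -/
def lamDeriv (p : ℝ) : ℝ := derivWithin M.lam (Set.Icc M.pLo M.pHi) p

/-- The derivative `c'` of the staffing cost on `[muLo, muHi]` (one-sided at the end points). -/
def costDeriv (m : ℝ) : ℝ := derivWithin M.cost (Set.Icc M.muLo M.muHi) m

/-! ### The objective function -/

/-- The law of an i.i.d. sequence of pairs `(U_n, V_n)` with `U_n` and `V_n` independent. -/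
def seqLaw : Measure (ℕ → ℝ × ℝ) := Measure.infinitePi fun _ => M.lawU.prod M.lawV

/-- The waiting time of customer `n` under the fixed parameter `ϑ`; customer `0` finds the system
empty, `U_n / λ(p)` is the time between the arrivals of customers `n` and `n + 1`, and `V_n / μ` is
the service time of customer `n`. -/
def waiting (ϑ : Param) (s : ℕ → ℝ × ℝ) : ℕ → ℝ
  | 0 => 0
  | n + 1 => max (waiting ϑ s n - (s n).1 / M.lam (ϑ 1) + (s n).2 / ϑ 0) 0

/-- The arrival time of customer `n` under the fixed parameter `ϑ`. -/
def arrival (ϑ : Param) (s : ℕ → ℝ × ℝ) (n : ℕ) : ℝ :=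
  ∑ k ∈ Finset.range n, (s k).1 / M.lam (ϑ 1)

/-- The departure time of customer `n` under the fixed parameter `ϑ`. -/
def departure (ϑ : Param) (s : ℕ → ℝ × ℝ) (n : ℕ) : ℝ :=
  M.arrival ϑ s n + M.waiting ϑ s n + (s n).2 / ϑ 0

/-- The queue length (number of customers waiting or in service) at time `r`. -/
def queueLength (ϑ : Param) (s : ℕ → ℝ × ℝ) (r : ℝ) : ℕ :=
  Set.ncard {n : ℕ | M.arrival ϑ s n ≤ r ∧ r < M.departure ϑ s n}

/-- The steady-state mean queue length `E[Q_∞(μ, p)]`: the expected value of the long-run time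
average of the queue length. (For a stable queue the time average converges almost surely, to a
constant.) -/
def meanQueueLength (ϑ : Param) : ℝ :=
  ∫ s, limUnder atTop (fun R : ℝ => R⁻¹ * ∫ r in (0 : ℝ)..R, (M.queueLength ϑ s r : ℝ)) ∂M.seqLaw

/-- The objective `f(μ, p) = h₀ E[Q_∞(μ, p)] + c(μ) - p λ(p)`. -/
def objective (ϑ : Param) : ℝ :=
  M.h0 * M.meanQueueLength ϑ + M.cost (ϑ 0) - ϑ 1 * M.lam (ϑ 1)

/-- The gradient `∇f` of the objective on the feasible box. -/
def gradObj (ϑ : Param) : Param := gradientWithin M.objective M.box ϑ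

/-! ### The state process and the gradient estimator -/

/-- One step of the state `x = (w, y)` under the parameter `ϑ` driven by `(U, V)`. -/
def step (ϑ : Param) (x uv : ℝ × ℝ) : ℝ × ℝ :=
  let w := max (x.1 - uv.1 / M.lam (ϑ 1) + uv.2 / ϑ 0) 0
  (w, if 0 < w then x.2 + uv.1 / M.lam (ϑ 1) else 0)

/-- The one-step transition law `P_ϑ(x, ·)`. -/
def trans (ϑ : Param) (x : ℝ × ℝ) : Measure (ℝ × ℝ) :=
  (M.lawU.prod M.lawV).map (M.step ϑ x)

/-- The transition operator `(P_ϑ h)(x) = ∫ h(x') P_ϑ(x, dx')`. -/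
def transOp {E : Type*} [NormedAddCommGroup E] [NormedSpace ℝ E] (ϑ : Param)
    (h : ℝ × ℝ → E) (x : ℝ × ℝ) : E :=
  ∫ x', h x' ∂M.trans ϑ x

/-- The gradient estimator `H(ϑ, x)`; the first coordinate estimates `∂f/∂μ`, the second one
`∂f/∂p`. -/
def gradEst (ϑ : Param) (x : ℝ × ℝ) : Param :=
  !₂[M.costDeriv (ϑ 0) - M.h0 * (M.lam (ϑ 1) / ϑ 0) * (x.1 + x.2 + 1 / ϑ 0),
    -M.lam (ϑ 1) - ϑ 1 * M.lamDeriv (ϑ 1) + M.h0 * M.lamDeriv (ϑ 1) * (x.1 + x.2 + 1 / ϑ 0)]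

/-- The transient bias `(P_ϑ)ⁿ H(ϑ, ·)(x) - ∇f(ϑ)` after `n` steps. -/
def bias (ϑ : Param) (x : ℝ × ℝ) (n : ℕ) : Param :=
  (M.transOp ϑ)^[n] (M.gradEst ϑ) x - M.gradObj ϑ

/-- The solution `U(ϑ, x)` of the Poisson equation `H(ϑ, x) - ∇f(ϑ) = U(ϑ, x) - P_ϑ U(ϑ, x)`, given
as the cumulated transient bias. -/
def poissonSol (ϑ : Param) (x : ℝ × ℝ) : Param := ∑' n, M.bias ϑ x n

/-- The conditional covariance matrix `P_ϑ(h hᵀ)(x) - (P_ϑ h)(x) (P_ϑ h)(x)ᵀ`. -/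
def condCov (ϑ : Param) (h : ℝ × ℝ → Param) (x : ℝ × ℝ) : Matrix (Fin 2) (Fin 2) ℝ :=
  Matrix.of fun i j =>
    M.transOp ϑ (fun x' => h x' i * h x' j) x - M.transOp ϑ h x i * M.transOp ϑ h x j

/-! ### The SAMCMC recursion -/

/-- The SAMCMC recursion started from `x_0 = (0, 0)` and `ϑ_1`: the value at `t` is the pair
`(x_t, ϑ_{t+1})`, where `x_{t+1}` is drawn from `P_{ϑ_{t+1}}(x_t, ·)` by means of
`(U_{t+1}, V_{t+1})` and `ϑ_{t+2}` is the projection of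
`ϑ_{t+1} - η_{t+1} H(ϑ_{t+1}, x_{t+1})`. -/
def samcmc (η : ℕ → ℝ) (ϑ₁ : Param) (s : ℕ → ℝ × ℝ) : ℕ → (ℝ × ℝ) × Param
  | 0 => ((0, 0), ϑ₁)
  | t + 1 =>
    let ϑ := (samcmc η ϑ₁ s t).2
    let x := M.step ϑ (samcmc η ϑ₁ s t).1 (s (t + 1))
    (x, M.proj (ϑ - η (t + 1) • M.gradEst ϑ x))

/-- The averaged conditional covariance `T⁻¹ ∑_{t=1}^T Var_{ϑ_t}(U(ϑ⋆, x_{t-1}))`; the summand with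
index `t` below is the one for the pair `(x_t, ϑ_{t+1})`. -/
def avgCondCov (ϑstar : Param) (η : ℕ → ℝ) (ϑ₁ : Param) (s : ℕ → ℝ × ℝ) (T : ℕ) :
    Matrix (Fin 2) (Fin 2) ℝ :=
  (T : ℝ)⁻¹ • ∑ t ∈ Finset.range T,
    M.condCov (M.samcmc η ϑ₁ s t).2 (M.poissonSol ϑstar) (M.samcmc η ϑ₁ s t).1

/-! ### Assumptions -/

/-- Demand rate, staffing cost and uniform stability. -/
structure UniformlyStable : Prop where
  lam_pos : ∀ p ∈ Set.Icc M.pLo M.pHi, 0 < M.lam p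
  lam_smooth : ContDiffOn ℝ 1 M.lam (Set.Icc M.pLo M.pHi)
  lam_anti : AntitoneOn M.lam (Set.Icc M.pLo M.pHi)
  cost_smooth : ContDiffOn ℝ 1 M.cost (Set.Icc M.muLo M.muHi)
  cost_mono : MonotoneOn M.cost (Set.Icc M.muLo M.muHi)
  stable : M.lam M.pLo < M.muLo

/-- The primitive random times are nonnegative with unit mean and light tails, and the law of the
service times has no atoms. -/
structure LightTailed : Prop where
  nonneg_U : ∀ᵐ u ∂M.lawU, 0 ≤ u
  nonneg_V : ∀ᵐ v ∂M.lawV, 0 ≤ v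
  mean_U : ∫ u, u ∂M.lawU = 1
  mean_V : ∫ v, v ∂M.lawV = 1
  noAtoms_V : ∀ v : ℝ, M.lawV {v} = 0
  exists_rates : ∃ η > 0, Integrable (fun v => Real.exp (η * v)) M.lawV ∧
    Integrable (fun u => Real.exp (η * u)) M.lawU ∧
    ∃ θ a γ : ℝ, 0 < θ ∧ θ < η / (2 * M.muHi) ∧
      0 < a ∧ a < (M.muLo - M.lam M.pLo) / (M.muLo + M.lam M.pLo) ∧ 0 < γ ∧
      Integrable (fun v => Real.exp (θ / (1 + a) * v)) M.lawV ∧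
      cgf id M.lawU (-θ / (1 - a)) < -θ - γ / 2 ∧ cgf id M.lawV (θ / (1 + a)) < θ - γ / 2

/-- `ϑ⋆` is an optimal solution and an inner point of the box, with convexity and smoothness of the
objective relative to `ϑ⋆`. -/
structure ConvexSmooth (ϑstar : Param) (K₀ K₁ : ℝ) : Prop where
  isMinOn : IsMinOn M.objective M.box ϑstar
  mem_interior : ϑstar ∈ interior M.box
  K₀_pos : 0 < K₀
  K₀_le_one : K₀ ≤ 1
  K₀_lt_K₁ : K₀ < K₁
  convex : ∀ ϑ ∈ M.box, K₀ * ‖ϑ - ϑstar‖ ^ 2 ≤ inner ℝ (ϑ - ϑstar) (M.gradObj ϑ)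
  smooth : ∀ ϑ ∈ M.box, ‖M.gradObj ϑ‖ ≤ K₁ * ‖ϑ - ϑstar‖

/-- Local linearity of `∇f` at `ϑ⋆` with positive definite matrix `G`. -/
structure LocallyLinear (ϑstar : Param) (G : Matrix (Fin 2) (Fin 2) ℝ) (L δ : ℝ) : Prop where
  posDef : G.PosDef
  δ_pos : 0 < δ
  linear : ∀ ϑ ∈ M.box, ‖ϑ - ϑstar‖ ≤ δ →
    ‖M.gradObj ϑ - Matrix.toEuclideanLin G (ϑ - ϑstar)‖ ≤ L * ‖ϑ - ϑstar‖ ^ 2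

end GIGI1

/-- The step size conditions; the step sizes are `η_1, η_2, …`, and `η 0` plays no role. -/
structure StepSize (η : ℕ → ℝ) : Prop where
  pos : ∀ t ≥ 1, 0 < η t
  anti : ∀ t ≥ 1, η (t + 1) ≤ η t
  tendsto_zero : Tendsto η atTop (𝓝 0)
  mul_mono : ∀ t : ℕ, 1 ≤ t → (t : ℝ) * η t ≤ ((t + 1 : ℕ) : ℝ) * η (t + 1)
  mul_tendsto : Tendsto (fun t : ℕ => (t : ℝ) * η t) atTop atTop
  ratio : (fun t => (η t - η (t + 1)) / η t) =o[atTop] η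
  not_summable : ¬ Summable η
  summable_rpow : Summable fun t => η t ^ (1.5 : ℝ)

end

/-! ### The exponential Lyapunov function and one step of the chain -/

noncomputable section

namespace GIGI1

variable {M : GIGI1}

/-! The chain is controlled by the weight `wt s r (w, y) = exp (s w + r y)`. The light-tail
condition provides exponents for which one step multiplies this weight, as long as the queue does
not empty, by a random factor of mean below one, uniformly over the box. When the queue empties, the
state is reset to `(0, 0)`. One step is also monotone in the state, so two ordered copies driven by
the same noise coincide from the moment the upper one empties. Together these facts give geometric
forgetting of the initial state (`Tame.abs_iterate_sub_le`), hence stationary means with a geometric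
rate uniform in the parameter. Since the service law has no atoms, the transition operator preserves
joint continuity in parameter and state, so stationary means are continuous in the parameter.

The series defining the Poisson solution subtracts the gradient of the objective, so that gradient
must be identified with the stationary mean of the estimator (`Regular.gradObj_eq`). A law of large
numbers and Little's law along a sample path express the mean queue length through the stationary
waiting time. The scaled waiting time `λ w` satisfies a pathwise subgradient inequality in the load
`λ / μ` with slope `μ (w + y)`. Passing to stationary means and exchanging the roles of the two
parameters squeezes the remainder of the first-order expansion, and continuity of the slope gives
differentiability.

The estimator depends on the state only through the scalar `w + y`, so the Poisson solution is a
scalar function times a fixed vector. The conditional covariance is therefore a scalar conditional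
variance times a fixed rank-one matrix, and that scalar is jointly continuous in parameter and state
with exponential growth.

It remains to prove a law of large numbers along the algorithm. Over a fixed number of steps the
parameters hardly move, so the controlled chain stays close in probability to a chain with frozen
parameter (`Controlled.close_frozen`), which mixes geometrically. Freezing at the current parameter
shows that the mean drift of the algorithm is asymptotically at least the one required by strong
convexity, and a Robbins–Monro recursion gives mean square convergence of the parameters to the
optimum. Freezing at the optimum then shows that distant centered summands have asymptotically
nonpositive correlation, up to an arbitrarily small error. The second moment of the average tends to
zero, and the limit is the stationary mean of the conditional variance at the optimum. -/

/-- Stability, light tails and a box with nonempty interior. -/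
structure Regular (M : GIGI1) : Prop where
  stable : M.UniformlyStable
  light : M.LightTailed
  mu_lt : M.muLo < M.muHi
  p_lt : M.pLo < M.pHi

/-- The law of a pair `(U, V)`. -/
abbrev noise (M : GIGI1) : Measure (ℝ × ℝ) := M.lawU.prod M.lawV

/-- The exponential Lyapunov function. -/
def wt (s r : ℝ) (x : ℝ × ℝ) : ℝ := Real.exp (s * x.1 + r * x.2)

/-- The random factor that bounds the growth of the Lyapunov function over one step. -/
def driftFactor (M : GIGI1) (s r : ℝ) (uv : ℝ × ℝ) : ℝ :=
  Real.exp (s * (uv.2 / M.muLo - uv.1 / M.lam M.pLo) + r * (uv.1 / M.lam M.pHi))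

/-- The contraction rate of the Lyapunov function. -/
def rate (M : GIGI1) (s r : ℝ) : ℝ := ∫ uv, M.driftFactor s r uv ∂M.noise

/-- Exponents for which the Lyapunov function contracts off the empty state. -/
structure Drift (M : GIGI1) (s r : ℝ) : Prop where
  s_pos : 0 < s
  r_pos : 0 < r
  integrable : Integrable (M.driftFactor s r) M.noise
  rate_lt : M.rate s r < 1

lemma wt_pos (s r : ℝ) (x : ℝ × ℝ) : 0 < wt s r x := Real.exp_pos _

lemma one_le_wt {s r : ℝ} (hs : 0 ≤ s) (hr : 0 ≤ r) {x : ℝ × ℝ} (hx : x ∈ stateSpace) :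
    1 ≤ wt s r x := by
  obtain ⟨h1, h2⟩ := hx
  exact Real.one_le_exp (by positivity)

lemma wt_zero (s r : ℝ) : wt s r (0, 0) = 1 := by simp [wt]

lemma continuous_wt (s r : ℝ) : Continuous (wt s r) := by
  unfold wt; fun_prop

lemma wt_mono {s r : ℝ} (hs : 0 ≤ s) (hr : 0 ≤ r) {x y : ℝ × ℝ} (h : x ≤ y) :
    wt s r x ≤ wt s r y := by
  unfold wt
  gcongr
  exacts [h.1, h.2]

lemma wt_pow (s r : ℝ) (n : ℕ) (x : ℝ × ℝ) : wt s r x ^ n = wt (n * s) (n * r) x := by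
  unfold wt
  rw [← Real.exp_nat_mul]
  ring_nf

lemma driftFactor_pos (s r : ℝ) (uv : ℝ × ℝ) : 0 < M.driftFactor s r uv := Real.exp_pos _

lemma continuous_driftFactor (s r : ℝ) : Continuous (M.driftFactor s r) := by
  unfold driftFactor; fun_prop

lemma rate_nonneg (s r : ℝ) : 0 ≤ M.rate s r :=
  integral_nonneg fun _ => (driftFactor_pos _ _ _).le

lemma zero_mem_stateSpace : ((0, 0) : ℝ × ℝ) ∈ stateSpace := ⟨le_rfl, le_rfl⟩

lemma isClosed_stateSpace : IsClosed stateSpace :=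
  (isClosed_le continuous_const continuous_fst).inter
    (isClosed_le continuous_const continuous_snd)

lemma zero_le_of_mem_stateSpace {x : ℝ × ℝ} (hx : x ∈ stateSpace) : ((0, 0) : ℝ × ℝ) ≤ x :=
  ⟨hx.1, hx.2⟩

namespace Regular

variable (hM : M.Regular)
include hM

lemma muLo_pos : 0 < M.muLo :=
  (hM.stable.lam_pos _ ⟨le_rfl, hM.p_lt.le⟩).trans hM.stable.stable

lemma lamLo_pos : 0 < M.lam M.pLo := hM.stable.lam_pos _ ⟨le_rfl, hM.p_lt.le⟩

lemma lamHi_pos : 0 < M.lam M.pHi := hM.stable.lam_pos _ ⟨hM.p_lt.le, le_rfl⟩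

lemma mu_pos {ϑ : Param} (hϑ : ϑ ∈ M.box) : 0 < ϑ 0 := hM.muLo_pos.trans_le hϑ.1.1

lemma lam_pos {ϑ : Param} (hϑ : ϑ ∈ M.box) : 0 < M.lam (ϑ 1) := hM.stable.lam_pos _ hϑ.2

lemma lam_le {ϑ : Param} (hϑ : ϑ ∈ M.box) : M.lam (ϑ 1) ≤ M.lam M.pLo :=
  hM.stable.lam_anti ⟨le_rfl, hM.p_lt.le⟩ hϑ.2 hϑ.2.1

lemma le_lam {ϑ : Param} (hϑ : ϑ ∈ M.box) : M.lam M.pHi ≤ M.lam (ϑ 1) :=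
  hM.stable.lam_anti hϑ.2 ⟨hM.p_lt.le, le_rfl⟩ hϑ.2.2

lemma noise_nonneg : ∀ᵐ uv ∂M.noise, 0 ≤ uv.1 ∧ 0 ≤ uv.2 :=
  (Measure.quasiMeasurePreserving_fst.ae hM.light.nonneg_U).and
    (Measure.quasiMeasurePreserving_snd.ae hM.light.nonneg_V)

/-- For fixed `u` only one value of `v` puts the workload exactly on the boundary between busy and
idle, and the service law gives no mass to a point. This is where the absence of atoms enters; it
makes the discontinuity of `step` negligible. -/
lemma noise_ne_zero (w l : ℝ) {m : ℝ} (hm : 0 < m) :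
    ∀ᵐ uv ∂M.noise, w - uv.1 / l + uv.2 / m ≠ 0 := by
  have hs : MeasurableSet {uv : ℝ × ℝ | w - uv.1 / l + uv.2 / m = 0} :=
    measurableSet_eq_fun (by fun_prop) measurable_const
  have : M.noise {uv : ℝ × ℝ | w - uv.1 / l + uv.2 / m = 0} = 0 := by
    rw [Measure.measure_prod_null hs]
    refine Eventually.of_forall fun u => ?_
    refine measure_mono_null (t := {m * (u / l - w)}) ?_ (hM.light.noAtoms_V _)
    intro v hv
    simp only [Set.mem_preimage, Set.mem_ofPred_eq] at hv
    simp only [Set.mem_singleton_iff]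
    field_simp at hv ⊢
    linarith
  simpa [ae_iff] using this

lemma integral_noise_fst : ∫ uv, uv.1 ∂M.noise = 1 := by
  have := integral_prod_mul (μ := M.lawU) (ν := M.lawV) (fun u : ℝ => u) (fun _ => (1 : ℝ))
  simpa [hM.light.mean_U] using this

lemma exists_drift : ∃ s r, M.Drift s r := by
  obtain ⟨η, hη, hV, hU, θ, a, γ, hθ, -, ha, ha', hγ, hVθ, hcU, hcV⟩ := hM.light.exists_rates
  have hmu := hM.muLo_pos
  have hl := hM.lamLo_pos
  have hl' := hM.lamHi_pos
  have ha1 : a < 1 := by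
    rw [lt_div_iff₀ (by positivity)] at ha'
    by_contra! h
    nlinarith
  -- The upper bound on `a` in the form `λ (1 + a) < μ (1 - a)`; it is what makes `r` below
  -- positive.
  have hslope : θ / (1 - a) < M.muLo * (θ / (1 + a)) / M.lam M.pLo := by
    rw [lt_div_iff₀ (by positivity)] at ha'
    rw [lt_div_iff₀ hl, mul_div_assoc', div_mul_eq_mul_div,
      div_lt_div_iff₀ (by linarith) (by linarith)]
    have : M.lam M.pLo * (1 + a) < M.muLo * (1 - a) := by linarith
    nlinarith
  -- The exponents are chosen so that `driftFactor` splits into the two exponentials of the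
  -- assumption: `s` produces the coefficient `θ / (1 + a)` of `v`, and `r` uses up the slack left
  -- in the coefficient of `u`, bringing it to `-θ / (1 - a)`.
  set s := M.muLo * (θ / (1 + a)) with hs
  set r := M.lam M.pHi * (s / M.lam M.pLo - θ / (1 - a)) with hr
  have hfac : M.driftFactor s r = fun uv =>
      Real.exp (-θ / (1 - a) * uv.1) * Real.exp (θ / (1 + a) * uv.2) := by
    funext uv
    rw [← Real.exp_add, driftFactor]
    congr 1
    rw [hr, hs]
    field_simp
    ring
  have hUθ : Integrable (fun u => Real.exp (-θ / (1 - a) * u)) M.lawU := by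
    refine Integrable.of_bound (C := 1) (by fun_prop) ?_
    filter_upwards [hM.light.nonneg_U] with u hu
    rw [Real.norm_eq_abs, Real.abs_exp, Real.exp_le_one_iff, neg_div]
    have : 0 < θ / (1 - a) := div_pos hθ (by linarith)
    nlinarith
  refine ⟨s, r, by positivity, mul_pos hl' (sub_pos.2 hslope), ?_, ?_⟩
  · rw [hfac]
    exact hUθ.mul_prod hVθ
  · rw [rate, hfac]
    erw [integral_prod_mul (μ := M.lawU) (ν := M.lawV) (fun u : ℝ => Real.exp (-θ / (1 - a) * u))
      (fun v => Real.exp (θ / (1 + a) * v))]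
    have e1 : ∫ u, Real.exp (-θ / (1 - a) * u) ∂M.lawU ≤ Real.exp (-θ - γ / 2) :=
      (Real.le_exp_log _).trans (Real.exp_le_exp.2 hcU.le)
    have e2 : ∫ v, Real.exp (θ / (1 + a) * v) ∂M.lawV ≤ Real.exp (θ - γ / 2) :=
      (Real.le_exp_log _).trans (Real.exp_le_exp.2 hcV.le)
    calc _ ≤ Real.exp (-θ - γ / 2) * Real.exp (θ - γ / 2) :=
          mul_le_mul e1 e2 (integral_nonneg fun _ => (Real.exp_pos _).le) (Real.exp_pos _).le
      _ = Real.exp (-γ) := by rw [← Real.exp_add]; ring_nf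
      _ < 1 := by rw [Real.exp_lt_one_iff]; linarith

end Regular

/-- By convexity `exp (c t) ≤ (1 - c) + c exp t`, so shrinking both exponents keeps integrability
and a rate below one. -/
lemma Drift.scale {s r c : ℝ} (h : M.Drift s r) (hc : 0 < c) (hc1 : c ≤ 1) :
    M.Drift (c * s) (c * r) := by
  have hle : ∀ uv, M.driftFactor (c * s) (c * r) uv ≤ (1 - c) + c * M.driftFactor s r uv := by
    intro uv
    set t := s * (uv.2 / M.muLo - uv.1 / M.lam M.pLo) + r * (uv.1 / M.lam M.pHi) with ht
    have := convexOn_exp.2 (Set.mem_univ 0) (Set.mem_univ t) (sub_nonneg.2 hc1) hc.le (by ring)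
    simp only [smul_eq_mul, mul_zero, zero_add, Real.exp_zero, mul_one] at this
    have e : M.driftFactor (c * s) (c * r) uv = Real.exp (c * t) := by
      rw [driftFactor, ht]; ring_nf
    rw [e]
    exact this
  have hi : Integrable (fun uv => (1 - c) + c * M.driftFactor s r uv) M.noise :=
    (integrable_const _).add (h.integrable.const_mul c)
  have hi' : Integrable (M.driftFactor (c * s) (c * r)) M.noise := by
    refine hi.mono' (continuous_driftFactor _ _).aestronglyMeasurable
      (Eventually.of_forall fun uv => ?_)
    rw [Real.norm_of_nonneg (driftFactor_pos _ _ _).le]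
    exact hle uv
  refine ⟨mul_pos hc h.s_pos, mul_pos hc h.r_pos, hi', ?_⟩
  have := integral_mono hi' hi hle
  rw [integral_add (integrable_const _) (h.integrable.const_mul c), integral_const_mul] at this
  simp only [integral_const, probReal_univ, one_smul] at this
  have hlt := h.rate_lt
  unfold rate at *
  nlinarith

/-! ### One step of the state process -/

section Step

variable {ϑ : Param} {x y uv : ℝ × ℝ}

lemma measurable_step (M : GIGI1) (ϑ : Param) (x : ℝ × ℝ) : Measurable (M.step ϑ x) := by
  have h1 : Measurable fun uv : ℝ × ℝ => max (x.1 - uv.1 / M.lam (ϑ 1) + uv.2 / ϑ 0) 0 := by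
    fun_prop
  exact h1.prodMk (Measurable.ite (measurableSet_lt measurable_const h1) (by fun_prop)
    measurable_const)

lemma step_fst (M : GIGI1) (ϑ : Param) (x uv : ℝ × ℝ) :
    (M.step ϑ x uv).1 = max (x.1 - uv.1 / M.lam (ϑ 1) + uv.2 / ϑ 0) 0 := rfl

lemma step_of_nonpos (h : x.1 - uv.1 / M.lam (ϑ 1) + uv.2 / ϑ 0 ≤ 0) :
    M.step ϑ x uv = (0, 0) := by
  simp [step, h]

lemma step_of_pos (h : 0 < x.1 - uv.1 / M.lam (ϑ 1) + uv.2 / ϑ 0) :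
    M.step ϑ x uv =
      (x.1 - uv.1 / M.lam (ϑ 1) + uv.2 / ϑ 0, x.2 + uv.1 / M.lam (ϑ 1)) := by
  simp [step, h, h.le]

lemma Regular.step_mem (hM : M.Regular) (hϑ : ϑ ∈ M.box) (hx : x ∈ stateSpace) (hu : 0 ≤ uv.1) :
    M.step ϑ x uv ∈ stateSpace := by
  by_cases h : 0 < x.1 - uv.1 / M.lam (ϑ 1) + uv.2 / ϑ 0
  · rw [step_of_pos h]
    exact ⟨h.le, add_nonneg hx.2 (div_nonneg hu (hM.lam_pos hϑ).le)⟩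
  · rw [step_of_nonpos (not_lt.1 h)]
    exact zero_mem_stateSpace

/-- The factor combines the worst cases over the box: slowest service and fastest arrivals for `w`,
slowest arrivals for `y`. There is no additive constant on the busy event, which is what permits
pure geometric decay in the coupling argument. -/
lemma Regular.wt_step_of_pos (hM : M.Regular) {s r : ℝ} (hs : 0 ≤ s) (hr : 0 ≤ r)
    (hϑ : ϑ ∈ M.box) (hu : 0 ≤ uv.1) (hv : 0 ≤ uv.2)
    (h : 0 < x.1 - uv.1 / M.lam (ϑ 1) + uv.2 / ϑ 0) :
    wt s r (M.step ϑ x uv) ≤ wt s r x * M.driftFactor s r uv := by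
  rw [step_of_pos h, wt, wt, driftFactor, ← Real.exp_add]
  have h1 : uv.2 / ϑ 0 ≤ uv.2 / M.muLo :=
    div_le_div_of_nonneg_left hv hM.muLo_pos hϑ.1.1
  have h2 : uv.1 / M.lam M.pLo ≤ uv.1 / M.lam (ϑ 1) :=
    div_le_div_of_nonneg_left hu (hM.lam_pos hϑ) (hM.lam_le hϑ)
  have h3 : uv.1 / M.lam (ϑ 1) ≤ uv.1 / M.lam M.pHi :=
    div_le_div_of_nonneg_left hu hM.lamHi_pos (hM.le_lam hϑ)
  apply Real.exp_le_exp.2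
  have := mul_le_mul_of_nonneg_left (add_le_add h1 (neg_le_neg h2)) hs
  have := mul_le_mul_of_nonneg_left h3 hr
  simp only
  nlinarith

lemma Regular.wt_step_le (hM : M.Regular) {s r : ℝ} (hs : 0 ≤ s) (hr : 0 ≤ r)
    (hϑ : ϑ ∈ M.box) (hu : 0 ≤ uv.1) (hv : 0 ≤ uv.2) :
    wt s r (M.step ϑ x uv) ≤ wt s r x * M.driftFactor s r uv + 1 := by
  by_cases h : 0 < x.1 - uv.1 / M.lam (ϑ 1) + uv.2 / ϑ 0
  · linarith [hM.wt_step_of_pos hs hr hϑ hu hv h]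
  · rw [step_of_nonpos (not_lt.1 h), wt_zero]
    have := mul_pos (wt_pos s r x) (driftFactor_pos (M := M) s r uv)
    linarith

/-- If the lower copy stays busy, so does the upper one and both receive the same increments; if the
lower copy empties, it moves to the smallest state. -/
lemma Regular.step_mono (hM : M.Regular) (hϑ : ϑ ∈ M.box) (hu : 0 ≤ uv.1) (hy : y ∈ stateSpace)
    (h : y ≤ x) : M.step ϑ y uv ≤ M.step ϑ x uv := by
  have hx : x ∈ stateSpace := ⟨hy.1.trans h.1, hy.2.trans h.2⟩
  have h1 := h.1
  have h2 := h.2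
  by_cases hp : 0 < y.1 - uv.1 / M.lam (ϑ 1) + uv.2 / ϑ 0
  · rw [step_of_pos hp, step_of_pos (by linarith)]
    exact ⟨by simp only; linarith, by simp only; linarith⟩
  · rw [step_of_nonpos (not_lt.1 hp)]
    exact zero_le_of_mem_stateSpace (hM.step_mem hϑ hx hu)

/-- Two ordered states merge as soon as the upper one becomes empty. -/
lemma step_eq_of_le_of_nonpos (h : y ≤ x) (hp : x.1 - uv.1 / M.lam (ϑ 1) + uv.2 / ϑ 0 ≤ 0) :
    M.step ϑ y uv = M.step ϑ x uv := by
  have h1 := h.1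
  rw [step_of_nonpos hp, step_of_nonpos (by linarith)]

end Step

end GIGI1

namespace GIGI1

variable {M : GIGI1}

/-! ### The transition operator on functions dominated by the Lyapunov function -/

/-- Families of functions on the state space that are jointly continuous in the parameter and the
state and dominated by the Lyapunov function. -/
structure Tame (M : GIGI1) (s r C : ℝ) (g : Param → ℝ × ℝ → ℝ) : Prop where
  cont : ContinuousOn (fun q : Param × (ℝ × ℝ) => g q.1 q.2) (M.box ×ˢ stateSpace)
  bound : ∀ ϑ ∈ M.box, ∀ x ∈ stateSpace, |g ϑ x| ≤ C * wt s r x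

lemma Tame.section {s r C : ℝ} {g : Param → ℝ × ℝ → ℝ} (hg : M.Tame s r C g) {ϑ : Param}
    (hϑ : ϑ ∈ M.box) : ContinuousOn (g ϑ) stateSpace :=
  hg.cont.comp (f := fun x => (ϑ, x)) (by fun_prop) fun _ hx => ⟨hϑ, hx⟩

lemma Tame.nonneg {s r C : ℝ} {g : Param → ℝ × ℝ → ℝ} (hg : M.Tame s r C g) {ϑ : Param}
    (hϑ : ϑ ∈ M.box) : 0 ≤ C := by
  have := hg.bound ϑ hϑ _ zero_mem_stateSpace
  rw [wt_zero, mul_one] at this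
  exact (abs_nonneg _).trans this

lemma Tame.of_const {s r C : ℝ} {ψ : ℝ × ℝ → ℝ} (hc : ContinuousOn ψ stateSpace)
    (hb : ∀ x ∈ stateSpace, |ψ x| ≤ C * wt s r x) : M.Tame s r C fun _ => ψ :=
  ⟨hc.comp continuousOn_snd fun _ hq => hq.2, fun _ _ => hb⟩

lemma Regular.ae_trans_mem (hM : M.Regular) {ϑ : Param} (hϑ : ϑ ∈ M.box) {x : ℝ × ℝ}
    (hx : x ∈ stateSpace) : ∀ᵐ x' ∂M.trans ϑ x, x' ∈ stateSpace := by
  refine (ae_map_iff (measurable_step M ϑ x).aemeasurable isClosed_stateSpace.measurableSet).2 ?_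
  filter_upwards [hM.noise_nonneg] with uv huv
  exact hM.step_mem hϑ hx huv.1

lemma Regular.aestronglyMeasurable_trans (hM : M.Regular) {E : Type*} [NormedAddCommGroup E]
    {ψ : ℝ × ℝ → E} (hψ : ContinuousOn ψ stateSpace) {ϑ : Param} (hϑ : ϑ ∈ M.box) {x : ℝ × ℝ}
    (hx : x ∈ stateSpace) : AEStronglyMeasurable ψ (M.trans ϑ x) := by
  rw [← Measure.restrict_eq_self_of_ae_mem (hM.ae_trans_mem hϑ hx)]
  exact hψ.aestronglyMeasurable isClosed_stateSpace.measurableSet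

lemma Regular.aestronglyMeasurable_step (hM : M.Regular) {E : Type*} [NormedAddCommGroup E]
    {ψ : ℝ × ℝ → E} (hψ : ContinuousOn ψ stateSpace) {ϑ : Param} (hϑ : ϑ ∈ M.box) {x : ℝ × ℝ}
    (hx : x ∈ stateSpace) : AEStronglyMeasurable (fun uv => ψ (M.step ϑ x uv)) M.noise :=
  (hM.aestronglyMeasurable_trans hψ hϑ hx).comp_measurable (measurable_step M ϑ x)

lemma Regular.transOp_eq (hM : M.Regular) {E : Type*} [NormedAddCommGroup E] [NormedSpace ℝ E]
    {ψ : ℝ × ℝ → E} (hψ : ContinuousOn ψ stateSpace) {ϑ : Param} (hϑ : ϑ ∈ M.box) {x : ℝ × ℝ}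
    (hx : x ∈ stateSpace) : M.transOp ϑ ψ x = ∫ uv, ψ (M.step ϑ x uv) ∂M.noise :=
  integral_map (measurable_step M ϑ x).aemeasurable (hM.aestronglyMeasurable_trans hψ hϑ hx)

lemma Regular.abs_step_le (hM : M.Regular) {s r C : ℝ} (hd : M.Drift s r) (hC : 0 ≤ C)
    {ψ : ℝ × ℝ → ℝ} (hb : ∀ x ∈ stateSpace, |ψ x| ≤ C * wt s r x) {ϑ : Param} (hϑ : ϑ ∈ M.box)
    {x : ℝ × ℝ} (hx : x ∈ stateSpace) :
    ∀ᵐ uv ∂M.noise, |ψ (M.step ϑ x uv)| ≤ C * (wt s r x * M.driftFactor s r uv + 1) := by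
  filter_upwards [hM.noise_nonneg] with uv huv
  exact (hb _ (hM.step_mem hϑ hx huv.1)).trans (mul_le_mul_of_nonneg_left
    (hM.wt_step_le hd.s_pos.le hd.r_pos.le hϑ huv.1 huv.2) hC)

lemma Drift.integrable_bound {s r : ℝ} (hd : M.Drift s r) (C w : ℝ) :
    Integrable (fun uv => C * (w * M.driftFactor s r uv + 1)) M.noise :=
  ((hd.integrable.const_mul w).add (integrable_const _)).const_mul C

lemma Drift.integral_bound {s r : ℝ} (hd : M.Drift s r) (C w : ℝ) :
    ∫ uv, C * (w * M.driftFactor s r uv + 1) ∂M.noise = C * (w * M.rate s r + 1) := by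
  rw [integral_const_mul, integral_add (hd.integrable.const_mul w) (integrable_const _),
    integral_const_mul]
  simp [rate]

lemma Regular.integrable_step (hM : M.Regular) {s r C : ℝ} (hd : M.Drift s r) (hC : 0 ≤ C)
    {ψ : ℝ × ℝ → ℝ} (hψ : ContinuousOn ψ stateSpace)
    (hb : ∀ x ∈ stateSpace, |ψ x| ≤ C * wt s r x) {ϑ : Param} (hϑ : ϑ ∈ M.box)
    {x : ℝ × ℝ} (hx : x ∈ stateSpace) :
    Integrable (fun uv => ψ (M.step ϑ x uv)) M.noise :=
  (hd.integrable_bound C (wt s r x)).mono' (hM.aestronglyMeasurable_step hψ hϑ hx)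
    (hM.abs_step_le hd hC hb hϑ hx)

lemma Regular.integrable_trans (hM : M.Regular) {s r C : ℝ} (hd : M.Drift s r) (hC : 0 ≤ C)
    {ψ : ℝ × ℝ → ℝ} (hψ : ContinuousOn ψ stateSpace)
    (hb : ∀ x ∈ stateSpace, |ψ x| ≤ C * wt s r x) {ϑ : Param} (hϑ : ϑ ∈ M.box)
    {x : ℝ × ℝ} (hx : x ∈ stateSpace) : Integrable ψ (M.trans ϑ x) :=
  (integrable_map_measure (hM.aestronglyMeasurable_trans hψ hϑ hx)
    (measurable_step M ϑ x).aemeasurable).2 (hM.integrable_step hd hC hψ hb hϑ hx)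

lemma Regular.abs_transOp_le (hM : M.Regular) {s r C : ℝ} (hd : M.Drift s r) (hC : 0 ≤ C)
    {ψ : ℝ × ℝ → ℝ} (hψ : ContinuousOn ψ stateSpace)
    (hb : ∀ x ∈ stateSpace, |ψ x| ≤ C * wt s r x) {ϑ : Param} (hϑ : ϑ ∈ M.box)
    {x : ℝ × ℝ} (hx : x ∈ stateSpace) :
    |M.transOp ϑ ψ x| ≤ C * (wt s r x * M.rate s r + 1) := by
  rw [hM.transOp_eq hψ hϑ hx, ← hd.integral_bound, ← Real.norm_eq_abs]
  exact norm_integral_le_of_norm_le (hd.integrable_bound C (wt s r x))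
    (hM.abs_step_le hd hC hb hϑ hx)

lemma Regular.continuousOn_lam (hM : M.Regular) :
    ContinuousOn (fun ϑ : Param => M.lam (ϑ 1)) M.box :=
  hM.stable.lam_smooth.continuousOn.comp (by fun_prop) fun _ h => h.2

lemma Regular.continuousWithinAt_step (hM : M.Regular) {q₀ : Param × (ℝ × ℝ)}
    (hq₀ : q₀ ∈ M.box ×ˢ stateSpace) {uv : ℝ × ℝ}
    (h : q₀.2.1 - uv.1 / M.lam (q₀.1 1) + uv.2 / q₀.1 0 ≠ 0) :
    ContinuousWithinAt (fun q : Param × (ℝ × ℝ) => M.step q.1 q.2 uv) (M.box ×ˢ stateSpace)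
      q₀ := by
  have hl : ContinuousWithinAt (fun q : Param × (ℝ × ℝ) => uv.1 / M.lam (q.1 1))
      (M.box ×ˢ stateSpace) q₀ := by
    refine continuousWithinAt_const.div ?_ (hM.lam_pos hq₀.1).ne'
    exact (hM.continuousOn_lam.comp continuousOn_fst fun _ h => h.1) _ hq₀
  have hm : ContinuousWithinAt (fun q : Param × (ℝ × ℝ) => uv.2 / q.1 0)
      (M.box ×ˢ stateSpace) q₀ :=
    continuousWithinAt_const.div (by fun_prop) (hM.mu_pos hq₀.1).ne'
  have harg : ContinuousWithinAt (fun q : Param × (ℝ × ℝ) =>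
      q.2.1 - uv.1 / M.lam (q.1 1) + uv.2 / q.1 0) (M.box ×ˢ stateSpace) q₀ :=
    ((by fun_prop : ContinuousWithinAt (fun q : Param × (ℝ × ℝ) => q.2.1) _ _).sub hl).add hm
  rcases lt_or_gt_of_ne h with hneg | hpos
  · refine (continuousWithinAt_const (b := ((0, 0) : ℝ × ℝ))).congr_of_eventuallyEq ?_
      (step_of_nonpos hneg.le)
    filter_upwards [harg.eventually_lt_const hneg] with q hq
    exact step_of_nonpos hq.le
  · refine (harg.prodMk ((by fun_prop : ContinuousWithinAt
      (fun q : Param × (ℝ × ℝ) => q.2.2) _ _).add hl)).congr_of_eventuallyEq ?_ (step_of_pos hpos)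
    filter_upwards [harg.eventually_const_lt hpos] with q hq
    exact step_of_pos hq

lemma Regular.ae_continuousWithinAt_step (hM : M.Regular) {q₀ : Param × (ℝ × ℝ)}
    (hq₀ : q₀ ∈ M.box ×ˢ stateSpace) :
    ∀ᵐ uv ∂M.noise, ContinuousWithinAt (fun q : Param × (ℝ × ℝ) => M.step q.1 q.2 uv)
      (M.box ×ˢ stateSpace) q₀ := by
  filter_upwards [hM.noise_ne_zero q₀.2.1 (M.lam (q₀.1 1)) (hM.mu_pos hq₀.1)] with uv h
  exact hM.continuousWithinAt_step hq₀ h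

/-- Continuity survives although `step` jumps: at each fixed parameter and state almost every noise
value is a continuity point, and dominated convergence applies. The constant doubles because `κ wt +
1 ≤ 2 wt` for a rate `κ < 1 ≤ wt`. -/
lemma Tame.transOp (hM : M.Regular) {s r C : ℝ} (hd : M.Drift s r)
    {g : Param → ℝ × ℝ → ℝ} (hg : M.Tame s r C g) :
    M.Tame s r (2 * C) fun ϑ => M.transOp ϑ (g ϑ) := by
  refine ⟨?_, fun ϑ hϑ x hx => ?_⟩
  · have heq : Set.EqOn (fun q : Param × (ℝ × ℝ) => M.transOp q.1 (g q.1) q.2)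
        (fun q => ∫ uv, g q.1 (M.step q.1 q.2 uv) ∂M.noise) (M.box ×ˢ stateSpace) :=
      fun q hq => hM.transOp_eq (hg.section hq.1) hq.1 hq.2
    refine ContinuousOn.congr ?_ heq
    intro q₀ hq₀
    refine continuousWithinAt_of_dominated
      -- A bound that is uniform near `q₀`, where the weight stays below its value at `q₀` plus one.
      (bound := fun uv => C * ((wt s r q₀.2 + 1) * M.driftFactor s r uv + 1)) ?_ ?_
      (hd.integrable_bound _ _) ?_
    · filter_upwards [self_mem_nhdsWithin] with q hq
      exact hM.aestronglyMeasurable_step (hg.section hq.1) hq.1 hq.2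
    · have hw : ContinuousWithinAt (fun q : Param × (ℝ × ℝ) => wt s r q.2)
          (M.box ×ˢ stateSpace) q₀ :=
        ((continuous_wt s r).comp continuous_snd).continuousWithinAt
      filter_upwards [self_mem_nhdsWithin, hw.eventually_lt_const (lt_add_one _)] with q hq hlt
      filter_upwards [hM.abs_step_le hd (hg.nonneg hq.1) (hg.bound _ hq.1) hq.1 hq.2] with uv huv
      refine huv.trans ?_
      have := hg.nonneg hq.1
      have := (driftFactor_pos (M := M) s r uv).le
      gcongr
    · filter_upwards [hM.ae_continuousWithinAt_step hq₀, hM.noise_nonneg] with uv huv hnn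
      have hmaps : Set.MapsTo (fun q : Param × (ℝ × ℝ) => (q.1, M.step q.1 q.2 uv))
          (M.box ×ˢ stateSpace) (M.box ×ˢ stateSpace) :=
        fun q hq => ⟨hq.1, hM.step_mem hq.1 hq.2 hnn.1⟩
      exact ContinuousWithinAt.comp (g := fun q : Param × (ℝ × ℝ) => g q.1 q.2)
        (f := fun q : Param × (ℝ × ℝ) => (q.1, M.step q.1 q.2 uv)) (hg.cont _ (hmaps hq₀))
        (continuousWithinAt_fst.prodMk huv) hmaps
  · have hC := hg.nonneg hϑ
    refine (hM.abs_transOp_le hd hC (hg.section hϑ) (hg.bound ϑ hϑ) hϑ hx).trans ?_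
    have h1 := one_le_wt hd.s_pos.le hd.r_pos.le hx
    have h2 := hd.rate_lt
    have : wt s r x * M.rate s r ≤ wt s r x * 1 := by gcongr
    nlinarith

/-- The growing constant is harmless: it serves only for integrability, while all quantitative
bounds come from the forgetting estimate. -/
lemma Tame.iterate (hM : M.Regular) {s r C : ℝ} (hd : M.Drift s r)
    {g : Param → ℝ × ℝ → ℝ} (hg : M.Tame s r C g) (n : ℕ) :
    M.Tame s r (2 ^ n * C) fun ϑ => (M.transOp ϑ)^[n] (g ϑ) := by
  induction n with
  | zero => simpa using hg
  | succ n ih =>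
    simp only [Function.iterate_succ_apply']
    convert ih.transOp hM hd using 1
    ring

/-- Geometric forgetting of the initial state. -/
lemma Tame.abs_iterate_sub_le (hM : M.Regular) {s r C : ℝ} (hd : M.Drift s r)
    {g : Param → ℝ × ℝ → ℝ} (hg : M.Tame s r C g) {ϑ : Param} (hϑ : ϑ ∈ M.box) (n : ℕ)
    {x y : ℝ × ℝ} (hx : x ∈ stateSpace) (hy : y ∈ stateSpace) (hyx : y ≤ x) :
    |(M.transOp ϑ)^[n] (g ϑ) x - (M.transOp ϑ)^[n] (g ϑ) y|
      ≤ 2 * C * M.rate s r ^ n * wt s r x := by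
  have hC := hg.nonneg hϑ
  induction n generalizing x y with
  | zero =>
    have h1 := hg.bound ϑ hϑ x hx
    have h2 := (hg.bound ϑ hϑ y hy).trans
      (mul_le_mul_of_nonneg_left (wt_mono hd.s_pos.le hd.r_pos.le hyx) hC)
    have := abs_sub (g ϑ x) (g ϑ y)
    simp only [Function.iterate_zero, id_eq, pow_zero, mul_one]
    linarith
  | succ n ih =>
    have hn := hg.iterate hM hd n
    have hint : ∀ z ∈ stateSpace, Integrable
        (fun uv => (M.transOp ϑ)^[n] (g ϑ) (M.step ϑ z uv)) M.noise := fun z hz =>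
      hM.integrable_step hd (hn.nonneg hϑ) (hn.section hϑ) (hn.bound ϑ hϑ) hϑ hz
    simp only [Function.iterate_succ_apply']
    rw [hM.transOp_eq (hn.section hϑ) hϑ hx, hM.transOp_eq (hn.section hϑ) hϑ hy,
      ← integral_sub (hint x hx) (hint y hy)]
    have hle : ∀ᵐ uv ∂M.noise, ‖(M.transOp ϑ)^[n] (g ϑ) (M.step ϑ x uv)
        - (M.transOp ϑ)^[n] (g ϑ) (M.step ϑ y uv)‖
        ≤ 2 * C * M.rate s r ^ n * wt s r x * M.driftFactor s r uv := by
      filter_upwards [hM.noise_nonneg] with uv huv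
      have hpow := pow_nonneg (rate_nonneg (M := M) s r) n
      -- Coupling with common noise: while the upper copy is busy its weight contracts on average,
      -- and once it empties the two copies have merged and the difference vanishes.
      by_cases hp : 0 < x.1 - uv.1 / M.lam (ϑ 1) + uv.2 / ϑ 0
      · refine (ih (hM.step_mem hϑ hx huv.1) (hM.step_mem hϑ hy huv.1)
          (hM.step_mono hϑ huv.1 hy hyx)).trans ?_
        rw [mul_assoc _ (wt s r x)]
        exact mul_le_mul_of_nonneg_left (hM.wt_step_of_pos hd.s_pos.le hd.r_pos.le hϑ huv.1
          huv.2 hp) (by positivity)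
      · rw [step_eq_of_le_of_nonpos hyx (not_lt.1 hp), sub_self, norm_zero]
        have := wt_pos s r x
        have := driftFactor_pos (M := M) s r uv
        positivity
    refine (norm_integral_le_of_norm_le (hd.integrable.const_mul _) hle).trans ?_
    rw [integral_const_mul, ← rate]
    exact le_of_eq (by ring)

/-- The stationary mean of `ψ` under the parameter `ϑ`. -/
def statMean (M : GIGI1) (ϑ : Param) (ψ : ℝ × ℝ → ℝ) : ℝ :=
  limUnder atTop fun n => (M.transOp ϑ)^[n] ψ (0, 0)

/-- One additional step amounts to starting from the random state reached from `(0, 0)`, whose mean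
weight is at most `rate + 1 ≤ 2`. Forgetting the initial state then makes the iterates at the empty
state a geometric Cauchy sequence. -/
lemma Tame.abs_iterate_succ_sub_le (hM : M.Regular) {s r C : ℝ} (hd : M.Drift s r)
    {g : Param → ℝ × ℝ → ℝ} (hg : M.Tame s r C g) {ϑ : Param} (hϑ : ϑ ∈ M.box) (n : ℕ) :
    |(M.transOp ϑ)^[n] (g ϑ) (0, 0) - (M.transOp ϑ)^[n + 1] (g ϑ) (0, 0)|
      ≤ 4 * C * M.rate s r ^ n := by
  have hC := hg.nonneg hϑ
  have hn := hg.iterate hM hd n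
  have hint := hM.integrable_step hd (hn.nonneg hϑ) (hn.section hϑ) (hn.bound ϑ hϑ) hϑ
    zero_mem_stateSpace
  rw [abs_sub_comm, Function.iterate_succ_apply',
    hM.transOp_eq (hn.section hϑ) hϑ zero_mem_stateSpace]
  have e : (M.transOp ϑ)^[n] (g ϑ) (0, 0) =
      ∫ _, (M.transOp ϑ)^[n] (g ϑ) (0, 0) ∂M.noise := by simp
  rw [e, ← integral_sub hint (integrable_const _)]
  have hpow := pow_nonneg (rate_nonneg (M := M) s r) n
  have hle : ∀ᵐ uv ∂M.noise, ‖(M.transOp ϑ)^[n] (g ϑ) (M.step ϑ (0, 0) uv)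
        - (M.transOp ϑ)^[n] (g ϑ) (0, 0)‖
        ≤ 2 * C * M.rate s r ^ n * (1 * M.driftFactor s r uv + 1) := by
    filter_upwards [hM.noise_nonneg] with uv huv
    have hmem := hM.step_mem hϑ zero_mem_stateSpace huv.1
    refine (hg.abs_iterate_sub_le hM hd hϑ n hmem zero_mem_stateSpace
      (zero_le_of_mem_stateSpace hmem)).trans ?_
    have := hM.wt_step_le (x := (0, 0)) hd.s_pos.le hd.r_pos.le hϑ huv.1 huv.2
    rw [wt_zero] at this
    gcongr
  refine (norm_integral_le_of_norm_le (hd.integrable_bound _ _) hle).trans ?_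
  rw [hd.integral_bound]
  have h1 := hd.rate_lt
  have h2 : 2 * C * M.rate s r ^ n * (1 * M.rate s r + 1) ≤ 2 * C * M.rate s r ^ n * 2 := by
    gcongr; linarith
  linarith

lemma Tame.tendsto_statMean (hM : M.Regular) {s r C : ℝ} (hd : M.Drift s r)
    {g : Param → ℝ × ℝ → ℝ} (hg : M.Tame s r C g) {ϑ : Param} (hϑ : ϑ ∈ M.box) :
    Tendsto (fun n => (M.transOp ϑ)^[n] (g ϑ) (0, 0)) atTop (𝓝 (M.statMean ϑ (g ϑ))) :=
  (cauchySeq_of_le_geometric (M.rate s r) (4 * C) hd.rate_lt fun n => by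
    rw [Real.dist_eq]; exact hg.abs_iterate_succ_sub_le hM hd hϑ n).tendsto_limUnder

/-- Geometric ergodicity. -/
lemma Tame.abs_iterate_sub_statMean_le (hM : M.Regular) {s r C : ℝ} (hd : M.Drift s r)
    {g : Param → ℝ × ℝ → ℝ} (hg : M.Tame s r C g) {ϑ : Param} (hϑ : ϑ ∈ M.box) (n : ℕ)
    {x : ℝ × ℝ} (hx : x ∈ stateSpace) :
    |(M.transOp ϑ)^[n] (g ϑ) x - M.statMean ϑ (g ϑ)|
      ≤ 6 * C / (1 - M.rate s r) * M.rate s r ^ n * wt s r x := by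
  have hC := hg.nonneg hϑ
  have h1 := hg.abs_iterate_sub_le hM hd hϑ n hx zero_mem_stateSpace (zero_le_of_mem_stateSpace hx)
  have h2 := dist_le_of_le_geometric_of_tendsto (M.rate s r) (4 * C) hd.rate_lt
    (fun n => by rw [Real.dist_eq]; exact hg.abs_iterate_succ_sub_le hM hd hϑ n)
    (hg.tendsto_statMean hM hd hϑ) n
  rw [Real.dist_eq] at h2
  have hw := one_le_wt hd.s_pos.le hd.r_pos.le hx
  have hr0 := rate_nonneg (M := M) s r
  have hr1 := sub_pos.2 hd.rate_lt
  have hpow := pow_nonneg hr0 n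
  have h3 : 2 * C * M.rate s r ^ n * wt s r x
      ≤ 2 * C / (1 - M.rate s r) * M.rate s r ^ n * wt s r x := by
    gcongr
    rw [le_div_iff₀ hr1]
    nlinarith [mul_nonneg hC hr0]
  have h4 : 4 * C * M.rate s r ^ n / (1 - M.rate s r)
      ≤ 4 * C / (1 - M.rate s r) * M.rate s r ^ n * wt s r x := by
    rw [mul_div_right_comm]
    exact le_mul_of_one_le_right (by positivity) hw
  have h5 := abs_sub_le ((M.transOp ϑ)^[n] (g ϑ) x) ((M.transOp ϑ)^[n] (g ϑ) (0, 0))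
    (M.statMean ϑ (g ϑ))
  have h6 : 6 * C / (1 - M.rate s r) * M.rate s r ^ n * wt s r x =
    2 * C / (1 - M.rate s r) * M.rate s r ^ n * wt s r x +
    4 * C / (1 - M.rate s r) * M.rate s r ^ n * wt s r x := by ring
  linarith

/-- Stationary means are continuous in the parameter. -/
lemma Tame.continuousOn_statMean (hM : M.Regular) {s r C : ℝ} (hd : M.Drift s r)
    {g : Param → ℝ × ℝ → ℝ} (hg : M.Tame s r C g) :
    ContinuousOn (fun ϑ => M.statMean ϑ (g ϑ)) M.box := by
  -- At the empty state the weight equals one, so the ergodic error is independent of the parameter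
  -- and continuity passes to the limit.
  have hu : TendstoUniformlyOn (fun n ϑ => (M.transOp ϑ)^[n] (g ϑ) (0, 0))
      (fun ϑ => M.statMean ϑ (g ϑ)) atTop M.box := by
    have h0 : Tendsto (fun n : ℕ => 6 * C / (1 - M.rate s r) * M.rate s r ^ n * 1) atTop (𝓝 0) := by
      have := (tendsto_pow_atTop_nhds_zero_of_lt_one (rate_nonneg (M := M) s r)
        hd.rate_lt).const_mul (6 * C / (1 - M.rate s r))
      simpa using this
    rw [Metric.tendstoUniformlyOn_iff]
    intro ε hε
    filter_upwards [h0.eventually_lt_const hε] with n hn ϑ hϑ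
    rw [dist_comm, Real.dist_eq]
    refine lt_of_le_of_lt ?_ hn
    have := hg.abs_iterate_sub_statMean_le hM hd hϑ n zero_mem_stateSpace
    rwa [wt_zero] at this
  refine hu.continuousOn (Frequently.of_forall fun n => ?_)
  exact (hg.iterate hM hd n).cont.comp (f := fun ϑ : Param => (ϑ, ((0, 0) : ℝ × ℝ)))
    (by fun_prop) fun ϑ hϑ => ⟨hϑ, zero_mem_stateSpace⟩

end GIGI1

/-- The model functions are only known to be continuous on the feasible region, so measurability
along the algorithm is obtained by factoring through that set. -/
lemma ContinuousOn.measurable_comp_of_mem {α X Y : Type*} {_ : MeasurableSpace α}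
    [TopologicalSpace X] [MeasurableSpace X] [OpensMeasurableSpace X] [TopologicalSpace Y]
    [MeasurableSpace Y] [BorelSpace Y] {S : Set X} {f : X → Y} (hf : ContinuousOn f S)
    {q : α → X} (hq : Measurable q) (h : ∀ a, q a ∈ S) : Measurable fun a => f (q a) :=
  hf.domRestrict.measurable.comp (hq.subtype_mk (h := h))

namespace GIGI1

variable {M : GIGI1} {Ω : Type*} {mΩ : MeasurableSpace Ω} {P : Measure Ω}

/-! ### Noise sequences and their past -/

/-- An i.i.d. sequence of nonnegative pairs `(U_n, V_n)` with the law prescribed by the model. -/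
structure IsNoise (M : GIGI1) (P : Measure Ω) (ξ : ℕ → Ω → ℝ × ℝ) : Prop where
  measurable : ∀ n, Measurable (ξ n)
  nonneg : ∀ n ω, 0 ≤ (ξ n ω).1 ∧ 0 ≤ (ξ n ω).2
  law : ∀ n, P.map (ξ n) = M.noise
  indep : iIndepFun ξ P

/-- The σ-algebra generated by the noise with index below `m`. -/
@[reducible] def past (ξ : ℕ → Ω → ℝ × ℝ) (m : ℕ) : MeasurableSpace Ω :=
  ⨆ j ∈ Set.Iio m, MeasurableSpace.comap (ξ j) inferInstance

/-- The state process under a fixed parameter. -/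
def path (M : GIGI1) (ϑ : Param) (x : ℝ × ℝ) (s : ℕ → ℝ × ℝ) : ℕ → ℝ × ℝ
  | 0 => x
  | n + 1 => M.step ϑ (path M ϑ x s n) (s n)

variable {ξ : ℕ → Ω → ℝ × ℝ}

lemma past_mono {m n : ℕ} (h : m ≤ n) : past ξ m ≤ past ξ n :=
  biSup_mono fun _ hj => lt_of_lt_of_le hj h

lemma measurable_past {m j : ℕ} (h : j < m) : Measurable[past ξ m] (ξ j) := by
  have h1 : Measurable[MeasurableSpace.comap (ξ j) inferInstance] (ξ j) := comap_measurable _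
  exact h1.mono (le_iSup₂_of_le j h le_rfl) le_rfl

lemma IsNoise.past_le (hξ : M.IsNoise P ξ) (m : ℕ) : past ξ m ≤ mΩ :=
  iSup₂_le fun j _ => (hξ.measurable j).comap_le

lemma IsNoise.indepFun (hξ : M.IsNoise P ξ) {E : Type*} [MeasurableSpace E] {m : ℕ} {Y : Ω → E}
    (hY : Measurable[past ξ m] Y) : IndepFun Y (ξ m) P := by
  have h := indep_iSup_of_disjoint (m := fun j => MeasurableSpace.comap (ξ j) inferInstance)
    (fun j => (hξ.measurable j).comap_le) hξ.indep.iIndep (S := Set.Iio m) (T := {m}) (by simp)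
  refine indep_of_indep_of_le_right (indep_of_indep_of_le_left h hY.comap_le) ?_
  exact le_iSup₂_of_le (f := fun j (_ : j ∈ ({m} : Set ℕ)) =>
    MeasurableSpace.comap (ξ j) inferInstance) m rfl le_rfl

/-- Conditioning on the past in the form of Fubini's theorem: the present noise is independent of
whatever the past determines, so the joint law is a product. -/
lemma IsNoise.integral_eq [IsProbabilityMeasure P] (hξ : M.IsNoise P ξ) {E : Type*}
    [MeasurableSpace E] {m : ℕ}
    {Y : Ω → E} (hY : Measurable[past ξ m] Y) {Φ : E → ℝ × ℝ → ℝ}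
    (hΦ : Measurable (Function.uncurry Φ)) (hint : Integrable (fun ω => Φ (Y ω) (ξ m ω)) P) :
    ∫ ω, Φ (Y ω) (ξ m ω) ∂P = ∫ ω, ∫ uv, Φ (Y ω) uv ∂M.noise ∂P := by
  have hY' : Measurable Y := hY.mono (hξ.past_le m) le_rfl
  have hpair : Measurable fun ω => (Y ω, ξ m ω) := hY'.prodMk (hξ.measurable m)
  have hmap : P.map (fun ω => (Y ω, ξ m ω)) = (P.map Y).prod M.noise := by
    rw [(indepFun_iff_map_prod_eq_prod_map_map hY'.aemeasurable
      (hξ.measurable m).aemeasurable).1 (hξ.indepFun hY), hξ.law]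
  have : IsProbabilityMeasure (P.map Y) := Measure.isProbabilityMeasure_map hY'.aemeasurable
  have hint' : Integrable (Function.uncurry Φ) ((P.map Y).prod M.noise) := by
    rw [← hmap]
    exact (integrable_map_measure hΦ.aestronglyMeasurable hpair.aemeasurable).2 hint
  calc ∫ ω, Φ (Y ω) (ξ m ω) ∂P = ∫ z, Function.uncurry Φ z ∂(P.map fun ω => (Y ω, ξ m ω)) :=
        (integral_map hpair.aemeasurable hΦ.aestronglyMeasurable).symm
    _ = ∫ y, ∫ uv, Φ y uv ∂M.noise ∂(P.map Y) := by
        rw [hmap, integral_prod _ hint']; rfl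
    _ = _ := integral_map hY'.aemeasurable
        hint'.1.integral_prod_right'

lemma Regular.measurable_step_comp (hM : M.Regular) {α : Type*} {_ : MeasurableSpace α}
    {ϑ : α → Param} {x uv : α → ℝ × ℝ} (hϑ : Measurable ϑ) (hϑm : ∀ a, ϑ a ∈ M.box)
    (hx : Measurable x) (huv : Measurable uv) :
    Measurable fun a => M.step (ϑ a) (x a) (uv a) := by
  have hl : Measurable fun a => M.lam (ϑ a 1) := hM.continuousOn_lam.measurable_comp_of_mem hϑ hϑm
  have hm : Measurable fun a => ϑ a 0 :=
    (by fun_prop : Continuous fun ϑ : Param => ϑ 0).measurable.comp hϑ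
  have h1 : Measurable fun a => max ((x a).1 - (uv a).1 / M.lam (ϑ a 1) + (uv a).2 / ϑ a 0) 0 := by
    fun_prop
  exact h1.prodMk (Measurable.ite (measurableSet_lt measurable_const h1) (by fun_prop)
    measurable_const)

/-! ### One step driven by the noise -/

section OneStep

variable {m : ℕ} {ϑ : Ω → Param} {x : Ω → ℝ × ℝ} {b : Ω → ℝ}

lemma IsNoise.measurable_step (hM : M.Regular) (hϑ : Measurable[past ξ m] ϑ)
    (hϑm : ∀ ω, ϑ ω ∈ M.box) (hx : Measurable[past ξ m] x) :
    Measurable[past ξ (m + 1)] fun ω => M.step (ϑ ω) (x ω) (ξ m ω) := by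
  have hle := past_mono (ξ := ξ) (Nat.le_succ m)
  exact hM.measurable_step_comp (hϑ.mono hle le_rfl) hϑm (hx.mono hle le_rfl)
    (measurable_past (Nat.lt_succ_self m))

/-- The drift inequality, with the expectation split by independence. The factor `b` from the past
makes the estimate available for correlations as well as for moments. -/
lemma IsNoise.wt_step [IsProbabilityMeasure P] (hM : M.Regular) (hξ : M.IsNoise P ξ) {s r : ℝ}
    (hd : M.Drift s r) (hϑ : Measurable[past ξ m] ϑ) (hϑm : ∀ ω, ϑ ω ∈ M.box)
    (hx : Measurable[past ξ m] x) (hxm : ∀ ω, x ω ∈ stateSpace)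
    (hb : Measurable[past ξ m] b) (hb0 : ∀ ω, 0 ≤ b ω)
    (hint : Integrable (fun ω => b ω * wt s r (x ω)) P) :
    Integrable (fun ω => b ω * wt s r (M.step (ϑ ω) (x ω) (ξ m ω))) P ∧
      ∫ ω, b ω * wt s r (M.step (ϑ ω) (x ω) (ξ m ω)) ∂P
        ≤ M.rate s r * ∫ ω, b ω * wt s r (x ω) ∂P + ∫ ω, b ω ∂P := by
  have hle := hξ.past_le m
  have hbm := hb.mono hle le_rfl
  have hbi : Integrable b P := by
    refine hint.mono' hbm.aestronglyMeasurable (Eventually.of_forall fun ω => ?_)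
    rw [Real.norm_of_nonneg (hb0 ω)]
    exact le_mul_of_one_le_right (hb0 ω) (one_le_wt hd.s_pos.le hd.r_pos.le (hxm ω))
  have hmeas : Measurable fun ω => b ω * wt s r (M.step (ϑ ω) (x ω) (ξ m ω)) :=
    hbm.mul ((continuous_wt s r).measurable.comp
      ((IsNoise.measurable_step hM hϑ hϑm hx).mono (hξ.past_le _) le_rfl))
  have hY : Measurable[past ξ m] fun ω => b ω * wt s r (x ω) :=
    hb.mul ((continuous_wt s r).measurable.comp hx)
  have hX : Measurable (M.driftFactor s r) := (continuous_driftFactor s r).measurable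
  have hind : IndepFun (fun ω => b ω * wt s r (x ω)) (fun ω => M.driftFactor s r (ξ m ω)) P :=
    (hξ.indepFun hY).comp measurable_id hX
  have hXi : Integrable (fun ω => M.driftFactor s r (ξ m ω)) P := by
    have := hd.integrable
    rw [← hξ.law m] at this
    exact this.comp_measurable (hξ.measurable m)
  have hXe : ∫ ω, M.driftFactor s r (ξ m ω) ∂P = M.rate s r := by
    rw [rate, ← hξ.law m, integral_map (hξ.measurable m).aemeasurable hX.aestronglyMeasurable]
  have hprod := hind.integrable_mul hint hXi
  have hdom : ∀ ω, b ω * wt s r (M.step (ϑ ω) (x ω) (ξ m ω))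
      ≤ b ω * wt s r (x ω) * M.driftFactor s r (ξ m ω) + b ω := by
    intro ω
    have := mul_le_mul_of_nonneg_left (hM.wt_step_le (x := x ω) hd.s_pos.le hd.r_pos.le (hϑm ω)
      (hξ.nonneg m ω).1 (hξ.nonneg m ω).2) (hb0 ω)
    linarith
  have hi : Integrable (fun ω => b ω * wt s r (M.step (ϑ ω) (x ω) (ξ m ω))) P := by
    refine (hprod.add hbi).mono' hmeas.aestronglyMeasurable (Eventually.of_forall fun ω => ?_)
    rw [Real.norm_of_nonneg (mul_nonneg (hb0 ω) (wt_pos _ _ _).le)]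
    exact hdom ω
  refine ⟨hi, (integral_mono hi (hprod.add hbi) hdom).trans_eq ?_⟩
  rw [integral_add' hprod hbi]
  have := hind.integral_mul_eq_mul_integral hint.1 hXi.1
  simp only [Pi.mul_apply] at this ⊢
  rw [this, hXe, mul_comm]

lemma IsNoise.integral_step [IsProbabilityMeasure P] (hM : M.Regular) (hξ : M.IsNoise P ξ)
    {s r C : ℝ} (hd : M.Drift s r) {g : Param → ℝ × ℝ → ℝ} (hg : M.Tame s r C g)
    (hϑ : Measurable[past ξ m] ϑ) (hϑm : ∀ ω, ϑ ω ∈ M.box)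
    (hx : Measurable[past ξ m] x) (hxm : ∀ ω, x ω ∈ stateSpace)
    (hb : Measurable[past ξ m] b)
    (hint : Integrable (fun ω => b ω * wt s r (x ω)) P) :
    ∫ ω, b ω * g (ϑ ω) (M.step (ϑ ω) (x ω) (ξ m ω)) ∂P
      = ∫ ω, b ω * M.transOp (ϑ ω) (g (ϑ ω)) (x ω) ∂P := by
  -- Truncating the noise at zero keeps every step inside the state space, so the integrand is
  -- measurable everywhere; neither side changes, as the noise is nonnegative.
  let pos : ℝ × ℝ → ℝ × ℝ := fun uv => (max uv.1 0, max uv.2 0)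
  have hpos : Measurable pos := by
    have : Continuous pos := by fun_prop
    exact this.measurable
  let S : Set (Param × (ℝ × ℝ)) := M.box ×ˢ stateSpace
  let Φ : ℝ × S → ℝ × ℝ → ℝ := fun y uv => y.1 * g y.2.1.1 (M.step y.2.1.1 y.2.1.2 (pos uv))
  have hΦ : Measurable (Function.uncurry Φ) := by
    have h1 : Measurable fun z : (ℝ × S) × (ℝ × ℝ) => z.1.2.1 := by fun_prop
    have h2 : Measurable fun z : (ℝ × S) × (ℝ × ℝ) =>
        (z.1.2.1.1, M.step z.1.2.1.1 z.1.2.1.2 (pos z.2)) :=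
      (h1.fst).prodMk (hM.measurable_step_comp h1.fst (fun z => z.1.2.2.1) h1.snd
        (hpos.comp measurable_snd))
    have h3 := hg.cont.measurable_comp_of_mem h2 fun z =>
      ⟨z.1.2.2.1, hM.step_mem z.1.2.2.1 z.1.2.2.2 (le_max_right _ _)⟩
    exact (measurable_fst.comp measurable_fst).mul h3
  let Y : Ω → ℝ × S := fun ω => (b ω, ⟨(ϑ ω, x ω), hϑm ω, hxm ω⟩)
  have hY : Measurable[past ξ m] Y := hb.prodMk ((hϑ.prodMk hx).subtype_mk)
  have hC : 0 ≤ C := by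
    obtain ⟨ω⟩ := nonempty_of_isProbabilityMeasure P
    exact hg.nonneg (hϑm ω)
  have hposξ : ∀ ω, pos (ξ m ω) = ξ m ω := fun ω =>
    Prod.ext (max_eq_left (hξ.nonneg m ω).1) (max_eq_left (hξ.nonneg m ω).2)
  have hΦξ : ∀ ω, Φ (Y ω) (ξ m ω) = b ω * g (ϑ ω) (M.step (ϑ ω) (x ω) (ξ m ω)) := fun ω => by
    simp only [Φ, Y, hposξ]
  have hmem : ∀ ω, M.step (ϑ ω) (x ω) (ξ m ω) ∈ stateSpace := fun ω =>
    hM.step_mem (hϑm ω) (hxm ω) (hξ.nonneg m ω).1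
  have hint' : Integrable (fun ω => Φ (Y ω) (ξ m ω)) P := by
    have habs : Integrable (fun ω => |b ω| * wt s r (x ω)) P := by
      refine hint.norm.congr (Eventually.of_forall fun ω => ?_)
      simp [abs_of_pos (wt_pos s r (x ω))]
    have h1 := (IsNoise.wt_step hM hξ hd hϑ hϑm hx hxm (b := fun ω => |b ω|)
      ((continuous_abs.measurable).comp hb) (fun ω => abs_nonneg _) habs).1
    refine (h1.const_mul C).mono' ?_ (Eventually.of_forall fun ω => ?_)
    · exact (hΦ.comp ((hY.mono (hξ.past_le m) le_rfl).prodMk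
        (hξ.measurable m))).aestronglyMeasurable
    · rw [hΦξ, Real.norm_eq_abs, abs_mul, mul_left_comm]
      exact mul_le_mul_of_nonneg_left (hg.bound _ (hϑm ω) _ (hmem ω)) (abs_nonneg _)
  have key := hξ.integral_eq hY hΦ hint'
  simp only [hΦξ] at key
  rw [key]
  refine integral_congr_ae (Eventually.of_forall fun ω => ?_)
  simp only [Φ, Y]
  rw [integral_const_mul, hM.transOp_eq (hg.section (hϑm ω)) (hϑm ω) (hxm ω)]
  congr 1
  refine integral_congr_ae ?_
  filter_upwards [hM.noise_nonneg] with uv huv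
  have : pos uv = uv := Prod.ext (max_eq_left huv.1) (max_eq_left huv.2)
  rw [this]

end OneStep

/-! ### Paths with a parameter that is frozen at time `m` -/

section Path

variable {m : ℕ} {ϑ : Ω → Param} {x : Ω → ℝ × ℝ} {b : Ω → ℝ}

lemma Regular.path_mem (hM : M.Regular) {ϑ : Param} (hϑ : ϑ ∈ M.box) {x : ℝ × ℝ}
    (hx : x ∈ stateSpace) {s : ℕ → ℝ × ℝ} (hs : ∀ n, 0 ≤ (s n).1) (n : ℕ) :
    M.path ϑ x s n ∈ stateSpace := by
  induction n with
  | zero => exact hx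
  | succ n ih => exact hM.step_mem hϑ ih (hs n)

lemma IsNoise.path_mem (hM : M.Regular) (hξ : M.IsNoise P ξ) (hϑm : ∀ ω, ϑ ω ∈ M.box)
    (hxm : ∀ ω, x ω ∈ stateSpace) (n : ℕ) (ω : Ω) :
    M.path (ϑ ω) (x ω) (fun k => ξ (m + k) ω) n ∈ stateSpace :=
  hM.path_mem (hϑm ω) (hxm ω) (fun k => (hξ.nonneg (m + k) ω).1) n

lemma IsNoise.measurable_path (hM : M.Regular) (hϑ : Measurable[past ξ m] ϑ)
    (hϑm : ∀ ω, ϑ ω ∈ M.box) (hx : Measurable[past ξ m] x) (n : ℕ) :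
    Measurable[past ξ (m + n)] fun ω => M.path (ϑ ω) (x ω) (fun k => ξ (m + k) ω) n := by
  induction n with
  | zero => exact hx
  | succ n ih =>
    exact IsNoise.measurable_step hM (hϑ.mono (past_mono (Nat.le_add_right m n)) le_rfl) hϑm ih

lemma IsNoise.integrable_path [IsProbabilityMeasure P] (hM : M.Regular) (hξ : M.IsNoise P ξ)
    {s r : ℝ}
    (hd : M.Drift s r) (hϑ : Measurable[past ξ m] ϑ) (hϑm : ∀ ω, ϑ ω ∈ M.box)
    (hx : Measurable[past ξ m] x) (hxm : ∀ ω, x ω ∈ stateSpace)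
    (hb : Measurable[past ξ m] b)
    (hint : Integrable (fun ω => b ω * wt s r (x ω)) P) (n : ℕ) :
    Integrable (fun ω => b ω * wt s r (M.path (ϑ ω) (x ω) (fun k => ξ (m + k) ω) n)) P := by
  have habs : ∀ n, Integrable
      (fun ω => |b ω| * wt s r (M.path (ϑ ω) (x ω) (fun k => ξ (m + k) ω) n)) P := by
    intro n
    induction n with
    | zero =>
      refine hint.norm.congr (Eventually.of_forall fun ω => ?_)
      simp [abs_of_pos (wt_pos s r (x ω)), path]
    | succ n ih =>
      have hle := past_mono (ξ := ξ) (Nat.le_add_right m n)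
      exact (IsNoise.wt_step hM hξ hd (hϑ.mono hle le_rfl) hϑm
        (IsNoise.measurable_path hM hϑ hϑm hx n) (IsNoise.path_mem hM hξ hϑm hxm n)
        ((continuous_abs.measurable).comp (hb.mono hle le_rfl)) (fun ω => abs_nonneg _) ih).1
  refine (habs n).mono ?_ (Eventually.of_forall fun ω => ?_)
  · exact ((hb.mono (hξ.past_le m) le_rfl).mul ((continuous_wt s r).measurable.comp
      ((IsNoise.measurable_path hM hϑ hϑm hx n).mono (hξ.past_le _) le_rfl))).aestronglyMeasurable
  · simp

/-- The Markov property of a path with frozen parameter. -/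
lemma IsNoise.integral_path [IsProbabilityMeasure P] (hM : M.Regular) (hξ : M.IsNoise P ξ)
    {s r C : ℝ} (hd : M.Drift s r) {g : Param → ℝ × ℝ → ℝ} (hg : M.Tame s r C g)
    (hϑ : Measurable[past ξ m] ϑ) (hϑm : ∀ ω, ϑ ω ∈ M.box)
    (hx : Measurable[past ξ m] x) (hxm : ∀ ω, x ω ∈ stateSpace)
    (hb : Measurable[past ξ m] b)
    (hint : Integrable (fun ω => b ω * wt s r (x ω)) P) (n : ℕ) :
    ∫ ω, b ω * g (ϑ ω) (M.path (ϑ ω) (x ω) (fun k => ξ (m + k) ω) n) ∂P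
      = ∫ ω, b ω * (M.transOp (ϑ ω))^[n] (g (ϑ ω)) (x ω) ∂P := by
  -- The last step of the path is integrated out first. This replaces `g` by its image under the
  -- transition operator, hence the induction over all tame families.
  induction n generalizing C g with
  | zero => rfl
  | succ n ih =>
    have hle := past_mono (ξ := ξ) (Nat.le_add_right m n)
    have h1 := IsNoise.integral_step hM hξ hd hg (hϑ.mono hle le_rfl) hϑm
      (IsNoise.measurable_path hM hϑ hϑm hx n) (IsNoise.path_mem hM hξ hϑm hxm n)
      (hb.mono hle le_rfl) (IsNoise.integrable_path hM hξ hd hϑ hϑm hx hxm hb hint n)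
    simp only [Function.iterate_succ_apply]
    rw [← ih (hg.transOp hM hd)]
    exact h1

lemma Drift.one_le_inv {s r : ℝ} (hd : M.Drift s r) : 1 ≤ (1 - M.rate s r)⁻¹ := by
  have h0 := rate_nonneg (M := M) s r
  have h1 := hd.rate_lt
  exact (one_le_inv₀ (by linarith)).2 (by linarith)

/-- The moment bound `(1 - κ)⁻¹` is preserved by one step. -/
lemma IsNoise.moment_step [IsProbabilityMeasure P] (hM : M.Regular) (hξ : M.IsNoise P ξ) {s r : ℝ}
    (hd : M.Drift s r) (hϑ : Measurable[past ξ m] ϑ) (hϑm : ∀ ω, ϑ ω ∈ M.box)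
    (hx : Measurable[past ξ m] x) (hxm : ∀ ω, x ω ∈ stateSpace)
    (hint : Integrable (fun ω => wt s r (x ω)) P)
    (hle : ∫ ω, wt s r (x ω) ∂P ≤ (1 - M.rate s r)⁻¹) :
    Integrable (fun ω => wt s r (M.step (ϑ ω) (x ω) (ξ m ω))) P ∧
      ∫ ω, wt s r (M.step (ϑ ω) (x ω) (ξ m ω)) ∂P ≤ (1 - M.rate s r)⁻¹ := by
  obtain ⟨h1, h2⟩ := IsNoise.wt_step hM hξ hd hϑ hϑm hx hxm (b := fun _ => 1) measurable_const
    (fun _ => zero_le_one) (by simpa using hint)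
  simp only [one_mul, integral_const, probReal_univ, smul_eq_mul] at h1 h2
  refine ⟨h1, h2.trans ?_⟩
  have h0 := rate_nonneg (M := M) s r
  have h3 : M.rate s r * ∫ ω, wt s r (x ω) ∂P ≤ M.rate s r * (1 - M.rate s r)⁻¹ := by gcongr
  -- The bound is the fixed point of `m ↦ κ m + 1`, where `κ` is the rate.
  have h4 : M.rate s r * (1 - M.rate s r)⁻¹ + 1 = (1 - M.rate s r)⁻¹ := by
    have : 1 - M.rate s r ≠ 0 := by linarith [hd.rate_lt]
    field_simp
    ring
  linarith

lemma IsNoise.moment_path [IsProbabilityMeasure P] (hM : M.Regular) (hξ : M.IsNoise P ξ) {s r : ℝ}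
    (hd : M.Drift s r) (hϑ : Measurable[past ξ m] ϑ) (hϑm : ∀ ω, ϑ ω ∈ M.box)
    (hx : Measurable[past ξ m] x) (hxm : ∀ ω, x ω ∈ stateSpace)
    (hint : Integrable (fun ω => wt s r (x ω)) P)
    (hle : ∫ ω, wt s r (x ω) ∂P ≤ (1 - M.rate s r)⁻¹) (n : ℕ) :
    Integrable (fun ω => wt s r (M.path (ϑ ω) (x ω) (fun k => ξ (m + k) ω) n)) P ∧
      ∫ ω, wt s r (M.path (ϑ ω) (x ω) (fun k => ξ (m + k) ω) n) ∂P ≤ (1 - M.rate s r)⁻¹ := by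
  induction n with
  | zero => exact ⟨hint, hle⟩
  | succ n ih =>
    exact IsNoise.moment_step hM hξ hd (hϑ.mono (past_mono (Nat.le_add_right m n)) le_rfl) hϑm
      (IsNoise.measurable_path hM hϑ hϑm hx n) (IsNoise.path_mem hM hξ hϑm hxm n) ih.1 ih.2

end Path

end GIGI1

/-! ### Second moments of sums of weakly correlated variables -/

section WeakCorrelation

variable {Ω : Type*} {mΩ : MeasurableSpace Ω} {P : Measure Ω}

lemma integral_sum_sq_succ {A : ℕ → Ω → ℝ} (hint : ∀ i j, Integrable (fun ω => A i ω * A j ω) P)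
    (T : ℕ) :
    Integrable (fun ω => (∑ i ∈ Finset.range T, A i ω) ^ 2) P ∧
    ∫ ω, (∑ i ∈ Finset.range (T + 1), A i ω) ^ 2 ∂P
      = ∫ ω, (∑ i ∈ Finset.range T, A i ω) ^ 2 ∂P
        + 2 * ∑ i ∈ Finset.range T, ∫ ω, A i ω * A T ω ∂P + ∫ ω, A T ω * A T ω ∂P := by
  have h1 : Integrable (fun ω => (∑ i ∈ Finset.range T, A i ω) ^ 2) P := by
    have : (fun ω => (∑ i ∈ Finset.range T, A i ω) ^ 2) = fun ω =>
        ∑ i ∈ Finset.range T, ∑ j ∈ Finset.range T, A i ω * A j ω := by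
      funext ω
      rw [sq, Finset.sum_mul_sum]
    rw [this]
    exact integrable_finsetSum _ fun i _ => integrable_finsetSum _ fun j _ => hint i j
  have h2 : Integrable (fun ω => 2 * ∑ i ∈ Finset.range T, A i ω * A T ω) P :=
    (integrable_finsetSum _ fun i _ => hint i T).const_mul 2
  refine ⟨h1, ?_⟩
  have : (fun ω => (∑ i ∈ Finset.range (T + 1), A i ω) ^ 2) = fun ω =>
      (∑ i ∈ Finset.range T, A i ω) ^ 2 + 2 * ∑ i ∈ Finset.range T, A i ω * A T ω
        + A T ω * A T ω := by
    funext ω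
    rw [Finset.sum_range_succ, ← Finset.sum_mul]
    ring
  have h12 : Integrable (fun ω => (∑ i ∈ Finset.range T, A i ω) ^ 2
      + 2 * ∑ i ∈ Finset.range T, A i ω * A T ω) P := h1.add h2
  rw [this, integral_add h12 (hint T T), integral_add h1 h2, integral_const_mul,
    integral_finsetSum _ fun i _ => hint i T]

/-- Geometrically decaying correlations give a variance of order `T`. -/
lemma integral_sum_sq_le_of_geometric {A : ℕ → Ω → ℝ}
    (hint : ∀ i j, Integrable (fun ω => A i ω * A j ω) P) {D κ : ℝ} (hκ0 : 0 ≤ κ)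
    (hκ1 : κ < 1) (hcorr : ∀ i k, |∫ ω, A i ω * A (i + k) ω ∂P| ≤ D * κ ^ k) (T : ℕ) :
    ∫ ω, (∑ i ∈ Finset.range T, A i ω) ^ 2 ∂P ≤ 2 * D * (1 - κ)⁻¹ * T := by
  have hD : 0 ≤ D := by simpa using (abs_nonneg _).trans (hcorr 0 0)
  induction T with
  | zero => simp
  | succ T ih =>
    rw [(integral_sum_sq_succ hint T).2]
    have h1 : ∀ i ∈ Finset.range (T + 1), ∫ ω, A i ω * A T ω ∂P ≤ D * κ ^ (T - i) := by
      intro i hi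
      have := (le_abs_self _).trans (hcorr i (T - i))
      rwa [Nat.add_sub_cancel' (Nat.lt_succ_iff.1 (Finset.mem_range.1 hi))] at this
    have h2 := Finset.sum_le_sum h1
    rw [← Finset.mul_sum] at h2
    have h3 : ∑ i ∈ Finset.range (T + 1), κ ^ (T - i) ≤ (1 - κ)⁻¹ := by
      have := Finset.sum_range_reflect (fun k => κ ^ k) (T + 1)
      simp only [Nat.add_sub_cancel] at this
      rw [this, ← tsum_geometric_of_lt_one hκ0 hκ1]
      exact (summable_geometric_of_lt_one hκ0 hκ1).sum_le_tsum _ fun k _ => pow_nonneg hκ0 k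
    have h4 := mul_le_mul_of_nonneg_left h3 hD
    rw [Finset.sum_range_succ] at h2
    have h5 : 0 ≤ ∫ ω, A T ω * A T ω ∂P := integral_nonneg fun ω => mul_self_nonneg _
    push_cast
    linarith

/-- The sum of the squares has finite expectation, hence is finite almost surely, so its terms tend
to zero. -/
lemma ae_tendsto_zero_of_summable_integral_sq {Y : ℕ → Ω → ℝ}
    (hint : ∀ n, Integrable (fun ω => Y n ω ^ 2) P) {c : ℕ → ℝ} (hc : Summable c)
    (hle : ∀ n, ∫ ω, Y n ω ^ 2 ∂P ≤ c n) : ∀ᵐ ω ∂P, Tendsto (fun n => Y n ω) atTop (𝓝 0) := by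
  have h1 : ∑' n, ∫⁻ ω, ENNReal.ofReal (Y n ω ^ 2) ∂P ≠ ⊤ := by
    have hle' : ∀ n, ∫⁻ ω, ENNReal.ofReal (Y n ω ^ 2) ∂P ≤ ENNReal.ofReal (c n) := fun n => by
      rw [← ofReal_integral_eq_lintegral_ofReal (hint n) (Eventually.of_forall fun ω => sq_nonneg _)]
      exact ENNReal.ofReal_le_ofReal (hle n)
    exact ne_top_of_le_ne_top hc.tsum_ofReal_ne_top (ENNReal.tsum_le_tsum hle')
  have hm : ∀ n, AEMeasurable (fun ω => ENNReal.ofReal (Y n ω ^ 2)) P := fun n =>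
    (hint n).1.aemeasurable.ennreal_ofReal
  rw [← lintegral_tsum hm] at h1
  filter_upwards [ae_lt_top' (AEMeasurable.tsum hm) h1] with ω hω
  have h2 := ENNReal.tendsto_atTop_zero_of_tsum_ne_top hω.ne
  have h3 := (ENNReal.tendsto_toReal ENNReal.zero_ne_top).comp h2
  have h4 : Tendsto (fun n => Y n ω ^ 2) atTop (𝓝 0) := by
    refine h3.congr fun n => ?_
    simp [ENNReal.toReal_ofReal (sq_nonneg _)]
  have h5 := h4.sqrt
  simp only [Real.sqrt_sq_eq_abs, Real.sqrt_zero] at h5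
  exact (tendsto_zero_iff_abs_tendsto_zero _).2 h5

/-- Law of large numbers for nonnegative variables with variance of order `T`. -/
lemma ae_tendsto_average_of_integral_sq_le [IsProbabilityMeasure P] {Y : ℕ → Ω → ℝ} {l K : ℝ}
    (hY : ∀ n ω, 0 ≤ Y n ω)
    (hint : ∀ T : ℕ, Integrable (fun ω => (∑ i ∈ Finset.range T, (Y i ω - l)) ^ 2) P)
    (hle : ∀ T : ℕ, ∫ ω, (∑ i ∈ Finset.range T, (Y i ω - l)) ^ 2 ∂P ≤ K * T) :
    ∀ᵐ ω ∂P, Tendsto (fun T : ℕ => (∑ i ∈ Finset.range T, Y i ω) / T) atTop (𝓝 l) := by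
  -- Along the squares the variances of the averages are of order `n⁻²`, hence summable.
  have h1 : ∀ᵐ ω ∂P, Tendsto (fun n : ℕ =>
      ((n + 1 : ℝ) ^ 2)⁻¹ * ∑ i ∈ Finset.range ((n + 1) ^ 2), (Y i ω - l)) atTop (𝓝 0) := by
    refine ae_tendsto_zero_of_summable_integral_sq (c := fun n : ℕ => K * (1 / (n + 1 : ℝ) ^ 2))
      (fun n => ?_) ?_ fun n => ?_
    · simp only [mul_pow]
      exact (hint _).const_mul _
    · have h := (summable_nat_add_iff 1).2 (Real.summable_one_div_nat_pow.2 one_lt_two)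
      push_cast at h
      exact h.mul_left K
    · simp only [mul_pow]
      rw [integral_const_mul]
      have hpos : (0 : ℝ) < (n + 1 : ℝ) ^ 2 := by positivity
      calc _ ≤ (((n + 1 : ℝ) ^ 2)⁻¹) ^ 2 * (K * ((n + 1) ^ 2 : ℕ)) :=
            mul_le_mul_of_nonneg_left (hle _) (by positivity)
        _ = _ := by push_cast; field_simp
  filter_upwards [h1] with ω hω
  -- Nonnegativity makes the partial sums monotone, and consecutive squares have ratio tending to
  -- one; this fills the gaps between the squares.
  refine tendsto_div_of_monotone_of_exists_subseq_tendsto_div _ l ?_ fun a ha => ?_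
  · exact monotone_nat_of_le_succ fun n => by
      rw [Finset.sum_range_succ]
      exact le_add_of_nonneg_right (hY n ω)
  · refine ⟨fun n => (n + 1) ^ 2, ?_, ?_, ?_⟩
    · have hlim : Tendsto (fun n : ℕ => ((1 + 1 / ((n : ℝ) + 1)) ^ 2)) atTop (𝓝 1) := by
        have := (tendsto_one_div_add_atTop_nhds_zero_nat (𝕜 := ℝ)).const_add 1
        simpa using this.pow 2
      filter_upwards [hlim.eventually_lt_const ha] with n hn
      have hpos : (0 : ℝ) < (n : ℝ) + 1 := by positivity
      have e : (1 + 1 / ((n : ℝ) + 1)) ^ 2 * ((n : ℝ) + 1) ^ 2 = ((n : ℝ) + 1 + 1) ^ 2 := by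
        field_simp
      push_cast
      rw [← e]
      exact mul_le_mul_of_nonneg_right hn.le (by positivity)
    · exact tendsto_atTop_mono (fun n => (by nlinarith : n ≤ (n + 1) ^ 2)) tendsto_id
    · have h2 := hω.add_const l
      rw [zero_add] at h2
      refine h2.congr fun n => ?_
      have hpos : ((n : ℝ) + 1) ≠ 0 := by positivity
      rw [Finset.sum_sub_distrib]
      simp only [Finset.sum_const, Finset.card_range, nsmul_eq_mul]
      push_cast
      field_simp
      ring

end WeakCorrelation

/-! ### Little's law along a sample path -/

section Little

variable {a d : ℕ → ℝ}

/-- Up to time `R` the integral of the queue length is the total of the sojourn intervals cut off at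
`R`. Only customers arriving by `R` contribute, each at most its whole sojourn time, and those
departed by `R` contribute all of it. -/
lemma queue_integral_bounds (ha : Monotone a) (ha0 : 0 ≤ a 0) (had : ∀ n, a n ≤ d n) {R : ℝ}
    (hR : 0 ≤ R) {N : ℕ} (hN : R < a N) :
    ∫ r in (0 : ℝ)..R, (Set.ncard {n : ℕ | a n ≤ r ∧ r < d n} : ℝ)
        ≤ ∑ n ∈ Finset.range N, (d n - a n) ∧
    ∀ K : ℕ, (∀ n < K, d n ≤ R) → ∑ n ∈ Finset.range K, (d n - a n) ≤
      ∫ r in (0 : ℝ)..R, (Set.ncard {n : ℕ | a n ≤ r ∧ r < d n} : ℝ) := by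
  have hfin : ∀ r ∈ Set.Ioc 0 R, (Set.ncard {n : ℕ | a n ≤ r ∧ r < d n} : ℝ) =
      ∑ n ∈ Finset.range N, (Set.Ico (a n) (d n)).indicator (fun _ => (1 : ℝ)) r := by
    intro r hr
    have hset : {n : ℕ | a n ≤ r ∧ r < d n} =
        ((Finset.range N).filter fun n => r ∈ Set.Ico (a n) (d n) : Finset ℕ) := by
      ext n
      simp only [Set.mem_ofPred_eq, Finset.coe_filter, Finset.mem_range, Set.mem_Ico]
      refine ⟨fun h => ⟨?_, h⟩, fun h => h.2⟩
      by_contra! hn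
      linarith [ha hn, h.1, hr.2]
    rw [hset, Set.ncard_coe_finset, Finset.card_filter]
    push_cast
    simp [Set.indicator_apply]
  have hintegrable : ∀ n, IntegrableOn
      (fun r => (Set.Ico (a n) (d n)).indicator (fun _ => (1 : ℝ)) r) (Set.Ioc 0 R) := fun n =>
    ((integrable_const (1 : ℝ)).indicator measurableSet_Ico)
  have heq : ∫ r in (0 : ℝ)..R, (Set.ncard {n : ℕ | a n ≤ r ∧ r < d n} : ℝ) =
      ∑ n ∈ Finset.range N, volume.real (Set.Ico (a n) (d n) ∩ Set.Ioc 0 R) := by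
    rw [intervalIntegral.integral_of_le hR, setIntegral_congr_fun measurableSet_Ioc hfin,
      integral_finsetSum _ fun n _ => hintegrable n]
    refine Finset.sum_congr rfl fun n _ => ?_
    rw [integral_indicator measurableSet_Ico, Measure.restrict_restrict measurableSet_Ico]
    simp
  have hle : ∀ n, volume.real (Set.Ico (a n) (d n) ∩ Set.Ioc 0 R) ≤ d n - a n := fun n => by
    refine (measureReal_mono Set.inter_subset_left (by simp)).trans ?_
    simp [Measure.real, had n]
  rw [heq]
  refine ⟨Finset.sum_le_sum fun n _ => hle n, fun K hK => ?_⟩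
  have hKN : K ≤ N := by
    by_contra! h
    linarith [hK N h, had N]
  refine le_trans ?_ (Finset.sum_le_sum_of_subset_of_nonneg (Finset.range_mono hKN)
    fun n _ _ => measureReal_nonneg)
  refine Finset.sum_le_sum fun n hn => ?_
  have hsub : Set.Ioo (a n) (d n) ⊆ Set.Ico (a n) (d n) ∩ Set.Ioc 0 R := fun r hr =>
    ⟨⟨hr.1.le, hr.2⟩, (ha0.trans (ha (Nat.zero_le n))).trans_lt hr.1,
      hr.2.le.trans (hK n (Finset.mem_range.1 hn))⟩
  refine le_trans ?_ (measureReal_mono hsub ?_)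
  · simp [Measure.real, had n]
  · exact ((measure_mono Set.inter_subset_left).trans_lt (by simp)).ne

/-- Little's law for a sample path. -/
lemma tendsto_queue_average (ha : Monotone a) (ha0 : 0 ≤ a 0) (hd : Monotone d)
    (had : ∀ n, a n ≤ d n) {α l : ℝ} (hα : 0 < α)
    (hlima : Tendsto (fun n : ℕ => a n / n) atTop (𝓝 α))
    (hlim : Tendsto (fun N : ℕ => (∑ n ∈ Finset.range N, (d n - a n)) / N) atTop (𝓝 l)) :
    Tendsto (fun R : ℝ => R⁻¹ * ∫ r in (0 : ℝ)..R,
      (Set.ncard {n : ℕ | a n ≤ r ∧ r < d n} : ℝ)) atTop (𝓝 (α⁻¹ * l)) := by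
  set G : ℕ → ℝ := fun N => ∑ n ∈ Finset.range N, (d n - a n) with hG
  -- A single sojourn time is a difference of consecutive partial sums of an averaging sequence,
  -- hence `o(n)`; departures therefore grow at the same rate as arrivals.
  have hlimd : Tendsto (fun n : ℕ => d n / n) atTop (𝓝 α) := by
    have h1 : Tendsto (fun n : ℕ => G (n + 1) / ((n + 1 : ℕ) : ℝ) * (1 + 1 / (n : ℝ)))
        atTop (𝓝 (l * (1 + 0))) :=
      ((tendsto_add_atTop_iff_nat 1).2 hlim).mul
        (tendsto_one_div_atTop_nhds_zero_nat.const_add 1)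
    have h2 := hlima.add (h1.sub hlim)
    rw [add_zero, mul_one, sub_self, add_zero] at h2
    refine h2.congr' ?_
    filter_upwards [eventually_ge_atTop 1] with n hn
    have : (0 : ℝ) < n := by exact_mod_cast hn
    simp only [hG, Finset.sum_range_succ]
    push_cast
    field_simp
    ring
  -- composition with integer parts of multiples
  have hcomp : ∀ {u : ℕ → ℝ} {v c : ℝ} {k : ℝ → ℕ}, 0 < c →
      Tendsto (fun n : ℕ => u n / n) atTop (𝓝 v) →
      Tendsto (fun R : ℝ => (k R : ℝ) / R) atTop (𝓝 c) →
      Tendsto (fun R : ℝ => u (k R) / R) atTop (𝓝 (v * c)) := by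
    intro u v c k hc hu hk
    have hk' : Tendsto (fun R : ℝ => (k R : ℝ)) atTop atTop := by
      refine (hk.pos_mul_atTop hc tendsto_id).congr' ?_
      filter_upwards [eventually_gt_atTop 0] with R hR
      simp only [id]
      field_simp
    have hkN : Tendsto k atTop atTop := tendsto_natCast_atTop_iff.1 hk'
    refine ((hu.comp hkN).mul hk).congr' ?_
    filter_upwards [hk'.eventually_gt_atTop 0, eventually_gt_atTop 0] with R h1 h2
    simp only [Function.comp_apply]
    field_simp
  -- For `c` above the arrival rate `α⁻¹`, customer `⌈c R⌉` has not arrived by time `R`. Below, for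
  -- `c` less than the rate, the first `⌊c R⌋` customers have left by time `R`.
  have hupper : ∀ c > α⁻¹, ∀ᶠ R : ℝ in atTop,
      R⁻¹ * ∫ r in (0 : ℝ)..R, (Set.ncard {n : ℕ | a n ≤ r ∧ r < d n} : ℝ)
        ≤ G ⌈c * R⌉₊ / R := by
    intro c hc
    have hc0 : 0 < c := (inv_pos.2 hα).trans hc
    have hac : 1 < α * c := by
      have := mul_lt_mul_of_pos_left hc hα
      rwa [mul_inv_cancel₀ hα.ne'] at this
    filter_upwards [(hcomp hc0 hlima (tendsto_nat_ceil_mul_div_atTop hc0.le)).eventually_const_lt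
      hac, eventually_gt_atTop 0] with R h1 hR
    rw [one_lt_div hR] at h1
    rw [div_eq_inv_mul]
    exact mul_le_mul_of_nonneg_left (queue_integral_bounds ha ha0 had hR.le h1).1
      (inv_pos.2 hR).le
  have hlower : ∀ c, 0 < c → c < α⁻¹ → ∀ᶠ R : ℝ in atTop, G ⌊c * R⌋₊ / R ≤
      R⁻¹ * ∫ r in (0 : ℝ)..R, (Set.ncard {n : ℕ | a n ≤ r ∧ r < d n} : ℝ) := by
    intro c hc0 hc
    have hac : α * c < 1 := by
      have := mul_lt_mul_of_pos_left hc hα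
      rwa [mul_inv_cancel₀ hα.ne'] at this
    -- Any constant above `α⁻¹` would do; it only supplies a customer arriving after `R`.
    have hc0' : 0 < α⁻¹ + 1 := by positivity
    have hac' : 1 < α * (α⁻¹ + 1) := by
      rw [mul_add, mul_inv_cancel₀ hα.ne']; linarith
    filter_upwards [(hcomp hc0 hlimd (tendsto_nat_floor_mul_div_atTop hc0.le)).eventually_lt_const
      hac, (hcomp hc0' hlima (tendsto_nat_ceil_mul_div_atTop hc0'.le)).eventually_const_lt hac',
      eventually_gt_atTop 0] with R h1 h2 hR
    rw [div_lt_one hR] at h1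
    rw [one_lt_div hR] at h2
    rw [div_eq_inv_mul]
    exact mul_le_mul_of_nonneg_left ((queue_integral_bounds ha ha0 had hR.le h2).2 _
      fun n hn => (hd hn.le).trans h1.le) (inv_pos.2 hR).le
  have hmul : Tendsto (fun c : ℝ => l * c) (𝓝 α⁻¹) (𝓝 (α⁻¹ * l)) := by
    have : Continuous fun c : ℝ => l * c := by fun_prop
    convert this.tendsto α⁻¹ using 2
    ring
  refine tendsto_order.2 ⟨fun v hv => ?_, fun v hv => ?_⟩
  · obtain ⟨c, hc1, hc2, hc3⟩ := (((hmul.eventually_const_lt hv).filter_mono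
      nhdsWithin_le_nhds).and (Ioo_mem_nhdsLT (inv_pos.2 hα))).exists
    filter_upwards [hlower c hc2 hc3, (hcomp hc2 hlim
      (tendsto_nat_floor_mul_div_atTop hc2.le)).eventually_const_lt hc1] with R h1 h2
    exact h2.trans_le h1
  · obtain ⟨c, hc1, hc2⟩ := (((hmul.eventually_lt_const hv).filter_mono
      nhdsWithin_le_nhds).and (self_mem_nhdsWithin (s := Set.Ioi α⁻¹))).exists
    have hc0 : 0 < c := (inv_pos.2 hα).trans hc2
    filter_upwards [hupper c hc2, (hcomp hc0 hlim
      (tendsto_nat_ceil_mul_div_atTop hc0.le)).eventually_lt_const hc1] with R h1 h2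
    exact h1.trans_lt h2

end Little

namespace GIGI1

variable {M : GIGI1} {Ω : Type*} {mΩ : MeasurableSpace Ω} {P : Measure Ω}
  {ξ : ℕ → Ω → ℝ × ℝ}

/-- The conditional variance is quadratic in the Poisson solution and so has the weight with
exponents `2 s, 2 r`; its law of large numbers needs second and fourth moments of that weight, which
leads to the factors four and eight. -/
lemma Regular.exists_drift_eight (hM : M.Regular) :
    ∃ s r, M.Drift s r ∧ M.Drift (2 * s) (2 * r) ∧ M.Drift (4 * s) (4 * r) ∧
      M.Drift (8 * s) (8 * r) := by
  obtain ⟨s, r, h⟩ := hM.exists_drift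
  refine ⟨1 / 8 * s, 1 / 8 * r, h.scale (by norm_num) (by norm_num), ?_, ?_, ?_⟩
  · convert h.scale (c := 1 / 4) (by norm_num) (by norm_num) using 1 <;> ring
  · convert h.scale (c := 1 / 2) (by norm_num) (by norm_num) using 1 <;> ring
  · convert h using 1 <;> ring

lemma fst_le_wt {s r : ℝ} (hs : 0 < s) (hr : 0 < r) {x : ℝ × ℝ} (hx : x ∈ stateSpace) :
    x.1 ≤ s⁻¹ * wt s r x := by
  have h1 := Real.add_one_le_exp (s * x.1 + r * x.2)
  have h2 : 0 ≤ r * x.2 := mul_nonneg hr.le hx.2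
  rw [inv_mul_eq_div, le_div_iff₀ hs, wt]
  linarith

lemma snd_le_wt {s r : ℝ} (hs : 0 < s) (hr : 0 < r) {x : ℝ × ℝ} (hx : x ∈ stateSpace) :
    x.2 ≤ r⁻¹ * wt s r x := by
  have h1 := Real.add_one_le_exp (s * x.1 + r * x.2)
  have h2 : 0 ≤ s * x.1 := mul_nonneg hs.le hx.1
  rw [inv_mul_eq_div, le_div_iff₀ hr, wt]
  linarith

lemma tame_fst {s r : ℝ} (hs : 0 < s) (hr : 0 < r) : M.Tame s r s⁻¹ fun _ x => x.1 :=
  Tame.of_const continuousOn_fst fun x hx => by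
    rw [abs_of_nonneg hx.1]; exact fst_le_wt hs hr hx

lemma tame_add {s r : ℝ} (hs : 0 < s) (hr : 0 < r) :
    M.Tame s r (s⁻¹ + r⁻¹) fun _ x => x.1 + x.2 :=
  Tame.of_const (by fun_prop) fun x hx => by
    rw [abs_of_nonneg (add_nonneg hx.1 hx.2), add_mul]
    exact add_le_add (fst_le_wt hs hr hx) (snd_le_wt hs hr hx)

lemma path_add (ϑ : Param) (x : ℝ × ℝ) (s : ℕ → ℝ × ℝ) (i k : ℕ) :
    M.path ϑ (M.path ϑ x s i) (fun j => s (i + j)) k = M.path ϑ x s (i + k) := by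
  induction k with
  | zero => rfl
  | succ k ih => simp only [path, ih]; rfl

section Correlation

variable {m : ℕ} {ϑ : Ω → Param} {x : Ω → ℝ × ℝ} {b : Ω → ℝ}

lemma IsNoise.integrable_mul_path [IsProbabilityMeasure P] (hM : M.Regular) (hξ : M.IsNoise P ξ)
    {s r C : ℝ} (hd : M.Drift s r) {g : Param → ℝ × ℝ → ℝ} (hg : M.Tame s r C g)
    (hϑ : Measurable[past ξ m] ϑ) (hϑm : ∀ ω, ϑ ω ∈ M.box)
    (hx : Measurable[past ξ m] x) (hxm : ∀ ω, x ω ∈ stateSpace)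
    (hb : Measurable[past ξ m] b)
    (hint : Integrable (fun ω => b ω * wt s r (x ω)) P) (n : ℕ) :
    Integrable (fun ω => b ω * g (ϑ ω) (M.path (ϑ ω) (x ω) (fun k => ξ (m + k) ω) n)) P := by
  have h1 := IsNoise.integrable_path hM hξ hd hϑ hϑm hx hxm hb hint n
  have hp := IsNoise.measurable_path hM hϑ hϑm hx n
  have hle := past_mono (ξ := ξ) (Nat.le_add_right m n)
  have hmeas : Measurable[past ξ (m + n)]
      fun ω => b ω * g (ϑ ω) (M.path (ϑ ω) (x ω) (fun k => ξ (m + k) ω) n) :=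
    (hb.mono hle le_rfl).mul (hg.cont.measurable_comp_of_mem ((hϑ.mono hle le_rfl).prodMk hp)
      fun ω => ⟨hϑm ω, IsNoise.path_mem hM hξ hϑm hxm n ω⟩)
  refine (h1.norm.const_mul C).mono' (hmeas.mono (hξ.past_le _) le_rfl).aestronglyMeasurable
    (Eventually.of_forall fun ω => ?_)
  rw [norm_mul, norm_mul, mul_left_comm, Real.norm_of_nonneg (wt_pos _ _ _).le]
  exact mul_le_mul_of_nonneg_left (hg.bound _ (hϑm ω) _ (IsNoise.path_mem hM hξ hϑm hxm n ω))
    (norm_nonneg _)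

lemma Tame.abs_statMean_le (hM : M.Regular) {s r C : ℝ} (hd : M.Drift s r)
    {g : Param → ℝ × ℝ → ℝ} (hg : M.Tame s r C g) {ϑ : Param} (hϑ : ϑ ∈ M.box) :
    |M.statMean ϑ (g ϑ)| ≤ C + 6 * C / (1 - M.rate s r) := by
  have h1 := hg.abs_iterate_sub_statMean_le hM hd hϑ 0 zero_mem_stateSpace
  have h2 := hg.bound ϑ hϑ _ zero_mem_stateSpace
  simp only [Function.iterate_zero, id_eq, pow_zero, mul_one, wt_zero] at h1 h2
  have h3 := abs_sub (g ϑ (0, 0)) (g ϑ (0, 0) - M.statMean ϑ (g ϑ))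
  rw [sub_sub_cancel] at h3
  linarith

/-- Decay of the correlation of the past with the centered future. -/
lemma IsNoise.abs_integral_mul_path_le [IsProbabilityMeasure P] (hM : M.Regular)
    (hξ : M.IsNoise P ξ)
    {s r C : ℝ} (hd : M.Drift s r) {g : Param → ℝ × ℝ → ℝ} (hg : M.Tame s r C g)
    (hϑ : Measurable[past ξ m] ϑ) (hϑm : ∀ ω, ϑ ω ∈ M.box)
    (hx : Measurable[past ξ m] x) (hxm : ∀ ω, x ω ∈ stateSpace)
    (hb : Measurable[past ξ m] b)
    (hint : Integrable (fun ω => b ω * wt s r (x ω)) P) (n : ℕ) :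
    |∫ ω, b ω * (g (ϑ ω) (M.path (ϑ ω) (x ω) (fun k => ξ (m + k) ω) n)
        - M.statMean (ϑ ω) (g (ϑ ω))) ∂P|
      ≤ 6 * C / (1 - M.rate s r) * M.rate s r ^ n * ∫ ω, |b ω| * wt s r (x ω) ∂P := by
  have hbi : Integrable b P := by
    refine hint.mono (hb.mono (hξ.past_le m) le_rfl).aestronglyMeasurable
      (Eventually.of_forall fun ω => ?_)
    rw [norm_mul]
    refine le_mul_of_one_le_right (norm_nonneg _) ?_
    rw [Real.norm_of_nonneg (wt_pos _ _ _).le]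
    exact one_le_wt hd.s_pos.le hd.r_pos.le (hxm ω)
  have habs : Integrable (fun ω => |b ω| * wt s r (x ω)) P := by
    refine hint.norm.congr (Eventually.of_forall fun ω => ?_)
    simp [abs_of_pos (wt_pos s r (x ω))]
  have h1 := IsNoise.integrable_mul_path hM hξ hd hg hϑ hϑm hx hxm hb hint n
  have h2 := IsNoise.integral_path hM hξ hd hg hϑ hϑm hx hxm hb hint n
  have h3 : Integrable (fun ω => b ω * (M.transOp (ϑ ω))^[n] (g (ϑ ω)) (x ω)) P :=
    IsNoise.integrable_mul_path hM hξ hd (hg.iterate hM hd n) hϑ hϑm hx hxm hb hint 0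
  have h4 : Integrable (fun ω => b ω * M.statMean (ϑ ω) (g (ϑ ω))) P := by
    refine hbi.mul_bdd ((hg.continuousOn_statMean hM hd).measurable_comp_of_mem
      (hϑ.mono (hξ.past_le m) le_rfl) hϑm).aestronglyMeasurable
      (Eventually.of_forall fun ω => hg.abs_statMean_le hM hd (hϑm ω))
  have e : ∫ ω, b ω * (g (ϑ ω) (M.path (ϑ ω) (x ω) (fun k => ξ (m + k) ω) n)
        - M.statMean (ϑ ω) (g (ϑ ω))) ∂P
      = ∫ ω, b ω * ((M.transOp (ϑ ω))^[n] (g (ϑ ω)) (x ω) - M.statMean (ϑ ω) (g (ϑ ω))) ∂P := by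
    simp only [mul_sub]
    rw [integral_sub h1 h4, integral_sub h3 h4, h2]
  rw [e, ← integral_const_mul, ← Real.norm_eq_abs]
  refine norm_integral_le_of_norm_le (habs.const_mul _) (Eventually.of_forall fun ω => ?_)
  rw [norm_mul, Real.norm_eq_abs, mul_left_comm]
  exact mul_le_mul_of_nonneg_left (hg.abs_iterate_sub_statMean_le hM hd (hϑm ω) n (hxm ω))
    (abs_nonneg _)

end Correlation

/-! ### The law of large numbers under a constant parameter -/

section LargeNumbers

variable {ϑ : Param}

lemma IsNoise.measurable_path_zero (hM : M.Regular) (hϑ : ϑ ∈ M.box) (n : ℕ) :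
    Measurable[past ξ n] fun ω => M.path ϑ (0, 0) (fun k => ξ k ω) n := by
  induction n with
  | zero => exact measurable_const
  | succ n ih => exact IsNoise.measurable_step hM measurable_const (fun _ => hϑ) ih

lemma IsNoise.path_zero_mem (hM : M.Regular) (hξ : M.IsNoise P ξ) (hϑ : ϑ ∈ M.box) (n : ℕ)
    (ω : Ω) : M.path ϑ (0, 0) (fun k => ξ k ω) n ∈ stateSpace :=
  hM.path_mem hϑ zero_mem_stateSpace (fun k => (hξ.nonneg k ω).1) n

lemma IsNoise.moment_path_zero [IsProbabilityMeasure P] (hM : M.Regular) (hξ : M.IsNoise P ξ)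
    {s r : ℝ} (hd : M.Drift s r) (hϑ : ϑ ∈ M.box) (n : ℕ) :
    Integrable (fun ω => wt s r (M.path ϑ (0, 0) (fun k => ξ k ω) n)) P ∧
      ∫ ω, wt s r (M.path ϑ (0, 0) (fun k => ξ k ω) n) ∂P ≤ (1 - M.rate s r)⁻¹ := by
  have hc : Measurable[past ξ 0] fun _ : Ω => ϑ := measurable_const
  have h0 : Measurable[past ξ 0] fun _ : Ω => ((0, 0) : ℝ × ℝ) := measurable_const
  have := IsNoise.moment_path hM hξ hd hc (fun _ => hϑ) h0 (fun _ => zero_mem_stateSpace)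
    (by simp) (by simpa [wt_zero] using hd.one_le_inv) n
  simpa only [zero_add] using this

lemma IsNoise.integral_path_zero [IsProbabilityMeasure P] (hM : M.Regular) (hξ : M.IsNoise P ξ)
    {s r C : ℝ} (hd : M.Drift s r) {ψ : ℝ × ℝ → ℝ} (hψ : M.Tame s r C fun _ => ψ)
    (hϑ : ϑ ∈ M.box) (n : ℕ) :
    Integrable (fun ω => ψ (M.path ϑ (0, 0) (fun k => ξ k ω) n)) P ∧
    ∫ ω, ψ (M.path ϑ (0, 0) (fun k => ξ k ω) n) ∂P = (M.transOp ϑ)^[n] ψ (0, 0) := by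
  have hc : Measurable[past ξ 0] fun _ : Ω => ϑ := measurable_const
  have h0 : Measurable[past ξ 0] fun _ : Ω => ((0, 0) : ℝ × ℝ) := measurable_const
  have h1 : Measurable[past ξ 0] fun _ : Ω => (1 : ℝ) := measurable_const
  have h2 := IsNoise.integrable_mul_path hM hξ hd hψ hc (fun _ => hϑ) h0
    (fun _ => zero_mem_stateSpace) h1 (by simp) n
  have h3 := IsNoise.integral_path hM hξ hd hψ hc (fun _ => hϑ) h0
    (fun _ => zero_mem_stateSpace) h1 (by simp) n
  simp only [zero_add, one_mul, integral_const, probReal_univ, one_smul] at h2 h3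
  exact ⟨h2, h3⟩

lemma abs_mul_le_of_le_wt {s r B u v : ℝ} {x y : ℝ × ℝ} (hB : 0 ≤ B) (hu : |u| ≤ B * wt s r x)
    (hv : |v| ≤ B * wt s r y) :
    |u * v| ≤ B ^ 2 * (wt (2 * s) (2 * r) x + wt (2 * s) (2 * r) y) := by
  have e : ∀ z, wt (2 * s) (2 * r) z = wt s r z ^ 2 := fun z => by
    have := wt_pow s r 2 z
    push_cast at this
    exact this.symm
  rw [abs_mul, e, e]
  have h1 := mul_le_mul hu hv (abs_nonneg _) (mul_nonneg hB (wt_pos _ _ _).le)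
  have h2 : wt s r x * wt s r y ≤ wt s r x ^ 2 + wt s r y ^ 2 := by
    nlinarith [sq_nonneg (wt s r x - wt s r y), sq_nonneg (wt s r x), sq_nonneg (wt s r y)]
  calc _ ≤ B * wt s r x * (B * wt s r y) := h1
    _ = B ^ 2 * (wt s r x * wt s r y) := by ring
    _ ≤ _ := mul_le_mul_of_nonneg_left h2 (sq_nonneg B)

/-- The summand with index `i` is determined by the noise before `i`, so its correlation with the
one `k` steps later decays like the ergodic error after `k` steps. Variance of order `T` then
suffices. -/
lemma IsNoise.ae_tendsto_average [IsProbabilityMeasure P] (hM : M.Regular) (hξ : M.IsNoise P ξ)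
    {s r C : ℝ} (hd : M.Drift s r) (hd2 : M.Drift (2 * s) (2 * r)) {ψ : ℝ × ℝ → ℝ}
    (hψ : M.Tame s r C fun _ => ψ) (hψ0 : ∀ x ∈ stateSpace, 0 ≤ ψ x) (hϑ : ϑ ∈ M.box) :
    ∀ᵐ ω ∂P, Tendsto (fun T : ℕ =>
      (∑ i ∈ Finset.range T, ψ (M.path ϑ (0, 0) (fun k => ξ k ω) i)) / T) atTop
      (𝓝 (M.statMean ϑ ψ)) := by
  set l := M.statMean ϑ ψ with hl
  set X : ℕ → Ω → ℝ × ℝ := fun i ω => M.path ϑ (0, 0) (fun k => ξ k ω) i with hX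
  have hXm : ∀ i ω, X i ω ∈ stateSpace := IsNoise.path_zero_mem hM hξ hϑ
  have hXmeas : ∀ i, Measurable[past ξ i] (X i) := IsNoise.measurable_path_zero hM hϑ
  have hC := hψ.nonneg hϑ
  set B := C + |l| with hB
  have hB0 : 0 ≤ B := by positivity
  set A : ℕ → Ω → ℝ := fun i ω => ψ (X i ω) - l with hA
  have hAmeas : ∀ i, Measurable[past ξ i] (A i) := fun i =>
    ((hψ.section hϑ).measurable_comp_of_mem (hXmeas i) (hXm i)).sub measurable_const
  have hAb : ∀ i ω, |A i ω| ≤ B * wt s r (X i ω) := fun i ω => by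
    have h1 := hψ.bound ϑ hϑ _ (hXm i ω)
    have h2 := abs_sub (ψ (X i ω)) l
    have h3 : |l| * 1 ≤ |l| * wt s r (X i ω) :=
      mul_le_mul_of_nonneg_left (one_le_wt hd.s_pos.le hd.r_pos.le (hXm i ω)) (abs_nonneg _)
    simp only [hA]
    rw [hB, add_mul]
    linarith
  have hw := fun i => IsNoise.moment_path_zero hM hξ hd2 hϑ i
  have hAi : ∀ i j, Integrable (fun ω => A i ω * A j ω) P := fun i j => by
    refine (((hw i).1.add (hw j).1).const_mul (B ^ 2)).mono'
      (((hAmeas i).mono (hξ.past_le i) le_rfl).mul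
        ((hAmeas j).mono (hξ.past_le j) le_rfl)).aestronglyMeasurable
      (Eventually.of_forall fun ω => ?_)
    exact abs_mul_le_of_le_wt hB0 (hAb i ω) (hAb j ω)
  have hwpos : ∀ i ω, |wt s r (X i ω)| ≤ 1 * wt s r (X i ω) := fun i ω => by
    rw [abs_of_pos (wt_pos _ _ _), one_mul]
  have hAw : ∀ i, Integrable (fun ω => A i ω * wt s r (X i ω)) P := fun i => by
    refine (((hw i).1.add (hw i).1).const_mul ((B + 1) ^ 2)).mono'
      (((hAmeas i).mono (hξ.past_le i) le_rfl).mul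
        ((continuous_wt s r).measurable.comp
          ((hXmeas i).mono (hξ.past_le i) le_rfl))).aestronglyMeasurable
      (Eventually.of_forall fun ω => ?_)
    refine abs_mul_le_of_le_wt (by positivity) ((hAb i ω).trans ?_) ((hwpos i ω).trans ?_) <;>
    · refine mul_le_mul_of_nonneg_right ?_ (wt_pos _ _ _).le
      linarith
  have hAwle : ∀ i, ∫ ω, |A i ω| * wt s r (X i ω) ∂P ≤ B * (1 - M.rate (2 * s) (2 * r))⁻¹ := by
    intro i
    calc _ ≤ ∫ ω, B * wt (2 * s) (2 * r) (X i ω) ∂P := by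
          refine integral_mono_of_nonneg (Eventually.of_forall fun ω =>
            mul_nonneg (abs_nonneg _) (wt_pos _ _ _).le) ((hw i).1.const_mul B)
            (Eventually.of_forall fun ω => ?_)
          have e := wt_pow s r 2 (X i ω)
          push_cast at e
          simp only [← e]
          nlinarith [hAb i ω, wt_pos s r (X i ω)]
      _ ≤ _ := by
          rw [integral_const_mul]
          exact mul_le_mul_of_nonneg_left (hw i).2 hB0
  have hr1 := sub_pos.2 hd.rate_lt
  have hcorr : ∀ i k, |∫ ω, A i ω * A (i + k) ω ∂P| ≤
      6 * C / (1 - M.rate s r) * (B * (1 - M.rate (2 * s) (2 * r))⁻¹) * M.rate s r ^ k := by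
    intro i k
    have h := IsNoise.abs_integral_mul_path_le hM hξ hd hψ measurable_const (fun _ => hϑ) (hXmeas i)
      (hXm i) (hAmeas i)
      (hAw i) k
    have e : ∀ ω, M.path ϑ (X i ω) (fun j => ξ (i + j) ω) k = X (i + k) ω := fun ω =>
      path_add ϑ (0, 0) (fun k => ξ k ω) i k
    simp only [e] at h
    refine h.trans ?_
    rw [mul_assoc, mul_assoc, mul_comm (M.rate s r ^ k)]
    have := pow_nonneg (rate_nonneg (M := M) s r) k
    gcongr
    exact hAwle i
  exact ae_tendsto_average_of_integral_sq_le (fun i ω => hψ0 _ (hXm i ω))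
    (fun T => (integral_sum_sq_succ hAi T).1)
    (integral_sum_sq_le_of_geometric hAi (rate_nonneg s r) hd.rate_lt hcorr)

end LargeNumbers

/-! ### The mean queue length -/

lemma Regular.map_pos_noise (hM : M.Regular) :
    M.noise.map (fun uv : ℝ × ℝ => (max uv.1 0, max uv.2 0)) = M.noise := by
  have : (fun uv : ℝ × ℝ => (max uv.1 0, max uv.2 0)) =ᵐ[M.noise] id := by
    filter_upwards [hM.noise_nonneg] with uv h
    exact Prod.ext (max_eq_left h.1) (max_eq_left h.2)
  rw [Measure.map_congr this, Measure.map_id]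

instance : IsProbabilityMeasure M.seqLaw := by
  unfold seqLaw; infer_instance

/-- Positive parts make the coordinates nonnegative at every sample point while changing them only
on a null set. -/
lemma Regular.isNoise_seqLaw (hM : M.Regular) :
    M.IsNoise M.seqLaw fun n s => (max (s n).1 0, max (s n).2 0) where
  measurable n := by fun_prop
  nonneg n s := ⟨le_max_right _ _, le_max_right _ _⟩
  law n := by
    have h1 : M.seqLaw.map (fun s : ℕ → ℝ × ℝ => s n) = M.noise :=
      Measure.infinitePi_map_eval (fun _ : ℕ => M.noise) n
    have h2 := hM.map_pos_noise
    nth_rw 1 [← h1] at h2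
    rw [Measure.map_map (by fun_prop) (by fun_prop)] at h2
    exact h2
  indep := iIndepFun_infinitePi (P := fun _ : ℕ => M.noise)
    (X := fun _ (uv : ℝ × ℝ) => (max uv.1 0, max uv.2 0)) (fun _ => by fun_prop)

lemma Regular.ae_seqLaw_eq (hM : M.Regular) :
    ∀ᵐ s ∂M.seqLaw, ∀ n, s n = (max (s n).1 0, max (s n).2 0) := by
  refine ae_all_iff.2 fun n => ?_
  have h1 : M.seqLaw.map (fun s : ℕ → ℝ × ℝ => s n) = M.noise :=
    Measure.infinitePi_map_eval (fun _ : ℕ => M.noise) n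
  have h2 := hM.noise_nonneg
  rw [← h1] at h2
  filter_upwards [ae_of_ae_map (measurable_pi_apply n).aemeasurable h2] with s hs
  exact Prod.ext (max_eq_left hs.1).symm (max_eq_left hs.2).symm

lemma IsNoise.ae_tendsto_average_noise [IsProbabilityMeasure P] (hξ : M.IsNoise P ξ)
    {f : ℝ × ℝ → ℝ} (hf : Continuous f) {l : ℝ} (hi : Integrable f M.noise)
    (hl : ∫ uv, f uv ∂M.noise = l) :
    ∀ᵐ ω ∂P, Tendsto (fun n : ℕ => (∑ i ∈ Finset.range n, f (ξ i ω)) / n) atTop (𝓝 l) := by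
  have hm : ∀ i, Measurable fun ω => f (ξ i ω) := fun i => hf.measurable.comp (hξ.measurable i)
  have h := strong_law_ae_real (μ := P) (fun i ω => f (ξ i ω)) ?_ ?_ ?_
  · have e : ∫ ω, f (ξ 0 ω) ∂P = l := by
      rw [← hl, ← hξ.law 0, integral_map (hξ.measurable 0).aemeasurable hf.aestronglyMeasurable]
    rwa [e] at h
  · rw [← hξ.law 0] at hi
    exact hi.comp_measurable (hξ.measurable 0)
  · intro i j hij
    exact (hξ.indep.indepFun hij).comp hf.measurable hf.measurable
  · intro i
    exact (IdentDistrib.mk (hξ.measurable i).aemeasurable (hξ.measurable 0).aemeasurable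
      (by rw [hξ.law, hξ.law])).comp hf.measurable

lemma waiting_eq_path (ϑ : Param) (s : ℕ → ℝ × ℝ) (n : ℕ) :
    M.waiting ϑ s n = (M.path ϑ (0, 0) s n).1 := by
  induction n with
  | zero => rfl
  | succ n ih => rw [waiting, path, step_fst, ih]

lemma Regular.integrable_fst (hM : M.Regular) : Integrable (fun uv : ℝ × ℝ => uv.1) M.noise := by
  have h : Integrable (fun u : ℝ => u) M.lawU := by
    by_contra h
    have := hM.light.mean_U
    rw [integral_undef h] at this
    exact zero_ne_one this
  exact h.comp_fst M.lawV

lemma Regular.integrable_snd (hM : M.Regular) : Integrable (fun uv : ℝ × ℝ => uv.2) M.noise := by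
  have h : Integrable (fun u : ℝ => u) M.lawV := by
    by_contra h
    have := hM.light.mean_V
    rw [integral_undef h] at this
    exact zero_ne_one this
  exact h.comp_snd M.lawU

lemma Regular.integral_noise_snd (hM : M.Regular) : ∫ uv, uv.2 ∂M.noise = 1 := by
  have := integral_prod_mul (μ := M.lawU) (ν := M.lawV) (fun _ => (1 : ℝ)) (fun v : ℝ => v)
  simpa [hM.light.mean_V] using this

/-- Little's law for the model. -/
theorem Regular.meanQueueLength_eq (hM : M.Regular) {ϑ : Param} (hϑ : ϑ ∈ M.box) :
    M.meanQueueLength ϑ = M.lam (ϑ 1) * (M.statMean ϑ Prod.fst + 1 / ϑ 0) := by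
  obtain ⟨s, r, hd, hd2, -, -⟩ := hM.exists_drift_eight
  have hl := hM.lam_pos hϑ
  have hm := hM.mu_pos hϑ
  have hξ := hM.isNoise_seqLaw
  have hW := hξ.ae_tendsto_average hM hd hd2 (tame_fst hd.s_pos hd.r_pos)
    (fun x hx => hx.1) hϑ
  have hU := hξ.ae_tendsto_average_noise (f := Prod.fst) continuous_fst hM.integrable_fst
    hM.integral_noise_fst
  have hV := hξ.ae_tendsto_average_noise (f := Prod.snd) continuous_snd hM.integrable_snd
    hM.integral_noise_snd
  have key : ∀ᵐ s ∂M.seqLaw, limUnder atTop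
      (fun R : ℝ => R⁻¹ * ∫ r in (0 : ℝ)..R, (M.queueLength ϑ s r : ℝ))
      = M.lam (ϑ 1) * (M.statMean ϑ Prod.fst + 1 / ϑ 0) := by
    filter_upwards [hW, hU, hV, hM.ae_seqLaw_eq] with s hW hU hV hs
    have hs' : (fun n => (max (s n).1 0, max (s n).2 0)) = s := funext fun n => (hs n).symm
    have hs1 : ∀ n, max (s n).1 0 = (s n).1 := fun n => by exact (congrArg Prod.fst (hs n)).symm
    have hs2 : ∀ n, max (s n).2 0 = (s n).2 := fun n => by exact (congrArg Prod.snd (hs n)).symm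
    have hnn1 : ∀ n, 0 ≤ (s n).1 := fun n => hs1 n ▸ le_max_right _ _
    have hnn2 : ∀ n, 0 ≤ (s n).2 := fun n => hs2 n ▸ le_max_right _ _
    simp only [hs', ← waiting_eq_path] at hW
    simp only [hs1] at hU
    simp only [hs2] at hV
    have hw0 : ∀ n, 0 ≤ M.waiting ϑ s n := fun n => by
      cases n with
      | zero => exact le_rfl
      | succ n => exact le_max_right _ _
    have ha : Monotone (M.arrival ϑ s) := monotone_nat_of_le_succ fun n => by
      rw [arrival, arrival, Finset.sum_range_succ]
      exact le_add_of_nonneg_right (div_nonneg (hnn1 n) hl.le)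
    have hdep : Monotone (M.departure ϑ s) := monotone_nat_of_le_succ fun n => by
      have h1 : M.waiting ϑ s n - (s n).1 / M.lam (ϑ 1) + (s n).2 / ϑ 0
          ≤ M.waiting ϑ s (n + 1) := le_max_left _ _
      have h2 := div_nonneg (hnn2 (n + 1)) hm.le
      simp only [departure, arrival, Finset.sum_range_succ]
      linarith
    have had : ∀ n, M.arrival ϑ s n ≤ M.departure ϑ s n := fun n => by
      have := hw0 n
      have := div_nonneg (hnn2 n) hm.le
      rw [departure]
      linarith
    have hlima : Tendsto (fun n : ℕ => M.arrival ϑ s n / n) atTop (𝓝 (1 / M.lam (ϑ 1))) := by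
      refine (hU.div_const (M.lam (ϑ 1))).congr fun n => ?_
      rw [arrival, ← Finset.sum_div]
      ring
    have hlim : Tendsto (fun N : ℕ => (∑ n ∈ Finset.range N,
        (M.departure ϑ s n - M.arrival ϑ s n)) / N) atTop
        (𝓝 (M.statMean ϑ Prod.fst + 1 / ϑ 0)) := by
      refine (hW.add (hV.div_const (ϑ 0))).congr fun n => ?_
      have : ∀ n, M.departure ϑ s n - M.arrival ϑ s n = M.waiting ϑ s n + (s n).2 / ϑ 0 :=
        fun n => by rw [departure]; ring
      simp only [this]
      rw [Finset.sum_add_distrib, ← Finset.sum_div]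
      ring
    have := tendsto_queue_average ha le_rfl hdep had (by positivity) hlima hlim
    rw [one_div, inv_inv] at this
    exact this.limUnder_eq
  rw [meanQueueLength, integral_congr_ae key]
  simp

end GIGI1

namespace GIGI1

variable {M : GIGI1}

/-! ### The gradient of the objective -/

/-- The stationary mean of `w + y`. -/
def meanState (M : GIGI1) (ϑ : Param) : ℝ := M.statMean ϑ fun x => x.1 + x.2

/-- The traffic intensity. -/
def load (M : GIGI1) (ϑ : Param) : ℝ := M.lam (ϑ 1) / ϑ 0

/-- Pathwise convexity of the scaled waiting times in the traffic intensity. -/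
lemma Regular.subgradient_path (hM : M.Regular) {ϑ ϑ' : Param} (hϑ : ϑ ∈ M.box)
    (hϑ' : ϑ' ∈ M.box) (s : ℕ → ℝ × ℝ) (n : ℕ) :
    M.lam (ϑ 1) * (M.path ϑ (0, 0) s n).1
      + ϑ 0 * ((M.path ϑ (0, 0) s n).1 + (M.path ϑ (0, 0) s n).2) * (M.load ϑ' - M.load ϑ)
      ≤ M.lam (ϑ' 1) * (M.path ϑ' (0, 0) s n).1 := by
  have hl := hM.lam_pos hϑ
  have hl' := hM.lam_pos hϑ'
  have hm := hM.mu_pos hϑ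
  have hm' := hM.mu_pos hϑ'
  induction n with
  | zero => simp [path]
  | succ n ih =>
    simp only [path]
    set x := M.path ϑ (0, 0) s n
    set x' := M.path ϑ' (0, 0) s n
    by_cases hp : 0 < x.1 - (s n).1 / M.lam (ϑ 1) + (s n).2 / ϑ 0
    · rw [step_of_pos hp]
      have h1 : x'.1 - (s n).1 / M.lam (ϑ' 1) + (s n).2 / ϑ' 0 ≤ (M.step ϑ' x' (s n)).1 :=
        le_max_left _ _
      have h2 := mul_le_mul_of_nonneg_left h1 hl'.le
      refine le_trans ?_ h2
      -- After scaling by `λ`, the workload recursion has increment `-U + ρ V` before truncation, so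
      -- it depends on the parameter through the load `ρ` alone.
      have e1 : M.lam (ϑ' 1) * (x'.1 - (s n).1 / M.lam (ϑ' 1) + (s n).2 / ϑ' 0)
          = M.lam (ϑ' 1) * x'.1 - (s n).1 + (s n).2 * M.load ϑ' := by
        rw [load]; field_simp
      have e2 : M.lam (ϑ 1) * (x.1 - (s n).1 / M.lam (ϑ 1) + (s n).2 / ϑ 0)
          = M.lam (ϑ 1) * x.1 - (s n).1 + (s n).2 * M.load ϑ := by
        rw [load]; field_simp
      -- While the queue is busy, `μ (w + y)` increases by exactly `V`, the slope of the increment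
      -- in the load.
      have e3 : ϑ 0 * (x.1 - (s n).1 / M.lam (ϑ 1) + (s n).2 / ϑ 0
          + (x.2 + (s n).1 / M.lam (ϑ 1))) = ϑ 0 * (x.1 + x.2) + (s n).2 := by
        field_simp; ring
      simp only
      rw [e1, e2, e3]
      linarith
    · rw [step_of_nonpos (not_lt.1 hp)]
      have h1 : 0 ≤ (M.step ϑ' x' (s n)).1 := le_max_right _ _
      simpa using mul_nonneg hl'.le h1

/-- The pathwise inequality for two chains started empty on the same noise is integrated, and the
number of steps is sent to infinity. -/
lemma Regular.subgradient (hM : M.Regular) {ϑ ϑ' : Param} (hϑ : ϑ ∈ M.box) (hϑ' : ϑ' ∈ M.box) :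
    M.lam (ϑ 1) * M.statMean ϑ Prod.fst + ϑ 0 * M.meanState ϑ * (M.load ϑ' - M.load ϑ)
      ≤ M.lam (ϑ' 1) * M.statMean ϑ' Prod.fst := by
  obtain ⟨s, r, hd, -, -, -⟩ := hM.exists_drift_eight
  have hξ := hM.isNoise_seqLaw
  have h1 := tame_fst (M := M) hd.s_pos hd.r_pos
  have h2 := tame_add (M := M) hd.s_pos hd.r_pos
  refine le_of_tendsto_of_tendsto' (((h1.tendsto_statMean hM hd hϑ).const_mul _).add
    (((h2.tendsto_statMean hM hd hϑ).const_mul (ϑ 0)).mul_const _))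
    ((h1.tendsto_statMean hM hd hϑ').const_mul _) fun n => ?_
  obtain ⟨i1, e1⟩ := hξ.integral_path_zero hM hd h1 hϑ n
  obtain ⟨i2, e2⟩ := hξ.integral_path_zero hM hd h2 hϑ n
  obtain ⟨i3, e3⟩ := hξ.integral_path_zero hM hd h1 hϑ' n
  rw [← e1, ← e2, ← e3, ← integral_const_mul, ← integral_const_mul, ← integral_const_mul,
    ← integral_mul_const, ← integral_add (i1.const_mul _) ((i2.const_mul _).mul_const _)]
  exact integral_mono ((i1.const_mul _).add ((i2.const_mul _).mul_const _)) (i3.const_mul _)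
    fun ω => hM.subgradient_path hϑ hϑ' _ n

lemma Regular.continuousOn_meanState (hM : M.Regular) : ContinuousOn M.meanState M.box := by
  obtain ⟨s, r, hd, -, -, -⟩ := hM.exists_drift_eight
  exact (tame_add hd.s_pos hd.r_pos).continuousOn_statMean hM hd

lemma convex_box (M : GIGI1) : Convex ℝ M.box := by
  have h1 : Convex ℝ {ϑ : Param | ϑ 0 ∈ Set.Icc M.muLo M.muHi} :=
    (convex_Icc M.muLo M.muHi).linear_preimage (EuclideanSpace.proj (𝕜 := ℝ) (0 : Fin 2)).toLinearMap
  have h2 : Convex ℝ {ϑ : Param | ϑ 1 ∈ Set.Icc M.pLo M.pHi} :=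
    (convex_Icc M.pLo M.pHi).linear_preimage (EuclideanSpace.proj (𝕜 := ℝ) (1 : Fin 2)).toLinearMap
  exact h1.inter h2

lemma Regular.interior_box_nonempty (hM : M.Regular) : (interior M.box).Nonempty := by
  have hopen : IsOpen {ϑ : Param | ϑ 0 ∈ Set.Ioo M.muLo M.muHi ∧ ϑ 1 ∈ Set.Ioo M.pLo M.pHi} :=
    (isOpen_Ioo.preimage (by fun_prop : Continuous fun ϑ : Param => ϑ 0)).inter
      (isOpen_Ioo.preimage (by fun_prop : Continuous fun ϑ : Param => ϑ 1))
  have hsub : {ϑ : Param | ϑ 0 ∈ Set.Ioo M.muLo M.muHi ∧ ϑ 1 ∈ Set.Ioo M.pLo M.pHi} ⊆ M.box :=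
    fun ϑ h => ⟨Set.Ioo_subset_Icc_self h.1, Set.Ioo_subset_Icc_self h.2⟩
  refine ⟨!₂[(M.muLo + M.muHi) / 2, (M.pLo + M.pHi) / 2], interior_maximal hsub hopen ?_⟩
  have := hM.mu_lt
  have := hM.p_lt
  refine ⟨⟨?_, ?_⟩, ⟨?_, ?_⟩⟩ <;> simp <;> linarith

lemma Regular.uniqueDiffOn_box (hM : M.Regular) : UniqueDiffOn ℝ M.box :=
  uniqueDiffOn_convex M.convex_box hM.interior_box_nonempty

/-- The stationary mean of the gradient estimator. -/
def meanGrad (M : GIGI1) (ϑ : Param) : Param :=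
  !₂[M.costDeriv (ϑ 0) - M.h0 * (M.lam (ϑ 1) / ϑ 0) * (M.meanState ϑ + 1 / ϑ 0),
    -M.lam (ϑ 1) - ϑ 1 * M.lamDeriv (ϑ 1) + M.h0 * M.lamDeriv (ϑ 1) * (M.meanState ϑ + 1 / ϑ 0)]

lemma Regular.hasFDerivWithinAt_lam (hM : M.Regular) {ϑ : Param} (hϑ : ϑ ∈ M.box) :
    HasFDerivWithinAt (fun ϑ : Param => M.lam (ϑ 1))
      (M.lamDeriv (ϑ 1) • EuclideanSpace.proj (𝕜 := ℝ) (1 : Fin 2)) M.box ϑ := by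
  have h1 : HasDerivWithinAt M.lam (M.lamDeriv (ϑ 1)) (Set.Icc M.pLo M.pHi) (ϑ 1) :=
    ((hM.stable.lam_smooth.differentiableOn one_ne_zero) _ hϑ.2).hasDerivWithinAt
  exact h1.comp_hasFDerivWithinAt ϑ
    (EuclideanSpace.proj (𝕜 := ℝ) (1 : Fin 2)).hasFDerivWithinAt fun _ h => h.2

lemma Regular.hasFDerivWithinAt_cost (hM : M.Regular) {ϑ : Param} (hϑ : ϑ ∈ M.box) :
    HasFDerivWithinAt (fun ϑ : Param => M.cost (ϑ 0))
      (M.costDeriv (ϑ 0) • EuclideanSpace.proj (𝕜 := ℝ) (0 : Fin 2)) M.box ϑ := by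
  have h1 : HasDerivWithinAt M.cost (M.costDeriv (ϑ 0)) (Set.Icc M.muLo M.muHi) (ϑ 0) :=
    ((hM.stable.cost_smooth.differentiableOn one_ne_zero) _ hϑ.1).hasDerivWithinAt
  exact h1.comp_hasFDerivWithinAt ϑ
    (EuclideanSpace.proj (𝕜 := ℝ) (0 : Fin 2)).hasFDerivWithinAt fun _ h => h.1

lemma Regular.hasFDerivWithinAt_load (hM : M.Regular) {ϑ : Param} (hϑ : ϑ ∈ M.box) :
    HasFDerivWithinAt M.load
      ((M.lamDeriv (ϑ 1) / ϑ 0) • EuclideanSpace.proj (𝕜 := ℝ) (1 : Fin 2)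
        - (M.lam (ϑ 1) / ϑ 0 ^ 2) • EuclideanSpace.proj (𝕜 := ℝ) (0 : Fin 2)) M.box ϑ := by
  have hm := (hM.mu_pos hϑ).ne'
  have h1 := hM.hasFDerivWithinAt_lam hϑ
  have h2 : HasFDerivWithinAt (fun ϑ : Param => (ϑ 0)⁻¹)
      (-((ϑ 0) ^ 2)⁻¹ • EuclideanSpace.proj (𝕜 := ℝ) (0 : Fin 2)) M.box ϑ :=
    (hasDerivAt_inv hm).comp_hasFDerivWithinAt ϑ
      (EuclideanSpace.proj (𝕜 := ℝ) (0 : Fin 2)).hasFDerivWithinAt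
  refine (h1.mul h2).congr_fderiv ?_
  ext v
  simp
  field_simp
  ring

/-- The stationary scaled waiting time is differentiable along the traffic intensity. -/
lemma Regular.hasFDerivWithinAt_waiting (hM : M.Regular) {ϑ : Param} (hϑ : ϑ ∈ M.box)
    {D : Param →L[ℝ] ℝ}
    (hD : HasFDerivWithinAt M.load D M.box ϑ) :
    HasFDerivWithinAt (fun ϑ : Param => M.lam (ϑ 1) * M.statMean ϑ Prod.fst)
      ((ϑ 0 * M.meanState ϑ) • D) M.box ϑ := by
  set g : Param → ℝ := fun ϑ => M.lam (ϑ 1) * M.statMean ϑ Prod.fst with hg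
  set m : Param → ℝ := fun ϑ => ϑ 0 * M.meanState ϑ with hm
  have hmc : ContinuousWithinAt m M.box ϑ :=
    (by fun_prop : ContinuousWithinAt (fun ϑ : Param => ϑ 0) M.box ϑ).mul
      (hM.continuousOn_meanState ϑ hϑ)
  have h1 : (fun ϑ' => (m ϑ' - m ϑ) * (M.load ϑ' - M.load ϑ)) =o[𝓝[M.box] ϑ]
      fun ϑ' => ϑ' - ϑ := by
    have ho : (fun ϑ' => m ϑ' - m ϑ) =o[𝓝[M.box] ϑ] fun _ => (1 : ℝ) := by
      rw [isLittleO_one_iff]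
      have := hmc.sub_const (m ϑ)
      simpa [ContinuousWithinAt] using this
    have := ho.mul_isBigO hD.isBigO_sub.norm_right
    simp only [one_mul] at this
    exact this.of_norm_right
  -- The subgradient inequality at `ϑ` makes the remainder nonnegative; the one at `ϑ'` bounds it by
  -- `(m ϑ' - m ϑ) * (load ϑ' - load ϑ)`, which is of smaller order by continuity of `m`.
  have h2 : (fun ϑ' => g ϑ' - g ϑ - m ϑ * (M.load ϑ' - M.load ϑ)) =o[𝓝[M.box] ϑ]
      fun ϑ' => ϑ' - ϑ := by
    refine IsBigO.trans_isLittleO (IsBigO.of_bound 1 ?_) h1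
    filter_upwards [self_mem_nhdsWithin] with ϑ' hϑ'
    have a1 := hM.subgradient hϑ hϑ'
    have a2 := hM.subgradient hϑ' hϑ
    rw [Real.norm_eq_abs, Real.norm_eq_abs, one_mul, abs_of_nonneg (by simp only [hg, hm]; linarith)]
    refine le_trans ?_ (le_abs_self _)
    simp only [hg, hm]
    linarith
  rw [hasFDerivWithinAt_iff_isLittleO] at hD ⊢
  refine (h2.add (hD.const_mul_left (m ϑ))).congr_left fun ϑ' => ?_
  simp [hm, hg]
  ring

lemma Regular.hasFDerivWithinAt_objective (hM : M.Regular) {ϑ : Param} (hϑ : ϑ ∈ M.box) :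
    HasFDerivWithinAt M.objective (InnerProductSpace.toDual ℝ Param (M.meanGrad ϑ)) M.box ϑ := by
  have hm := (hM.mu_pos hϑ).ne'
  have hl := hM.hasFDerivWithinAt_load hϑ
  have h := ((((hM.hasFDerivWithinAt_waiting hϑ hl).add hl).const_mul M.h0).add
    (hM.hasFDerivWithinAt_cost hϑ)).sub
    ((EuclideanSpace.proj (𝕜 := ℝ) (1 : Fin 2)).hasFDerivWithinAt.mul (hM.hasFDerivWithinAt_lam hϑ))
  -- Little's law writes the mean queue length as the scaled waiting time plus the load.
  have hcongr : ∀ ϑ ∈ M.box, M.objective ϑ =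
      M.h0 * (M.lam (ϑ 1) * M.statMean ϑ Prod.fst + M.load ϑ) + M.cost (ϑ 0)
        - ϑ 1 * M.lam (ϑ 1) := fun ϑ hϑ => by
    rw [objective, hM.meanQueueLength_eq hϑ, load]
    ring
  refine (h.congr hcongr (hcongr ϑ hϑ)).congr_fderiv ?_
  ext v
  simp [meanGrad, PiLp.inner_apply]
  field_simp
  ring

/-- The estimator is unbiased in stationarity. Hence `bias` is a centered quantity that decays
geometrically. The gradient within the box is unambiguous, also on the boundary, because the box is
convex with nonempty interior. -/
theorem Regular.gradObj_eq (hM : M.Regular) {ϑ : Param} (hϑ : ϑ ∈ M.box) :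
    M.gradObj ϑ = M.meanGrad ϑ := by
  rw [gradObj, gradientWithin,
    (hM.hasFDerivWithinAt_objective hϑ).fderivWithin (hM.uniqueDiffOn_box ϑ hϑ)]
  simp

end GIGI1

namespace GIGI1

variable {M : GIGI1}

/-! ### The Poisson equation -/

/-- The solution of the Poisson equation for a real-valued function. -/
def poisson (M : GIGI1) (ϑ : Param) (ψ : ℝ × ℝ → ℝ) (x : ℝ × ℝ) : ℝ :=
  ∑' n, ((M.transOp ϑ)^[n] ψ x - M.statMean ϑ ψ)

section Poisson

variable {s r C : ℝ} {ψ : ℝ × ℝ → ℝ} {ϑ : Param}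

lemma Tame.summable_poisson (hM : M.Regular) (hd : M.Drift s r) (hψ : M.Tame s r C fun _ => ψ)
    (hϑ : ϑ ∈ M.box) {x : ℝ × ℝ} (hx : x ∈ stateSpace) :
    Summable fun n => (M.transOp ϑ)^[n] ψ x - M.statMean ϑ ψ := by
  refine Summable.of_norm_bounded (g := fun n =>
    6 * C / (1 - M.rate s r) * M.rate s r ^ n * wt s r x) ?_ fun n =>
    hψ.abs_iterate_sub_statMean_le hM hd hϑ n hx
  exact ((summable_geometric_of_lt_one (rate_nonneg s r) hd.rate_lt).mul_left _).mul_right _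

/-- Dividing by the weight makes the series uniformly convergent with a geometric majorant, so its
sum is continuous; multiplying back gives the growth bound. -/
lemma Tame.poisson (hM : M.Regular) (hd : M.Drift s r) (hψ : M.Tame s r C fun _ => ψ)
    (hϑ : ϑ ∈ M.box) :
    M.Tame s r (6 * C / (1 - M.rate s r) * (1 - M.rate s r)⁻¹) fun _ => M.poisson ϑ ψ := by
  have hgeo := (summable_geometric_of_lt_one (rate_nonneg (M := M) s r) hd.rate_lt).mul_left
    (6 * C / (1 - M.rate s r))
  have hb : ∀ (n : ℕ), ∀ x ∈ stateSpace,
      ‖((M.transOp ϑ)^[n] ψ x - M.statMean ϑ ψ) / wt s r x‖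
        ≤ 6 * C / (1 - M.rate s r) * M.rate s r ^ n := fun n x hx => by
    rw [norm_div, Real.norm_of_nonneg (wt_pos s r x).le, div_le_iff₀ (wt_pos s r x)]
    exact hψ.abs_iterate_sub_statMean_le hM hd hϑ n hx
  have heq : ∀ x, M.poisson ϑ ψ x =
      (∑' n, ((M.transOp ϑ)^[n] ψ x - M.statMean ϑ ψ) / wt s r x) * wt s r x := fun x => by
    rw [tsum_div_const, div_mul_cancel₀ _ (wt_pos s r x).ne', GIGI1.poisson]
  refine Tame.of_const ?_ fun x hx => ?_
  · refine ContinuousOn.congr ?_ fun x _ => heq x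
    refine ContinuousOn.mul ?_ (continuous_wt s r).continuousOn
    refine continuousOn_tsum (fun n => ?_) hgeo hb
    exact (((hψ.iterate hM hd n).section hϑ).sub continuousOn_const).div
      (continuous_wt s r).continuousOn fun x _ => (wt_pos s r x).ne'
  · rw [heq, abs_mul, abs_of_pos (wt_pos s r x)]
    refine mul_le_mul_of_nonneg_right ?_ (wt_pos s r x).le
    refine (tsum_of_norm_bounded hgeo.hasSum fun n => hb n x hx).trans_eq ?_
    rw [tsum_mul_left, tsum_geometric_of_lt_one (rate_nonneg s r) hd.rate_lt]

/-- The Poisson equation. -/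
lemma Tame.poisson_sub_transOp (hM : M.Regular) (hd : M.Drift s r)
    (hψ : M.Tame s r C fun _ => ψ) (hϑ : ϑ ∈ M.box) {x : ℝ × ℝ} (hx : x ∈ stateSpace) :
    M.poisson ϑ ψ x - M.transOp ϑ (M.poisson ϑ ψ) x = ψ x - M.statMean ϑ ψ := by
  have hC := hψ.nonneg hϑ
  have hr1 := sub_pos.2 hd.rate_lt
  have hiter := fun n => hψ.iterate hM hd n
  have hint : ∀ n, Integrable (fun uv => (M.transOp ϑ)^[n] ψ (M.step ϑ x uv)) M.noise := fun n =>
    hM.integrable_step hd ((hiter n).nonneg hϑ) ((hiter n).section hϑ) ((hiter n).bound ϑ hϑ) hϑ hx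
  have hint' : ∀ n, Integrable (fun uv => (M.transOp ϑ)^[n] ψ (M.step ϑ x uv)
      - M.statMean ϑ ψ) M.noise := fun n => (hint n).sub (integrable_const _)
  have hsum : Summable fun n => ∫ uv, ‖(M.transOp ϑ)^[n] ψ (M.step ϑ x uv)
      - M.statMean ϑ ψ‖ ∂M.noise := by
    refine Summable.of_nonneg_of_le (fun n => integral_nonneg fun _ => norm_nonneg _) (fun n => ?_)
      (((summable_geometric_of_lt_one (rate_nonneg (M := M) s r) hd.rate_lt).mul_left
        (6 * C / (1 - M.rate s r))).mul_right (wt s r x * M.rate s r + 1))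
    rw [← hd.integral_bound]
    refine integral_mono_ae (hint' n).norm (hd.integrable_bound _ _) ?_
    filter_upwards [hM.noise_nonneg] with uv huv
    refine (hψ.abs_iterate_sub_statMean_le hM hd hϑ n (hM.step_mem hϑ hx huv.1)).trans ?_
    have := pow_nonneg (rate_nonneg (M := M) s r) n
    exact mul_le_mul_of_nonneg_left
      (hM.wt_step_le hd.s_pos.le hd.r_pos.le hϑ huv.1 huv.2) (by positivity)
  -- The operator may be applied termwise by summability of the absolute integrals; it shifts the
  -- series by one index, leaving only the first term in the difference.
  have hP : M.transOp ϑ (M.poisson ϑ ψ) x =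
      ∑' n, ((M.transOp ϑ)^[n + 1] ψ x - M.statMean ϑ ψ) := by
    rw [hM.transOp_eq ((hψ.poisson hM hd hϑ).section hϑ) hϑ hx]
    unfold GIGI1.poisson
    rw [← integral_tsum_of_summable_integral_norm hint' hsum]
    refine tsum_congr fun n => ?_
    rw [integral_sub (hint n) (integrable_const _), Function.iterate_succ_apply',
      hM.transOp_eq ((hiter n).section hϑ) hϑ hx]
    simp
  rw [hP, GIGI1.poisson, (hψ.summable_poisson hM hd hϑ hx).tsum_eq_zero_add]
  simp

end Poisson

/-- The direction in which the gradient estimator depends on the state. -/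
def slope (M : GIGI1) (ϑ : Param) : Param :=
  !₂[-(M.h0 * (M.lam (ϑ 1) / ϑ 0)), M.h0 * M.lamDeriv (ϑ 1)]

/-- The state enters only through the scalar `w + y`, which reduces the vector-valued Poisson
equation to a scalar one. -/
lemma gradEst_eq (ϑ : Param) (x : ℝ × ℝ) :
    M.gradEst ϑ x = M.meanGrad ϑ + (x.1 + x.2 - M.meanState ϑ) • M.slope ϑ := by
  ext i
  fin_cases i <;> simp [gradEst, meanGrad, slope] <;> ring

instance (ϑ : Param) (x : ℝ × ℝ) : IsProbabilityMeasure (M.trans ϑ x) :=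
  Measure.isProbabilityMeasure_map (measurable_step M ϑ x).aemeasurable

lemma Regular.iterate_gradEst (hM : M.Regular) {ϑ : Param} (hϑ : ϑ ∈ M.box) (n : ℕ) {x : ℝ × ℝ}
    (hx : x ∈ stateSpace) : (M.transOp ϑ)^[n] (M.gradEst ϑ) x =
      M.meanGrad ϑ + ((M.transOp ϑ)^[n] (fun x => x.1 + x.2) x - M.meanState ϑ) • M.slope ϑ := by
  obtain ⟨s, r, hd, -, -, -⟩ := hM.exists_drift_eight
  have hz := tame_add (M := M) hd.s_pos hd.r_pos
  induction n generalizing x with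
  | zero => exact gradEst_eq ϑ x
  | succ n ih =>
    have hn := hz.iterate hM hd n
    have hint := hM.integrable_trans hd (hn.nonneg hϑ) (hn.section hϑ) (hn.bound ϑ hϑ) hϑ hx
    have hint' : Integrable (fun x' => (M.transOp ϑ)^[n] (fun x => x.1 + x.2) x' - M.meanState ϑ)
      (M.trans ϑ x) := hint.sub (integrable_const _)
    simp only [Function.iterate_succ_apply']
    rw [transOp, transOp, integral_congr_ae ((hM.ae_trans_mem hϑ hx).mono fun x' hx' => ih hx'),
      integral_add (integrable_const _) (hint'.smul_const _),
      integral_smul_const, integral_sub hint (integrable_const _)]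
    simp

lemma Regular.bias_eq (hM : M.Regular) {ϑ : Param} (hϑ : ϑ ∈ M.box) (n : ℕ) {x : ℝ × ℝ}
    (hx : x ∈ stateSpace) : M.bias ϑ x n =
      ((M.transOp ϑ)^[n] (fun x => x.1 + x.2) x - M.meanState ϑ) • M.slope ϑ := by
  rw [bias, hM.iterate_gradEst hϑ n hx, hM.gradObj_eq hϑ, add_sub_cancel_left]

/-- The scalar Poisson solution for `w + y`. -/
def statePoisson (M : GIGI1) (ϑ : Param) : ℝ × ℝ → ℝ := M.poisson ϑ fun x => x.1 + x.2

lemma Regular.summable_bias (hM : M.Regular) {ϑ : Param} (hϑ : ϑ ∈ M.box) {x : ℝ × ℝ}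
    (hx : x ∈ stateSpace) : Summable (M.bias ϑ x) := by
  obtain ⟨s, r, hd, -, -, -⟩ := hM.exists_drift_eight
  refine (((tame_add hd.s_pos hd.r_pos).summable_poisson hM hd hϑ hx).smul_const
    (M.slope ϑ)).congr fun n => ?_
  rw [hM.bias_eq hϑ n hx, meanState]

lemma Regular.poissonSol_eq (hM : M.Regular) {ϑ : Param} (hϑ : ϑ ∈ M.box) {x : ℝ × ℝ}
    (hx : x ∈ stateSpace) : M.poissonSol ϑ x = M.statePoisson ϑ x • M.slope ϑ := by
  obtain ⟨s, r, hd, -, -, -⟩ := hM.exists_drift_eight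
  rw [poissonSol, statePoisson, poisson, ← Summable.tsum_smul_const
    ((tame_add hd.s_pos hd.r_pos).summable_poisson hM hd hϑ hx)]
  exact tsum_congr fun n => hM.bias_eq hϑ n hx

lemma Regular.exists_tame_statePoisson (hM : M.Regular) {s r : ℝ} (hd : M.Drift s r) {ϑ : Param}
    (hϑ : ϑ ∈ M.box) : ∃ C, M.Tame s r C fun _ => M.statePoisson ϑ :=
  ⟨_, (tame_add hd.s_pos hd.r_pos).poisson hM hd hϑ⟩

lemma Regular.transOp_poissonSol (hM : M.Regular) {ϑs ϑ : Param} (hϑs : ϑs ∈ M.box)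
    (hϑ : ϑ ∈ M.box) {x : ℝ × ℝ} (hx : x ∈ stateSpace) :
    M.transOp ϑ (M.poissonSol ϑs) x = M.transOp ϑ (M.statePoisson ϑs) x • M.slope ϑs := by
  rw [transOp, integral_congr_ae ((hM.ae_trans_mem hϑ hx).mono fun x' hx' =>
    hM.poissonSol_eq hϑs hx'), integral_smul_const, transOp]

theorem Regular.gradEst_sub_gradObj (hM : M.Regular) {ϑ : Param} (hϑ : ϑ ∈ M.box) {x : ℝ × ℝ}
    (hx : x ∈ stateSpace) : M.gradEst ϑ x - M.gradObj ϑ =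
      M.poissonSol ϑ x - M.transOp ϑ (M.poissonSol ϑ) x := by
  obtain ⟨s, r, hd, -, -, -⟩ := hM.exists_drift_eight
  rw [hM.transOp_poissonSol hϑ hϑ hx, hM.poissonSol_eq hϑ hx, ← sub_smul, statePoisson,
    (tame_add hd.s_pos hd.r_pos).poisson_sub_transOp hM hd hϑ hx, gradEst_eq, hM.gradObj_eq hϑ,
    add_sub_cancel_left, meanState]

lemma wt_two (s r : ℝ) (x : ℝ × ℝ) : wt (2 * s) (2 * r) x = wt s r x ^ 2 := by
  have := wt_pow s r 2 x
  push_cast at this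
  exact this.symm

lemma Tame.sq {s r C : ℝ} {g : Param → ℝ × ℝ → ℝ} (hg : M.Tame s r C g) :
    M.Tame (2 * s) (2 * r) (C ^ 2) fun ϑ x => g ϑ x ^ 2 := by
  refine ⟨hg.cont.pow 2, fun ϑ hϑ x hx => ?_⟩
  rw [abs_pow, wt_two, ← mul_pow]
  exact pow_le_pow_left₀ (abs_nonneg _) (hg.bound ϑ hϑ x hx) 2

lemma Tame.sub {s r C C' : ℝ} {g g' : Param → ℝ × ℝ → ℝ} (hg : M.Tame s r C g)
    (hg' : M.Tame s r C' g') : M.Tame s r (C + C') fun ϑ x => g ϑ x - g' ϑ x := by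
  refine ⟨hg.cont.sub hg'.cont, fun ϑ hϑ x hx => ?_⟩
  have h1 := hg.bound ϑ hϑ x hx
  have h2 := hg'.bound ϑ hϑ x hx
  have := abs_sub (g ϑ x) (g' ϑ x)
  rw [add_mul]
  linarith

theorem Regular.memLp_poissonSol (hM : M.Regular) {ϑs ϑ : Param} (hϑs : ϑs ∈ M.box)
    (hϑ : ϑ ∈ M.box) {x : ℝ × ℝ} (hx : x ∈ stateSpace) :
    MemLp (M.poissonSol ϑs) 2 (M.trans ϑ x) := by
  obtain ⟨s, r, hd, hd2, -, -⟩ := hM.exists_drift_eight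
  obtain ⟨C, hu⟩ := hM.exists_tame_statePoisson hd hϑs
  have hmeas := hM.aestronglyMeasurable_trans (hu.section hϑ) hϑ hx
  have hsq := hu.sq
  have h2 : MemLp (M.statePoisson ϑs) 2 (M.trans ϑ x) :=
    (memLp_two_iff_integrable_sq hmeas).2
      (hM.integrable_trans hd2 (hsq.nonneg hϑ) (hsq.section hϑ) (hsq.bound ϑ hϑ) hϑ hx)
  have h3 : MemLp (fun x' => M.statePoisson ϑs x' • M.slope ϑs) 2 (M.trans ϑ x) := by
    refine MemLp.of_le_mul (c := ‖M.slope ϑs‖) h2 (hmeas.smul_const _)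
      (Eventually.of_forall fun x' => ?_)
    rw [norm_smul, mul_comm]
  exact (memLp_congr_ae ((hM.ae_trans_mem hϑ hx).mono fun x' hx' =>
    hM.poissonSol_eq hϑs hx')).2 h3

/-- The conditional variance of the scalar Poisson solution. -/
def condVar (M : GIGI1) (ϑs ϑ : Param) (x : ℝ × ℝ) : ℝ :=
  M.transOp ϑ (fun x' => M.statePoisson ϑs x' ^ 2) x - M.transOp ϑ (M.statePoisson ϑs) x ^ 2

/-- A scalar function times a fixed vector has a covariance of rank one, so only the scalar factor
needs to be averaged. -/
lemma Regular.condCov_eq (hM : M.Regular) {ϑs ϑ : Param} (hϑs : ϑs ∈ M.box) (hϑ : ϑ ∈ M.box)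
    {x : ℝ × ℝ} (hx : x ∈ stateSpace) (i j : Fin 2) :
    M.condCov ϑ (M.poissonSol ϑs) x i j
      = M.condVar ϑs ϑ x * (M.slope ϑs i * M.slope ϑs j) := by
  rw [condCov, Matrix.of_apply, hM.transOp_poissonSol hϑs hϑ hx]
  have h1 : M.transOp ϑ (fun x' => M.poissonSol ϑs x' i * M.poissonSol ϑs x' j) x
      = M.transOp ϑ (fun x' => M.statePoisson ϑs x' ^ 2) x * (M.slope ϑs i * M.slope ϑs j) := by
    rw [transOp, transOp, ← integral_mul_const]
    refine integral_congr_ae ((hM.ae_trans_mem hϑ hx).mono fun x' hx' => ?_)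
    simp only [hM.poissonSol_eq hϑs hx', PiLp.smul_apply, smul_eq_mul]
    ring
  rw [h1, condVar]
  simp only [PiLp.smul_apply, smul_eq_mul]
  ring

/-- The Poisson solution stays fixed at `ϑs`; the varying parameter enters through the transition
law only, and the operator preserves joint continuity. Squaring doubles the exponents. -/
lemma Regular.exists_tame_condVar (hM : M.Regular) {s r : ℝ} (hd : M.Drift s r)
    (hd2 : M.Drift (2 * s) (2 * r)) {ϑs : Param} (hϑs : ϑs ∈ M.box) :
    ∃ C, M.Tame (2 * s) (2 * r) C (M.condVar ϑs) := by
  obtain ⟨C, hu⟩ := hM.exists_tame_statePoisson hd hϑs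
  exact ⟨_, (hu.sq.transOp hM hd2).sub (hu.transOp hM hd).sq⟩

lemma Regular.condVar_nonneg (hM : M.Regular) {ϑs ϑ : Param} (hϑs : ϑs ∈ M.box)
    (hϑ : ϑ ∈ M.box) {x : ℝ × ℝ} (hx : x ∈ stateSpace) : 0 ≤ M.condVar ϑs ϑ x := by
  obtain ⟨s, r, hd, hd2, -, -⟩ := hM.exists_drift_eight
  obtain ⟨C, hu⟩ := hM.exists_tame_statePoisson hd hϑs
  have hsq := hu.sq
  have i1 := hM.integrable_trans hd (hu.nonneg hϑ) (hu.section hϑ) (hu.bound ϑ hϑ) hϑ hx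
  have i2 := hM.integrable_trans hd2 (hsq.nonneg hϑ) (hsq.section hϑ) (hsq.bound ϑ hϑ) hϑ hx
  set c := M.transOp ϑ (M.statePoisson ϑs) x with hc
  have h : 0 ≤ ∫ x', (M.statePoisson ϑs x' - c) ^ 2 ∂M.trans ϑ x :=
    integral_nonneg fun _ => sq_nonneg _
  have e : ∀ x', (M.statePoisson ϑs x' - c) ^ 2
      = M.statePoisson ϑs x' ^ 2 - (2 * c) * M.statePoisson ϑs x' + c ^ 2 := fun x' => by ring
  have i3 : Integrable (fun x' => M.statePoisson ϑs x' ^ 2 - (2 * c) * M.statePoisson ϑs x')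
    (M.trans ϑ x) := i2.sub (i1.const_mul _)
  simp only [e] at h
  rw [integral_add i3 (integrable_const _), integral_sub i2 (i1.const_mul _),
    integral_const_mul, integral_const, probReal_univ, one_smul] at h
  have hc' : ∫ x', M.statePoisson ϑs x' ∂M.trans ϑ x = c := rfl
  rw [hc'] at h
  rw [condVar, ← hc, transOp]
  linarith

lemma Regular.statMean_nonneg (hM : M.Regular) {s r C : ℝ} (hd : M.Drift s r)
    {ψ : ℝ × ℝ → ℝ} (hψ : M.Tame s r C fun _ => ψ) (hψ0 : ∀ x ∈ stateSpace, 0 ≤ ψ x)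
    {ϑ : Param} (hϑ : ϑ ∈ M.box) : 0 ≤ M.statMean ϑ ψ := by
  refine ge_of_tendsto' (hψ.tendsto_statMean hM hd hϑ) fun n => ?_
  rw [← (hM.isNoise_seqLaw.integral_path_zero hM hd hψ hϑ n).2]
  exact integral_nonneg fun ω => hψ0 _ (hM.isNoise_seqLaw.path_zero_mem hM hϑ n ω)

end GIGI1

namespace GIGI1

variable {M : GIGI1}

/-! ### Functions that vanish on the diagonal -/

/-- Pairs of a feasible parameter and a state. -/
def pairs (M : GIGI1) : Set (Param × (ℝ × ℝ)) := M.box ×ˢ stateSpace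

lemma isCompact_box (M : GIGI1) : IsCompact M.box := by
  have h : M.box = (fun z : ℝ × ℝ => (!₂[z.1, z.2] : Param)) ''
      (Set.Icc M.muLo M.muHi ×ˢ Set.Icc M.pLo M.pHi) := by
    ext ϑ
    constructor
    · intro h
      refine ⟨(ϑ 0, ϑ 1), h, ?_⟩
      ext i
      fin_cases i <;> simp
    · rintro ⟨z, hz, rfl⟩
      exact ⟨by simpa using hz.1, by simpa using hz.2⟩
  rw [h]
  refine (isCompact_Icc.prod isCompact_Icc).image ?_
  refine (PiLp.continuous_toLp 2 _).comp (continuous_pi fun i => ?_)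
  fin_cases i <;> simp <;> fun_prop

/-- On a compact set of bounded weights, uniform continuity makes `Ψ` small near the diagonal, and
boundedness handles pairs at positive distance. Outside it the growth of `Ψ` is negligible against
the weights. -/
lemma exists_abs_le_of_diag {s r C : ℝ} (hs : 0 < s) (hr : 0 < r)
    {Ψ : Param × (ℝ × ℝ) → Param × (ℝ × ℝ) → ℝ}
    (hΨ : ContinuousOn (Function.uncurry Ψ) (M.pairs ×ˢ M.pairs))
    (hdiag : ∀ q ∈ M.pairs, Ψ q q = 0)
    (hb : ∀ q ∈ M.pairs, ∀ q' ∈ M.pairs, Ψ q q' ^ 2 ≤ C * (wt s r q.2 + wt s r q'.2))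
    {ε : ℝ} (hε : 0 < ε) :
    ∃ D, 0 ≤ D ∧ ∀ q ∈ M.pairs, ∀ q' ∈ M.pairs,
      |Ψ q q'| ≤ ε * (1 + wt s r q.2 + wt s r q'.2) + D * min 1 (dist q q') := by
  -- Once the sum `W` of the two weights exceeds `R`, the growth bound gives `Ψ² ≤ C W ≤ ε² W²`.
  set R := C / ε ^ 2 with hR
  set K : Set (Param × (ℝ × ℝ)) := M.box ×ˢ Set.Icc ((0, 0) : ℝ × ℝ) (s⁻¹ * R, r⁻¹ * R) with hK
  have hKc : IsCompact K := M.isCompact_box.prod isCompact_Icc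
  have hKsub : K ⊆ M.pairs := fun q hq => ⟨hq.1, hq.2.1.1, hq.2.1.2⟩
  have hKmem : ∀ q ∈ M.pairs, wt s r q.2 ≤ R → q ∈ K := fun q hq h =>
    ⟨hq.1, ⟨hq.2.1, hq.2.2⟩,
      (fst_le_wt hs hr hq.2).trans (mul_le_mul_of_nonneg_left h (inv_pos.2 hs).le),
      (snd_le_wt hs hr hq.2).trans (mul_le_mul_of_nonneg_left h (inv_pos.2 hr).le)⟩
  have hcont := hΨ.mono (Set.prod_mono hKsub hKsub)
  obtain ⟨δ, hδ, hunif⟩ := Metric.uniformContinuousOn_iff.1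
    ((hKc.prod hKc).uniformContinuousOn_of_continuous hcont) ε hε
  obtain ⟨B, hB⟩ := (hKc.prod hKc).exists_bound_of_continuousOn hcont
  have hδ1 : 0 < min 1 δ := lt_min one_pos hδ
  refine ⟨|B| / min 1 δ, by positivity, fun q hq q' hq' => ?_⟩
  have hw := wt_pos s r q.2
  have hw' := wt_pos s r q'.2
  have hD : 0 ≤ |B| / min 1 δ * min 1 (dist q q') := by positivity
  by_cases hRq : wt s r q.2 ≤ R ∧ wt s r q'.2 ≤ R
  · have m1 := hKmem q hq hRq.1
    have m2 := hKmem q' hq' hRq.2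
    by_cases hdist : dist q q' < δ
    · have := hunif (q, q') ⟨m1, m2⟩ (q, q) ⟨m1, m1⟩ (by
        rw [Prod.dist_eq]
        simpa [dist_comm q' q] using hdist)
      simp only [Function.uncurry_apply_pair, hdiag q hq, Real.dist_eq, sub_zero] at this
      nlinarith
    · have h1 : |Ψ q q'| ≤ |B| := (hB (q, q') ⟨m1, m2⟩).trans (le_abs_self B)
      have h2 : min 1 δ ≤ min 1 (dist q q') := min_le_min_left _ (not_lt.1 hdist)
      have h3 : |B| ≤ |B| / min 1 δ * min 1 (dist q q') := by
        rw [div_mul_eq_mul_div, le_div_iff₀ hδ1]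
        exact mul_le_mul_of_nonneg_left h2 (abs_nonneg _)
      nlinarith
  · have hsum : R ≤ wt s r q.2 + wt s r q'.2 := by
      by_contra! h
      exact hRq ⟨by linarith, by linarith⟩
    have h1 : |Ψ q q'| ≤ ε * (wt s r q.2 + wt s r q'.2) := by
      refine abs_le_of_sq_le_sq ((hb q hq q' hq').trans ?_) (by positivity)
      have hC : C ≤ ε ^ 2 * (wt s r q.2 + wt s r q'.2) := by
        rw [hR, div_le_iff₀ (by positivity)] at hsum
        linarith
      calc _ ≤ ε ^ 2 * (wt s r q.2 + wt s r q'.2) * (wt s r q.2 + wt s r q'.2) :=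
            mul_le_mul_of_nonneg_right hC (by positivity)
        _ = _ := by ring
    nlinarith

variable {Ω : Type*} {mΩ : MeasurableSpace Ω} {P : Measure Ω} {ξ : ℕ → Ω → ℝ × ℝ}

/-- A sequence of random pairs in the feasible region with bounded moments. -/
structure Tight (M : GIGI1) (P : Measure Ω) (s r K : ℝ) (q : ℕ → Ω → Param × (ℝ × ℝ)) :
    Prop where
  measurable : ∀ τ, Measurable (q τ)
  mem : ∀ τ ω, q τ ω ∈ M.pairs
  integrable : ∀ τ, Integrable (fun ω => wt s r (q τ ω).2) P
  moment : ∀ τ, ∫ ω, wt s r (q τ ω).2 ∂P ≤ K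

/-- The distance of two sequences of random variables tends to zero in probability. -/
def Close {E : Type*} [PseudoMetricSpace E] (P : Measure Ω) (q q' : ℕ → Ω → E) : Prop :=
  Tendsto (fun τ => ∫ ω, min 1 (dist (q τ ω) (q' τ ω)) ∂P) atTop (𝓝 0)

lemma integrable_min_one [IsFiniteMeasure P] {f : Ω → ℝ} (hf : Measurable f) (h0 : ∀ ω, 0 ≤ f ω) :
    Integrable (fun ω => min 1 (f ω)) P := by
  refine Integrable.of_bound (C := 1) (measurable_const.min hf).aestronglyMeasurable
    (Eventually.of_forall fun ω => ?_)
  rw [Real.norm_of_nonneg (le_min zero_le_one (h0 ω))]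
  exact min_le_left _ _

/-- Closeness in probability becomes convergence in mean: the bound on `Ψ²` by weights with bounded
expectation excludes escape of mass to large states. -/
lemma Close.tendsto_integral_abs [IsProbabilityMeasure P] {s r C K : ℝ} (hs : 0 < s) (hr : 0 < r)
    {Ψ : Param × (ℝ × ℝ) → Param × (ℝ × ℝ) → ℝ}
    (hΨ : ContinuousOn (Function.uncurry Ψ) (M.pairs ×ˢ M.pairs))
    (hdiag : ∀ q ∈ M.pairs, Ψ q q = 0)
    (hb : ∀ q ∈ M.pairs, ∀ q' ∈ M.pairs, Ψ q q' ^ 2 ≤ C * (wt s r q.2 + wt s r q'.2))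
    {q q' : ℕ → Ω → Param × (ℝ × ℝ)} (hq : M.Tight P s r K q) (hq' : M.Tight P s r K q')
    (hclose : Close P q q') :
    Tendsto (fun τ => ∫ ω, |Ψ (q τ ω) (q' τ ω)| ∂P) atTop (𝓝 0) := by
  have hK : 0 ≤ K := (integral_nonneg fun ω => (wt_pos s r _).le).trans (hq.moment 0)
  refine tendsto_order.2 ⟨fun v hv => Eventually.of_forall fun τ =>
    hv.trans_le (integral_nonneg fun _ => abs_nonneg _), fun v hv => ?_⟩
  obtain ⟨D, hD, hle⟩ := exists_abs_le_of_diag hs hr hΨ hdiag hb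
    (ε := v / (2 * (1 + K + K))) (by positivity)
  have hlim : Tendsto (fun τ => D * ∫ ω, min 1 (dist (q τ ω) (q' τ ω)) ∂P) atTop (𝓝 0) := by
    simpa using Tendsto.const_mul D hclose
  filter_upwards [hlim.eventually_lt_const (half_pos hv)] with τ hτ
  have i1 : Integrable (fun ω => v / (2 * (1 + K + K)) *
      (1 + wt s r (q τ ω).2 + wt s r (q' τ ω).2)) P :=
    (((integrable_const 1).add (hq.integrable τ)).add (hq'.integrable τ)).const_mul _
  have i2 : Integrable (fun ω => D * min 1 (dist (q τ ω) (q' τ ω))) P :=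
    (integrable_min_one ((hq.measurable τ).dist (hq'.measurable τ))
      fun _ => dist_nonneg).const_mul D
  have i3 : Integrable (fun ω => 1 + wt s r (q τ ω).2) P :=
    (integrable_const 1).add (hq.integrable τ)
  calc ∫ ω, |Ψ (q τ ω) (q' τ ω)| ∂P
      ≤ ∫ ω, (v / (2 * (1 + K + K)) * (1 + wt s r (q τ ω).2 + wt s r (q' τ ω).2)
        + D * min 1 (dist (q τ ω) (q' τ ω))) ∂P :=
        integral_mono_of_nonneg (Eventually.of_forall fun _ => abs_nonneg _) (i1.add i2)
          (Eventually.of_forall fun ω => hle _ (hq.mem τ ω) _ (hq'.mem τ ω))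
    _ = v / (2 * (1 + K + K)) * (1 + ∫ ω, wt s r (q τ ω).2 ∂P + ∫ ω, wt s r (q' τ ω).2 ∂P)
        + D * ∫ ω, min 1 (dist (q τ ω) (q' τ ω)) ∂P := by
        rw [integral_add i1 i2, integral_const_mul, integral_const_mul,
          integral_add i3 (hq'.integrable τ),
          integral_add (integrable_const 1) (hq.integrable τ)]
        simp
    _ ≤ v / (2 * (1 + K + K)) * (1 + K + K) + D * ∫ ω, min 1 (dist (q τ ω) (q' τ ω)) ∂P := by
        gcongr
        exacts [hq.moment τ, hq'.moment τ]
    _ = v / 2 + D * ∫ ω, min 1 (dist (q τ ω) (q' τ ω)) ∂P := by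
        have : 1 + K + K ≠ 0 := by positivity
        field_simp
    _ < v := by linarith

/-! ### Continuous dependence of one step on the parameter and the state -/

/-- For fixed noise the step may jump, but its discontinuities are negligible at every point, so
averaging over the noise restores continuity. -/
lemma Regular.continuousOn_integral_dist_step (hM : M.Regular) :
    ContinuousOn (Function.uncurry fun q q' : Param × (ℝ × ℝ) =>
      ∫ uv, min 1 (dist (M.step q.1 q.2 uv) (M.step q'.1 q'.2 uv)) ∂M.noise)
      (M.pairs ×ˢ M.pairs) := by
  intro z hz
  refine continuousWithinAt_of_dominated (bound := fun _ => 1) ?_ ?_ (integrable_const _) ?_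
  · refine Eventually.of_forall fun z => ?_
    exact (measurable_const.min ((measurable_step M _ _).dist
      (measurable_step M _ _))).aestronglyMeasurable
  · refine Eventually.of_forall fun z => Eventually.of_forall fun uv => ?_
    rw [Real.norm_of_nonneg (le_min zero_le_one dist_nonneg)]
    exact min_le_left _ _
  · filter_upwards [hM.ae_continuousWithinAt_step hz.1, hM.ae_continuousWithinAt_step hz.2]
      with uv h1 h2
    have h1' : ContinuousWithinAt (fun z : (Param × (ℝ × ℝ)) × (Param × (ℝ × ℝ)) =>
        M.step z.1.1 z.1.2 uv) (M.pairs ×ˢ M.pairs) z :=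
      ContinuousWithinAt.comp (f := Prod.fst) (g := fun q : Param × (ℝ × ℝ) => M.step q.1 q.2 uv)
        h1 continuousWithinAt_fst fun z hz => hz.1
    have h2' : ContinuousWithinAt (fun z : (Param × (ℝ × ℝ)) × (Param × (ℝ × ℝ)) =>
        M.step z.2.1 z.2.2 uv) (M.pairs ×ˢ M.pairs) z :=
      ContinuousWithinAt.comp (f := Prod.snd) (g := fun q : Param × (ℝ × ℝ) => M.step q.1 q.2 uv)
        h2 continuousWithinAt_snd fun z hz => hz.2
    exact continuousWithinAt_const.min (h1'.dist h2')

/-- Fresh noise is independent of both current pairs, so the expected truncated distance after the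
step is that of a continuous function vanishing on the diagonal. -/
lemma Close.step [IsProbabilityMeasure P] (hM : M.Regular) (hξ : M.IsNoise P ξ) {s r K : ℝ}
    (hs : 0 < s) (hr : 0 < r) {m : ℕ → ℕ} {q q' : ℕ → Ω → Param × (ℝ × ℝ)}
    (hq : M.Tight P s r K q) (hq' : M.Tight P s r K q')
    (hqm : ∀ τ, Measurable[past ξ (m τ)] (q τ)) (hqm' : ∀ τ, Measurable[past ξ (m τ)] (q' τ))
    (hclose : Close P q q') :
    Close P (fun τ ω => M.step (q τ ω).1 (q τ ω).2 (ξ (m τ) ω))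
      (fun τ ω => M.step (q' τ ω).1 (q' τ ω).2 (ξ (m τ) ω)) := by
  have h := hclose.tendsto_integral_abs (C := 1) hs hr hM.continuousOn_integral_dist_step
    (fun q _ => by simp) (fun q hq q' hq' => ?_) hq hq'
  · refine h.congr fun τ => ?_
    let Φ : M.pairs × M.pairs → ℝ × ℝ → ℝ := fun y uv =>
      min 1 (dist (M.step y.1.1.1 y.1.1.2 uv) (M.step y.2.1.1 y.2.1.2 uv))
    have hΦ : Measurable (Function.uncurry Φ) := by
      have h1 : Measurable fun z : (M.pairs × M.pairs) × (ℝ × ℝ) => z.1.1.1 := by fun_prop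
      have h2 : Measurable fun z : (M.pairs × M.pairs) × (ℝ × ℝ) => z.1.2.1 := by fun_prop
      exact measurable_const.min
        ((hM.measurable_step_comp h1.fst (fun z => z.1.1.2.1) h1.snd measurable_snd).dist
        (hM.measurable_step_comp h2.fst (fun z => z.1.2.2.1) h2.snd measurable_snd))
    let Y : Ω → M.pairs × M.pairs := fun ω => (⟨q τ ω, hq.mem τ ω⟩, ⟨q' τ ω, hq'.mem τ ω⟩)
    have hY : Measurable[past ξ (m τ)] Y := ((hqm τ).subtype_mk).prodMk ((hqm' τ).subtype_mk)
    have hint : Integrable (fun ω => Φ (Y ω) (ξ (m τ) ω)) P := by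
      refine Integrable.of_bound (C := 1) (hΦ.comp ((hY.mono (hξ.past_le _) le_rfl).prodMk
        (hξ.measurable _))).aestronglyMeasurable (Eventually.of_forall fun ω => ?_)
      rw [Real.norm_of_nonneg (le_min zero_le_one dist_nonneg)]
      exact min_le_left _ _
    rw [hξ.integral_eq hY hΦ hint]
    refine integral_congr_ae (Eventually.of_forall fun ω => ?_)
    exact abs_of_nonneg (integral_nonneg fun uv => le_min zero_le_one dist_nonneg)
  · have h0 : 0 ≤ ∫ uv, min 1 (dist (M.step q.1 q.2 uv) (M.step q'.1 q'.2 uv)) ∂M.noise :=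
      integral_nonneg fun uv => le_min zero_le_one dist_nonneg
    have h1 : ∫ uv, min 1 (dist (M.step q.1 q.2 uv) (M.step q'.1 q'.2 uv)) ∂M.noise ≤ 1 := by
      calc _ ≤ ∫ _, (1 : ℝ) ∂M.noise := integral_mono_of_nonneg
            (Eventually.of_forall fun uv => le_min zero_le_one dist_nonneg) (integrable_const _)
            (Eventually.of_forall fun uv => min_le_left _ _)
        _ = 1 := by simp
    have h2 := one_le_wt hs.le hr.le hq.2
    have h3 := one_le_wt hs.le hr.le hq'.2
    nlinarith

/-! ### Controlled chains -/

/-- A chain `X` driven by the noise under parameters `Θ t` that depend on the past only. -/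
structure Controlled (M : GIGI1) (ξ : ℕ → Ω → ℝ × ℝ) (Θ : ℕ → Ω → Param)
    (X : ℕ → Ω → ℝ × ℝ) : Prop where
  measurable_param : ∀ t, Measurable[past ξ (t + 1)] (Θ t)
  measurable_state : ∀ t, Measurable[past ξ (t + 1)] (X t)
  param_mem : ∀ t ω, Θ t ω ∈ M.box
  state_mem : ∀ t ω, X t ω ∈ stateSpace
  state_zero : ∀ ω, X 0 ω = (0, 0)
  state_succ : ∀ t ω, X (t + 1) ω = M.step (Θ t ω) (X t ω) (ξ (t + 1) ω)

variable {Θ : ℕ → Ω → Param} {X : ℕ → Ω → ℝ × ℝ}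

lemma Controlled.moment [IsProbabilityMeasure P] (hM : M.Regular) (hξ : M.IsNoise P ξ)
    (hX : M.Controlled ξ Θ X) {s r : ℝ} (hd : M.Drift s r) (t : ℕ) :
    Integrable (fun ω => wt s r (X t ω)) P ∧
      ∫ ω, wt s r (X t ω) ∂P ≤ (1 - M.rate s r)⁻¹ := by
  induction t with
  | zero => simpa [hX.state_zero, wt_zero] using hd.one_le_inv
  | succ t ih =>
    simp only [hX.state_succ]
    exact IsNoise.moment_step hM hξ hd (hX.measurable_param t) (hX.param_mem t)
      (hX.measurable_state t) (hX.state_mem t) ih.1 ih.2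

/-- The chain that starts from `X τ` and uses the parameter `ϑ` from then on. -/
def frozen (M : GIGI1) (ξ : ℕ → Ω → ℝ × ℝ) (X : ℕ → Ω → ℝ × ℝ) (ϑ : ℕ → Ω → Param)
    (k τ : ℕ) (ω : Ω) : ℝ × ℝ :=
  M.path (ϑ τ ω) (X τ ω) (fun j => ξ (τ + 1 + j) ω) k

lemma Controlled.tight [IsProbabilityMeasure P] (hM : M.Regular) (hξ : M.IsNoise P ξ)
    (hX : M.Controlled ξ Θ X) {s r : ℝ} (hd : M.Drift s r) (k : ℕ) {ϑ : ℕ → Ω → Param}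
    (hϑ : ∀ τ, Measurable (ϑ τ)) (hϑm : ∀ τ ω, ϑ τ ω ∈ M.box) :
    M.Tight P s r (1 - M.rate s r)⁻¹ fun τ ω => (ϑ τ ω, X (τ + k) ω) where
  measurable τ := (hϑ τ).prodMk ((hX.measurable_state _).mono (hξ.past_le _) le_rfl)
  mem τ ω := ⟨hϑm τ ω, hX.state_mem _ ω⟩
  integrable _ := (hX.moment hM hξ hd _).1
  moment _ := (hX.moment hM hξ hd _).2

section Frozen

variable {ϑ : ℕ → Ω → Param}

lemma Controlled.measurable_frozen (hM : M.Regular) (hX : M.Controlled ξ Θ X)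
    (hϑ : ∀ τ, Measurable[past ξ (τ + 1)] (ϑ τ)) (hϑm : ∀ τ ω, ϑ τ ω ∈ M.box) (k τ : ℕ) :
    Measurable[past ξ (τ + 1 + k)] (M.frozen ξ X ϑ k τ) :=
  IsNoise.measurable_path hM (hϑ τ) (hϑm τ) (hX.measurable_state τ) k

lemma Controlled.tight_frozen [IsProbabilityMeasure P] (hM : M.Regular) (hξ : M.IsNoise P ξ)
    (hX : M.Controlled ξ Θ X) {s r : ℝ} (hd : M.Drift s r)
    (hϑ : ∀ τ, Measurable[past ξ (τ + 1)] (ϑ τ)) (hϑm : ∀ τ ω, ϑ τ ω ∈ M.box) (k : ℕ) :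
    M.Tight P s r (1 - M.rate s r)⁻¹ fun τ ω => (ϑ τ ω, M.frozen ξ X ϑ k τ ω) where
  measurable τ := ((hϑ τ).mono (hξ.past_le _) le_rfl).prodMk
    ((hX.measurable_frozen hM hϑ hϑm k τ).mono (hξ.past_le _) le_rfl)
  mem τ ω := ⟨hϑm τ ω, IsNoise.path_mem hM hξ (hϑm τ) (hX.state_mem τ) k ω⟩
  integrable τ := (IsNoise.moment_path hM hξ hd (hϑ τ) (hϑm τ) (hX.measurable_state τ)
    (hX.state_mem τ) (hX.moment hM hξ hd τ).1 (hX.moment hM hξ hd τ).2 k).1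
  moment τ := (IsNoise.moment_path hM hξ hd (hϑ τ) (hϑm τ) (hX.measurable_state τ)
    (hX.state_mem τ) (hX.moment hM hξ hd τ).1 (hX.moment hM hξ hd τ).2 k).2

lemma Close.prodMk [IsProbabilityMeasure P] {E F : Type*} [PseudoMetricSpace E]
    [PseudoMetricSpace F] [MeasurableSpace E] [MeasurableSpace F] [OpensMeasurableSpace E]
    [OpensMeasurableSpace F] [SecondCountableTopology E] [SecondCountableTopology F]
    {q q' : ℕ → Ω → E} {p p' : ℕ → Ω → F} (hq : ∀ τ, Measurable (q τ))
    (hq' : ∀ τ, Measurable (q' τ)) (hp : ∀ τ, Measurable (p τ)) (hp' : ∀ τ, Measurable (p' τ))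
    (h : Close P q q') (h' : Close P p p') :
    Close P (fun τ ω => (q τ ω, p τ ω)) fun τ ω => (q' τ ω, p' τ ω) := by
  refine squeeze_zero (fun τ => integral_nonneg fun ω => le_min zero_le_one dist_nonneg)
    (fun τ => ?_) (by simpa using Tendsto.add h h')
  have i1 := integrable_min_one (P := P) ((hq τ).dist (hq' τ)) fun _ => dist_nonneg
  have i2 := integrable_min_one (P := P) ((hp τ).dist (hp' τ)) fun _ => dist_nonneg
  rw [← integral_add i1 i2]
  refine integral_mono_of_nonneg (Eventually.of_forall fun ω => le_min zero_le_one dist_nonneg)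
    (i1.add i2) (Eventually.of_forall fun ω => ?_)
  simp only [Prod.dist_eq]
  have h1 : 0 ≤ min 1 (dist (q τ ω) (q' τ ω)) := le_min zero_le_one dist_nonneg
  have h2 : 0 ≤ min 1 (dist (p τ ω) (p' τ ω)) := le_min zero_le_one dist_nonneg
  rcases max_cases (dist (q τ ω) (q' τ ω)) (dist (p τ ω) (p' τ ω)) with ⟨e, -⟩ | ⟨e, -⟩ <;>
  · rw [e]
    linarith

/-- If the parameter stays close to the frozen one, then so does the chain. -/
lemma Controlled.close_frozen [IsProbabilityMeasure P] (hM : M.Regular) (hξ : M.IsNoise P ξ)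
    (hX : M.Controlled ξ Θ X)
    (hϑ : ∀ τ, Measurable[past ξ (τ + 1)] (ϑ τ)) (hϑm : ∀ τ ω, ϑ τ ω ∈ M.box)
    (hclose : ∀ k, Close P (fun τ => Θ (τ + k)) ϑ) (k : ℕ) :
    Close P (fun τ => X (τ + k)) (M.frozen ξ X ϑ k) := by
  obtain ⟨s, r, hd, -, -, -⟩ := hM.exists_drift_eight
  have hΘ : ∀ k τ, Measurable (Θ (τ + k)) := fun k τ =>
    (hX.measurable_param _).mono (hξ.past_le _) le_rfl
  have hXm : ∀ k τ, Measurable (X (τ + k)) := fun k τ =>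
    (hX.measurable_state _).mono (hξ.past_le _) le_rfl
  have hϑ' : ∀ τ, Measurable (ϑ τ) := fun τ => (hϑ τ).mono (hξ.past_le _) le_rfl
  induction k with
  | zero => simp [Close, frozen, path]
  | succ k ih =>
    have h1 := Close.prodMk (hΘ k) hϑ' (hXm k)
      (fun τ => (hX.measurable_frozen hM hϑ hϑm k τ).mono (hξ.past_le _) le_rfl) (hclose k) ih
    -- Both chains consume the noise with index `τ + k + 1` in this step, and both pairs are
    -- determined by the earlier noise.
    have h2 := Close.step hM hξ hd.s_pos hd.r_pos (m := fun τ => τ + k + 1)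
      (hX.tight hM hξ hd k (hΘ k) fun τ => hX.param_mem _)
      (hX.tight_frozen hM hξ hd hϑ hϑm k)
      (fun τ => (hX.measurable_param _).prodMk (hX.measurable_state _)) (fun τ => ?_) h1
    · refine Filter.Tendsto.congr (fun τ => ?_) h2
      refine integral_congr_ae (Eventually.of_forall fun ω => ?_)
      simp only [frozen, path, ← add_assoc, hX.state_succ, add_right_comm τ 1 k]
    · have hle : past ξ (τ + 1 + k) = past ξ (τ + k + 1) := by rw [add_right_comm]
      rw [← hle]
      exact ((hϑ τ).mono (past_mono (Nat.le_add_right _ _)) le_rfl).prodMk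
        (hX.measurable_frozen hM hϑ hϑm k τ)

end Frozen

end GIGI1

/-! ### A deterministic recursion for stochastic approximation -/

/-- A perturbed linear recursion with divergent step sizes tends to zero. -/
lemma tendsto_zero_of_recursion {a b h : ℕ → ℝ} {c : ℝ} (hc : 0 < c) (ha : ∀ t, 0 ≤ a t)
    (hpos : ∀ t, 0 < h t) (hlim : Tendsto h atTop (𝓝 0)) (hdiv : ¬ Summable h)
    (hb : ∀ ε > 0, ∀ᶠ t in atTop, b t ≤ ε)
    (hrec : ∀ t, a (t + 1) ≤ (1 - c * h t) * a t + h t * b t) : Tendsto a atTop (𝓝 0) := by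
  refine tendsto_order.2 ⟨fun v hv => Eventually.of_forall fun t => hv.trans_le (ha t),
    fun v hv => ?_⟩
  set ε := v / 2 with hε
  have hε0 : 0 < ε := half_pos hv
  have hch : ∀ᶠ t in atTop, c * h t ≤ 1 := by
    have := hlim.const_mul c
    rw [mul_zero] at this
    exact (this.eventually_lt_const one_pos).mono fun t => le_of_lt
  obtain ⟨T, hT⟩ := eventually_atTop.1 (hch.and (hb (c * ε) (by positivity)))
  -- The excess over the level `ε` shrinks by the factor `1 - c h ≤ exp (-c h)` at each step, and
  -- the product of these factors vanishes because the step sizes are not summable.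
  set d : ℕ → ℝ := fun n => max (a (T + n) - ε) 0 with hd
  have hstep : ∀ n, d (n + 1) ≤ Real.exp (-(c * h (T + n))) * d n := by
    intro n
    obtain ⟨h1, h2⟩ := hT (T + n) (Nat.le_add_right _ _)
    have h3 := hrec (T + n)
    have h4 := mul_le_mul_of_nonneg_left h2 (hpos (T + n)).le
    have h5 : a (T + (n + 1)) - ε ≤ (1 - c * h (T + n)) * (a (T + n) - ε) := by
      rw [← add_assoc]; linarith
    have h6 : (1 - c * h (T + n)) * (a (T + n) - ε) ≤ (1 - c * h (T + n)) * d n :=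
      mul_le_mul_of_nonneg_left (le_max_left _ _) (by linarith)
    have h7 : 0 ≤ d n := le_max_right _ _
    have h8 : (1 - c * h (T + n)) * d n ≤ Real.exp (-(c * h (T + n))) * d n :=
      mul_le_mul_of_nonneg_right (by linarith [Real.add_one_le_exp (-(c * h (T + n)))]) h7
    exact max_le (by linarith) (mul_nonneg (Real.exp_pos _).le h7)
  have hprod : ∀ n, d n ≤ Real.exp (-(c * ∑ i ∈ Finset.range n, h (T + i))) * d 0 := by
    intro n
    induction n with
    | zero => simp
    | succ n ih =>
      refine (hstep n).trans ((mul_le_mul_of_nonneg_left ih (Real.exp_pos _).le).trans_eq ?_)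
      rw [← mul_assoc, ← Real.exp_add, Finset.sum_range_succ]
      ring_nf
  have hdiv' : ¬ Summable fun i => h (T + i) := by
    simp only [add_comm T]
    rwa [summable_nat_add_iff T]
  have hsum := (not_summable_iff_tendsto_nat_atTop_of_nonneg fun i => (hpos (T + i)).le).1 hdiv'
  have hexp : Tendsto (fun n => Real.exp (-(c * ∑ i ∈ Finset.range n, h (T + i))) * d 0)
      atTop (𝓝 0) := by
    have h1 : Tendsto (fun n => Real.exp (-(c * ∑ i ∈ Finset.range n, h (T + i)))) atTop (𝓝 0) :=
      Real.tendsto_exp_neg_atTop_nhds_zero.comp (hsum.const_mul_atTop hc)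
    simpa using h1.mul_const (d 0)
  obtain ⟨N, hN⟩ := eventually_atTop.1 (hexp.eventually_lt_const hε0)
  filter_upwards [eventually_ge_atTop (T + N)] with t ht
  obtain ⟨k, rfl⟩ := Nat.exists_eq_add_of_le ht
  have h1 := (hprod (N + k)).trans_lt (hN (N + k) (Nat.le_add_right _ _))
  have h2 : a (T + (N + k)) - ε ≤ d (N + k) := le_max_left _ _
  rw [add_assoc]
  linarith

namespace GIGI1

variable {M : GIGI1}

/-! ### Regularity of the gradient estimator -/

lemma Regular.continuousOn_lamDeriv (hM : M.Regular) :
    ContinuousOn (fun ϑ : Param => M.lamDeriv (ϑ 1)) M.box :=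
  (hM.stable.lam_smooth.continuousOn_derivWithin (uniqueDiffOn_Icc hM.p_lt) le_rfl).comp
    (by fun_prop) fun _ h => h.2

lemma Regular.continuousOn_costDeriv (hM : M.Regular) :
    ContinuousOn (fun ϑ : Param => M.costDeriv (ϑ 0)) M.box :=
  (hM.stable.cost_smooth.continuousOn_derivWithin (uniqueDiffOn_Icc hM.mu_lt) le_rfl).comp
    (by fun_prop) fun _ h => h.1

lemma continuousOn_vec {α : Type*} [TopologicalSpace α] {S : Set α} {f g : α → ℝ}
    (hf : ContinuousOn f S) (hg : ContinuousOn g S) :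
    ContinuousOn (fun a => (!₂[f a, g a] : Param)) S := by
  refine (PiLp.continuous_toLp 2 _).comp_continuousOn (continuousOn_pi.2 fun i => ?_)
  fin_cases i
  exacts [hf, hg]

lemma Regular.continuousOn_load (hM : M.Regular) : ContinuousOn M.load M.box :=
  fun _ hϑ => (hM.hasFDerivWithinAt_load hϑ).continuousWithinAt

lemma Regular.continuousOn_slope (hM : M.Regular) : ContinuousOn M.slope M.box :=
  continuousOn_vec (continuousOn_const.mul hM.continuousOn_load).neg
    (continuousOn_const.mul hM.continuousOn_lamDeriv)

lemma Regular.continuousOn_meanGrad (hM : M.Regular) : ContinuousOn M.meanGrad M.box := by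
  have h1 : ContinuousOn (fun ϑ : Param => M.meanState ϑ + 1 / ϑ 0) M.box :=
    hM.continuousOn_meanState.add (continuousOn_const.div (by fun_prop)
      fun ϑ hϑ => (hM.mu_pos hϑ).ne')
  exact continuousOn_vec
    (hM.continuousOn_costDeriv.sub ((continuousOn_const.mul hM.continuousOn_load).mul h1))
    ((hM.continuousOn_lam.neg.sub ((by fun_prop : ContinuousOn (fun ϑ : Param => ϑ 1) M.box).mul
      hM.continuousOn_lamDeriv)).add ((continuousOn_const.mul hM.continuousOn_lamDeriv).mul h1))

lemma Regular.continuousOn_gradEst (hM : M.Regular) :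
    ContinuousOn (fun q : Param × (ℝ × ℝ) => M.gradEst q.1 q.2) M.pairs := by
  have h : ∀ {E : Type} [TopologicalSpace E] {f : Param → E}, ContinuousOn f M.box →
      ContinuousOn (fun q : Param × (ℝ × ℝ) => f q.1) M.pairs := fun hf =>
    hf.comp continuousOn_fst fun q hq => hq.1
  simp only [gradEst_eq]
  exact (h hM.continuousOn_meanGrad).add ((ContinuousOn.sub (by fun_prop)
    (h hM.continuousOn_meanState)).smul (h hM.continuousOn_slope))

lemma Regular.exists_norm_gradEst_le (hM : M.Regular) {s r : ℝ} (hs : 0 < s) (hr : 0 < r) :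
    ∃ C, 0 ≤ C ∧ ∀ ϑ ∈ M.box, ∀ x ∈ stateSpace, ‖M.gradEst ϑ x‖ ≤ C * wt s r x := by
  obtain ⟨A, hA⟩ := M.isCompact_box.exists_bound_of_continuousOn hM.continuousOn_meanGrad
  obtain ⟨B, hB⟩ := M.isCompact_box.exists_bound_of_continuousOn hM.continuousOn_meanState
  obtain ⟨D, hD⟩ := M.isCompact_box.exists_bound_of_continuousOn hM.continuousOn_slope
  refine ⟨|A| + (s⁻¹ + r⁻¹ + |B|) * |D|, by positivity, fun ϑ hϑ x hx => ?_⟩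
  have hw := one_le_wt hs.le hr.le hx
  have h1 := (hA ϑ hϑ).trans (le_abs_self A)
  have h2 := (hB ϑ hϑ).trans (le_abs_self B)
  have h3 := (hD ϑ hϑ).trans (le_abs_self D)
  have h4 := (tame_add (M := M) hs hr).bound ϑ hϑ x hx
  have h5 : ‖x.1 + x.2 - M.meanState ϑ‖ ≤ (s⁻¹ + r⁻¹ + |B|) * wt s r x := by
    refine (norm_sub_le _ _).trans ?_
    rw [add_mul]
    refine add_le_add h4 (h2.trans ?_)
    exact le_mul_of_one_le_right (abs_nonneg _) hw
  rw [gradEst_eq]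
  refine (norm_add_le _ _).trans ?_
  rw [norm_smul, add_mul]
  refine add_le_add (h1.trans (le_mul_of_one_le_right (abs_nonneg _) hw)) ?_
  calc _ ≤ (s⁻¹ + r⁻¹ + |B|) * wt s r x * |D| :=
        mul_le_mul h5 h3 (norm_nonneg _) (by have := wt_pos s r x; positivity)
    _ = _ := by ring

/-! ### The projection -/

lemma Regular.proj_mem (hM : M.Regular) (ϑ : Param) : M.proj ϑ ∈ M.box := by
  have h1 := hM.mu_lt.le
  have h2 := hM.p_lt.le
  refine ⟨⟨?_, ?_⟩, ⟨?_, ?_⟩⟩ <;> simp [proj, h1, h2]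

lemma continuous_proj (M : GIGI1) : Continuous M.proj := by
  refine (PiLp.continuous_toLp 2 _).comp (continuous_pi fun i => ?_)
  fin_cases i <;> simp <;> fun_prop

lemma abs_clip_sub_le {l u a b : ℝ} (h1 : l ≤ b) (h2 : b ≤ u) :
    |max l (min u a) - b| ≤ |a - b| := by
  have e : b = max l (min u b) := by rw [min_eq_right h2, max_eq_right h1]
  conv_lhs => rw [e]
  refine (abs_max_sub_max_le_max _ _ _ _).trans (max_le (by simp) ?_)
  exact (abs_min_sub_min_le_max _ _ _ _).trans (max_le (by simp) le_rfl)

lemma norm_proj_sub_le {ϑ ϑ' : Param} (hϑ' : ϑ' ∈ M.box) : ‖M.proj ϑ - ϑ'‖ ≤ ‖ϑ - ϑ'‖ := by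
  rw [EuclideanSpace.norm_eq, EuclideanSpace.norm_eq]
  apply Real.sqrt_le_sqrt
  simp only [Fin.sum_univ_two, PiLp.sub_apply, Real.norm_eq_abs]
  have h0 : |M.proj ϑ 0 - ϑ' 0| ≤ |ϑ 0 - ϑ' 0| := by
    simpa [proj] using abs_clip_sub_le (a := ϑ 0) hϑ'.1.1 hϑ'.1.2
  have h1 : |M.proj ϑ 1 - ϑ' 1| ≤ |ϑ 1 - ϑ' 1| := by
    simpa [proj] using abs_clip_sub_le (a := ϑ 1) hϑ'.2.1 hϑ'.2.2
  gcongr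

end GIGI1

namespace GIGI1

variable {M : GIGI1} {Ω : Type*} {mΩ : MeasurableSpace Ω} {P : Measure Ω} {ξ : ℕ → Ω → ℝ × ℝ}

/-! ### Convergence of the parameters -/

lemma Close.trans [IsProbabilityMeasure P] {E : Type*} [PseudoMetricSpace E] [MeasurableSpace E]
    [OpensMeasurableSpace E] [SecondCountableTopology E] {q q' q'' : ℕ → Ω → E}
    (hq : ∀ τ, Measurable (q τ)) (hq' : ∀ τ, Measurable (q' τ)) (hq'' : ∀ τ, Measurable (q'' τ))
    (h : Close P q q') (h' : Close P q' q'') : Close P q q'' := by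
  refine squeeze_zero (fun τ => integral_nonneg fun ω => le_min zero_le_one dist_nonneg)
    (fun τ => ?_) (by simpa using Tendsto.add h h')
  have i1 := integrable_min_one (P := P) ((hq τ).dist (hq' τ)) fun _ => dist_nonneg
  have i2 := integrable_min_one (P := P) ((hq' τ).dist (hq'' τ)) fun _ => dist_nonneg
  rw [← integral_add i1 i2]
  refine integral_mono_of_nonneg (Eventually.of_forall fun ω => le_min zero_le_one dist_nonneg)
    (i1.add i2) (Eventually.of_forall fun ω => ?_)
  have h0 := dist_triangle (q τ ω) (q' τ ω) (q'' τ ω)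
  have h1 : 0 ≤ dist (q τ ω) (q' τ ω) := dist_nonneg
  have h2 : 0 ≤ dist (q' τ ω) (q'' τ ω) := dist_nonneg
  simp only
  rcases min_cases 1 (dist (q τ ω) (q' τ ω)) with ⟨e1, -⟩ | ⟨e1, -⟩ <;>
  rcases min_cases 1 (dist (q' τ ω) (q'' τ ω)) with ⟨e2, -⟩ | ⟨e2, -⟩ <;>
  rw [e1, e2]
  · exact (min_le_left _ _).trans (by norm_num)
  · exact (min_le_left _ _).trans (by linarith)
  · exact (min_le_left _ _).trans (by linarith)
  · exact (min_le_right _ _).trans h0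

lemma Close.of_integral_le {E : Type*} [PseudoMetricSpace E] [IsProbabilityMeasure P]
    {q q' : ℕ → Ω → E} {f : ℕ → Ω → ℝ}
    (hle : ∀ τ ω, dist (q τ ω) (q' τ ω) ≤ f τ ω) (hi : ∀ τ, Integrable (f τ) P)
    (hlim : Tendsto (fun τ => ∫ ω, f τ ω ∂P) atTop (𝓝 0)) : Close P q q' :=
  squeeze_zero (fun _ => integral_nonneg fun _ => le_min zero_le_one dist_nonneg)
    (fun τ => integral_mono_of_nonneg (Eventually.of_forall fun _ => le_min zero_le_one dist_nonneg)
      (hi τ) (Eventually.of_forall fun ω => (min_le_right _ _).trans (hle τ ω))) hlim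

/-- The parameter process of the algorithm. -/
def algParam (M : GIGI1) (η : ℕ → ℝ) (ϑ₁ : Param) (ξ : ℕ → Ω → ℝ × ℝ) (t : ℕ) (ω : Ω) : Param :=
  (M.samcmc η ϑ₁ (fun k => ξ k ω) t).2

/-- The state process of the algorithm. -/
def algState (M : GIGI1) (η : ℕ → ℝ) (ϑ₁ : Param) (ξ : ℕ → Ω → ℝ × ℝ) (t : ℕ) (ω : Ω) : ℝ × ℝ :=
  (M.samcmc η ϑ₁ (fun k => ξ k ω) t).1

section Algorithm

variable {η : ℕ → ℝ} {ϑ₁ ϑs : Param}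

lemma algParam_succ (t : ℕ) (ω : Ω) : M.algParam η ϑ₁ ξ (t + 1) ω =
    M.proj (M.algParam η ϑ₁ ξ t ω - η (t + 1) •
      M.gradEst (M.algParam η ϑ₁ ξ t ω) (M.algState η ϑ₁ ξ (t + 1) ω)) := rfl

lemma IsNoise.controlled (hM : M.Regular) (hξ : M.IsNoise P ξ) (hϑ₁ : ϑ₁ ∈ M.box) :
    M.Controlled ξ (M.algParam η ϑ₁ ξ) (M.algState η ϑ₁ ξ) := by
  have hpm : ∀ t ω, M.algParam η ϑ₁ ξ t ω ∈ M.box := fun t ω => by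
    cases t with
    | zero => exact hϑ₁
    | succ t => exact hM.proj_mem _
  have hsm : ∀ t ω, M.algState η ϑ₁ ξ t ω ∈ stateSpace := fun t ω => by
    induction t with
    | zero => exact zero_mem_stateSpace
    | succ t ih => exact hM.step_mem (hpm t ω) ih (hξ.nonneg _ ω).1
  have hmeas : ∀ t, Measurable[past ξ (t + 1)] (M.algParam η ϑ₁ ξ t) ∧
      Measurable[past ξ (t + 1)] (M.algState η ϑ₁ ξ t) := fun t => by
    induction t with
    | zero => exact ⟨measurable_const, measurable_const⟩
    | succ t ih =>
      have h1 : Measurable[past ξ (t + 1 + 1)] (M.algState η ϑ₁ ξ (t + 1)) :=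
        IsNoise.measurable_step hM ih.1 (hpm t) ih.2
      have h2 : Measurable[past ξ (t + 1 + 1)] (M.algParam η ϑ₁ ξ t) :=
        ih.1.mono (past_mono (Nat.le_succ _)) le_rfl
      have h3 : Measurable[past ξ (t + 1 + 1)] fun ω =>
          M.gradEst (M.algParam η ϑ₁ ξ t ω) (M.algState η ϑ₁ ξ (t + 1) ω) :=
        hM.continuousOn_gradEst.measurable_comp_of_mem (h2.prodMk h1)
          fun ω => ⟨hpm t ω, hsm (t + 1) ω⟩
      exact ⟨(continuous_proj M).measurable.comp (h2.sub (h3.const_smul (η (t + 1)))), h1⟩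
  exact ⟨fun t => (hmeas t).1, fun t => (hmeas t).2, hpm, hsm, fun _ => rfl, fun _ _ => rfl⟩

/-- A single update moves the parameter by at most `η ‖H‖`, and the mean of `‖H‖` is bounded along
the chain. Since the step sizes tend to zero, any fixed number of updates is negligible. -/
lemma IsNoise.close_algParam [IsProbabilityMeasure P] (hM : M.Regular) (hξ : M.IsNoise P ξ)
    (hη : StepSize η) (hϑ₁ : ϑ₁ ∈ M.box) (k : ℕ) :
    Close P (fun τ => M.algParam η ϑ₁ ξ (τ + k)) (M.algParam η ϑ₁ ξ) := by
  obtain ⟨s, r, hd, -, -, -⟩ := hM.exists_drift_eight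
  obtain ⟨C, hC, hH⟩ := hM.exists_norm_gradEst_le hd.s_pos hd.r_pos
  have hX := hξ.controlled (η := η) hM hϑ₁
  have hΘ : ∀ t, Measurable (M.algParam η ϑ₁ ξ t) := fun t =>
    (hX.measurable_param t).mono (hξ.past_le _) le_rfl
  induction k with
  | zero => simp [Close]
  | succ k ih =>
    refine Close.trans (fun τ => hΘ _) (fun τ => hΘ _) hΘ ?_ ih
    have hmom := fun t => hX.moment hM hξ hd t
    refine Close.of_integral_le (f := fun τ ω => η (τ + k + 1) *
      (C * wt s r (M.algState η ϑ₁ ξ (τ + k + 1) ω))) (fun τ ω => ?_)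
      (fun τ => ((hmom _).1.const_mul C).const_mul _) ?_
    · have h0 := (hη.pos (τ + k + 1) (Nat.le_add_left 1 _)).le
      rw [← add_assoc, algParam_succ, dist_eq_norm]
      refine (norm_proj_sub_le (hX.param_mem _ ω)).trans ?_
      rw [sub_sub_cancel_left, norm_neg, norm_smul, Real.norm_of_nonneg h0]
      exact mul_le_mul_of_nonneg_left (hH _ (hX.param_mem _ ω) _ (hX.state_mem _ ω)) h0
    · have hlim : Tendsto (fun τ : ℕ => η (τ + k + 1) * (C * (1 - M.rate s r)⁻¹)) atTop (𝓝 0) := by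
        have := ((tendsto_add_atTop_iff_nat (k + 1)).2 hη.tendsto_zero).mul_const
          (C * (1 - M.rate s r)⁻¹)
        simpa [add_assoc] using this
      refine squeeze_zero (fun τ => integral_nonneg fun ω => ?_) (fun τ => ?_) hlim
      · have h0 := (hη.pos (τ + k + 1) (Nat.le_add_left 1 _)).le
        have := (wt_pos s r (M.algState η ϑ₁ ξ (τ + k + 1) ω)).le
        positivity
      · have h0 := (hη.pos (τ + k + 1) (Nat.le_add_left 1 _)).le
        rw [integral_const_mul, integral_const_mul]
        have := (hmom (τ + k + 1)).2
        gcongr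

/-- The drift of the algorithm towards the optimum, up to the term given by strong convexity. -/
def excess (M : GIGI1) (ϑs : Param) (K₀ : ℝ) (q : Param × (ℝ × ℝ)) : ℝ :=
  inner ℝ (q.1 - ϑs) (M.gradEst q.1 q.2) - K₀ * ‖q.1 - ϑs‖ ^ 2

lemma Regular.continuousOn_excess (hM : M.Regular) (ϑs : Param) (K₀ : ℝ) :
    ContinuousOn (M.excess ϑs K₀) M.pairs := by
  unfold excess
  exact ((by fun_prop : ContinuousOn (fun q : Param × (ℝ × ℝ) => q.1 - ϑs) M.pairs).inner
    hM.continuousOn_gradEst).sub (by fun_prop)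

lemma exists_norm_sub_le (M : GIGI1) (ϑs : Param) :
    ∃ B, 0 ≤ B ∧ ∀ ϑ ∈ M.box, ‖ϑ - ϑs‖ ≤ B := by
  obtain ⟨B, hB⟩ := M.isCompact_box.exists_bound_of_continuousOn
    (f := fun ϑ : Param => ϑ - ϑs) (by fun_prop)
  exact ⟨|B|, abs_nonneg _, fun ϑ hϑ => (hB ϑ hϑ).trans (le_abs_self B)⟩

lemma Regular.exists_abs_excess_le (hM : M.Regular) {s r : ℝ} (hs : 0 < s) (hr : 0 < r)
    (ϑs : Param) (K₀ : ℝ) :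
    ∃ C, 0 ≤ C ∧ ∀ q ∈ M.pairs, |M.excess ϑs K₀ q| ≤ C * wt s r q.2 := by
  obtain ⟨C, hC, hH⟩ := hM.exists_norm_gradEst_le hs hr
  obtain ⟨B, hB0, hB⟩ := M.exists_norm_sub_le ϑs
  refine ⟨B * C + |K₀| * B ^ 2, by positivity, fun q hq => ?_⟩
  have h1 := hB q.1 hq.1
  have h2 := hH q.1 hq.1 q.2 hq.2
  have hw := one_le_wt hs.le hr.le hq.2
  have h3 := abs_real_inner_le_norm (q.1 - ϑs) (M.gradEst q.1 q.2)
  have h4 : ‖q.1 - ϑs‖ * ‖M.gradEst q.1 q.2‖ ≤ B * (C * wt s r q.2) :=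
    mul_le_mul h1 h2 (norm_nonneg _) hB0
  have h5 : |K₀ * ‖q.1 - ϑs‖ ^ 2| ≤ |K₀| * B ^ 2 := by
    rw [abs_mul, abs_of_nonneg (sq_nonneg ‖q.1 - ϑs‖)]
    gcongr
  have h6 : |K₀| * B ^ 2 ≤ |K₀| * B ^ 2 * wt s r q.2 :=
    le_mul_of_one_le_right (by positivity) hw
  have h7 := abs_sub (inner ℝ (q.1 - ϑs) (M.gradEst q.1 q.2)) (K₀ * ‖q.1 - ϑs‖ ^ 2)
  unfold excess
  rw [add_mul]
  linarith

/-- Asymptotically the algorithm moves towards the optimum on average. -/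
lemma IsNoise.eventually_neg_le_excess [IsProbabilityMeasure P] (hM : M.Regular)
    (hξ : M.IsNoise P ξ) (hη : StepSize η) (hϑ₁ : ϑ₁ ∈ M.box) {K₀ : ℝ}
    (hconv : ∀ ϑ ∈ M.box, K₀ * ‖ϑ - ϑs‖ ^ 2 ≤ inner ℝ (ϑ - ϑs) (M.gradObj ϑ))
    {ε : ℝ} (hε : 0 < ε) :
    ∀ᶠ t in atTop, -ε ≤ ∫ ω, M.excess ϑs K₀
      (M.algParam η ϑ₁ ξ t ω, M.algState η ϑ₁ ξ (t + 1) ω) ∂P := by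
  obtain ⟨s, r, hd, hd2, -, -⟩ := hM.exists_drift_eight
  set Θ := M.algParam η ϑ₁ ξ with hΘdef
  set X := M.algState η ϑ₁ ξ with hXdef
  have hX : M.Controlled ξ Θ X := hξ.controlled hM hϑ₁
  have hΘ : ∀ t, Measurable (Θ t) := fun t => (hX.measurable_param t).mono (hξ.past_le _) le_rfl
  have hXmeas : ∀ t, Measurable (X t) := fun t =>
    (hX.measurable_state t).mono (hξ.past_le _) le_rfl
  obtain ⟨C, hC, hex⟩ := hM.exists_abs_excess_le hd.s_pos hd.r_pos ϑs K₀
  obtain ⟨B, hB0, hB⟩ := M.exists_norm_sub_le ϑs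
  obtain ⟨D, hD⟩ := M.isCompact_box.exists_bound_of_continuousOn hM.continuousOn_slope
  have hz := tame_add (M := M) hd.s_pos hd.r_pos
  set A := 6 * (s⁻¹ + r⁻¹) / (1 - M.rate s r) with hA
  have hr1 := sub_pos.2 hd.rate_lt
  have hA0 : 0 ≤ A := by
    have := hd.s_pos
    have := hd.r_pos
    positivity
  -- the lag
  obtain ⟨n, hn⟩ : ∃ n, A * M.rate s r ^ (n + 1) * (B * |D| * (1 - M.rate s r)⁻¹) < ε / 2 := by
    have h0 := ((tendsto_pow_atTop_nhds_zero_of_lt_one (rate_nonneg (M := M) s r)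
      hd.rate_lt).const_mul A).mul_const (B * |D| * (1 - M.rate s r)⁻¹)
    rw [mul_zero, zero_mul] at h0
    exact (((tendsto_add_atTop_iff_nat 1).2 h0).eventually_lt_const (half_pos hε)).exists
  have hq := hX.tight hM hξ hd2 (n + 1) (ϑ := fun τ => Θ (τ + n)) (fun τ => hΘ _)
    (fun τ => hX.param_mem _)
  have hq' := hX.tight_frozen hM hξ hd2 hX.measurable_param hX.param_mem (n + 1)
  have hclose : Close P (fun τ ω => (Θ (τ + n) ω, X (τ + (n + 1)) ω))
      (fun τ ω => (Θ τ ω, M.frozen ξ X Θ (n + 1) τ ω)) :=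
    Close.prodMk (fun τ => hΘ _) hΘ (fun τ => hXmeas _)
      (fun τ => (hX.measurable_frozen hM hX.measurable_param hX.param_mem _ τ).mono
        (hξ.past_le _) le_rfl)
      (hξ.close_algParam hM hη hϑ₁ n)
      (hX.close_frozen hM hξ hX.measurable_param hX.param_mem
        (hξ.close_algParam hM hη hϑ₁) (n + 1))
  -- From `(e - e')² ≤ 2 e² + 2 e'²`; the excess grows like the weight, so moments with doubled
  -- exponents suffice.
  have hlim := hclose.tendsto_integral_abs (C := 2 * C ^ 2) hd2.s_pos hd2.r_pos
    (Ψ := fun q q' => M.excess ϑs K₀ q - M.excess ϑs K₀ q')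
    (((hM.continuousOn_excess ϑs K₀).comp continuousOn_fst fun z hz => hz.1).sub
      ((hM.continuousOn_excess ϑs K₀).comp continuousOn_snd fun z hz => hz.2))
    (fun q _ => sub_self _) (fun q hq q' hq' => by
      have h1 := sq_le_sq' (abs_le.1 (hex q hq)).1 (abs_le.1 (hex q hq)).2
      have h2 := sq_le_sq' (abs_le.1 (hex q' hq')).1 (abs_le.1 (hex q' hq')).2
      rw [wt_two, wt_two]
      nlinarith [sq_nonneg (M.excess ϑs K₀ q + M.excess ϑs K₀ q')]) hq hq'
  have hint : ∀ (Q : Ω → Param × (ℝ × ℝ)), Measurable Q → (∀ ω, Q ω ∈ M.pairs) →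
      Integrable (fun ω => wt (2 * s) (2 * r) (Q ω).2) P →
      Integrable (fun ω => M.excess ϑs K₀ (Q ω)) P := fun Q hQ hQm hQi => by
    refine (hQi.const_mul C).mono' ((hM.continuousOn_excess ϑs K₀).measurable_comp_of_mem hQ
      hQm).aestronglyMeasurable (Eventually.of_forall fun ω => (hex _ (hQm ω)).trans ?_)
    have := one_le_wt hd.s_pos.le hd.r_pos.le (hQm ω).2
    rw [wt_two]
    gcongr
    nlinarith
  -- the frozen chain
  have hfrozen : ∀ τ, -(ε / 2) ≤ ∫ ω, M.excess ϑs K₀ (Θ τ ω, M.frozen ξ X Θ (n + 1) τ ω) ∂P := by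
    intro τ
    -- The state-dependent part of the drift is this quantity, known when the freezing starts, times
    -- the centered `w + y`; its mean decays with the lag.
    have hbm : Measurable[past ξ (τ + 1)] fun ω => inner ℝ (Θ τ ω - ϑs) (M.slope (Θ τ ω)) :=
      (((by fun_prop : ContinuousOn (fun ϑ : Param => ϑ - ϑs) M.box).inner
        hM.continuousOn_slope)).measurable_comp_of_mem (hX.measurable_param τ) (hX.param_mem τ)
    have hbb : ∀ ω, |inner ℝ (Θ τ ω - ϑs) (M.slope (Θ τ ω))| ≤ B * |D| := fun ω =>
      (abs_real_inner_le_norm _ _).trans (mul_le_mul (hB _ (hX.param_mem τ ω))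
        ((hD _ (hX.param_mem τ ω)).trans (le_abs_self D)) (norm_nonneg _) hB0)
    have hmom := hX.moment hM hξ hd τ
    have hbi : Integrable (fun ω => inner ℝ (Θ τ ω - ϑs) (M.slope (Θ τ ω)) * wt s r (X τ ω)) P := by
      refine hmom.1.bdd_mul (c := B * |D|) (hbm.mono (hξ.past_le _) le_rfl).aestronglyMeasurable
        (Eventually.of_forall hbb)
    have hdec := IsNoise.abs_integral_mul_path_le hM hξ hd hz (hX.measurable_param τ)
      (hX.param_mem τ) (hX.measurable_state τ) (hX.state_mem τ) hbm hbi (n + 1)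
    have hle : ∫ ω, |inner ℝ (Θ τ ω - ϑs) (M.slope (Θ τ ω))| * wt s r (X τ ω) ∂P
        ≤ B * |D| * (1 - M.rate s r)⁻¹ := by
      calc _ ≤ ∫ ω, B * |D| * wt s r (X τ ω) ∂P :=
            integral_mono_of_nonneg (Eventually.of_forall fun ω =>
              mul_nonneg (abs_nonneg _) (wt_pos _ _ _).le) (hmom.1.const_mul _)
              (Eventually.of_forall fun ω =>
                mul_le_mul_of_nonneg_right (hbb ω) (wt_pos _ _ _).le)
        _ ≤ _ := by
            rw [integral_const_mul]
            exact mul_le_mul_of_nonneg_left hmom.2 (by positivity)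
    have hpow := pow_nonneg (rate_nonneg (M := M) s r) (n + 1)
    have h1 := hdec.trans (mul_le_mul_of_nonneg_left hle (by positivity))
    have h2 := (abs_le.1 (h1.trans hn.le)).1
    refine h2.trans (integral_mono_ae ?_ ?_ (Eventually.of_forall fun ω => ?_))
    · have i1 := IsNoise.integrable_mul_path hM hξ hd hz (hX.measurable_param τ)
        (hX.param_mem τ) (hX.measurable_state τ) (hX.state_mem τ) hbm hbi (n + 1)
      have i2 : Integrable (fun ω => inner ℝ (Θ τ ω - ϑs) (M.slope (Θ τ ω)) *
          M.statMean (Θ τ ω) fun x => x.1 + x.2) P := by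
        refine Integrable.of_bound (C := B * |D| * (s⁻¹ + r⁻¹ + A))
          ((hbm.mono (hξ.past_le _) le_rfl).mul ((hz.continuousOn_statMean hM
            hd).measurable_comp_of_mem (hΘ τ) (hX.param_mem τ))).aestronglyMeasurable
          (Eventually.of_forall fun ω => ?_)
        rw [norm_mul]
        exact mul_le_mul (hbb ω) (hz.abs_statMean_le hM hd (hX.param_mem τ ω)) (norm_nonneg _)
          (by positivity)
      simp only [mul_sub]
      exact i1.sub i2
    · exact hint _ (hq'.measurable τ) (hq'.mem τ) (hq'.integrable τ)
    -- The remaining part of the frozen drift is the inner product with the true gradient, which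
    -- strong convexity bounds below by the subtracted square.
    · have h3 := hconv _ (hX.param_mem τ ω)
      simp only [excess]
      rw [gradEst_eq, inner_add_right, inner_smul_right, ← hM.gradObj_eq (hX.param_mem τ ω)]
      simp only [frozen, meanState]
      linarith
  have hlim' := hlim.eventually_lt_const (half_pos hε)
  obtain ⟨T, hT⟩ := eventually_atTop.1 hlim'
  filter_upwards [eventually_ge_atTop (T + n)] with t ht
  obtain ⟨τ, rfl⟩ : ∃ τ, t = τ + n := ⟨t - n, by omega⟩
  have h1 := hT τ (by omega)
  have i1 := hint _ (hq.measurable τ) (hq.mem τ) (hq.integrable τ)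
  have i2 := hint _ (hq'.measurable τ) (hq'.mem τ) (hq'.integrable τ)
  have h2 := abs_integral_le_integral_abs (μ := P) (f := fun ω =>
    M.excess ϑs K₀ (Θ (τ + n) ω, X (τ + (n + 1)) ω)
      - M.excess ϑs K₀ (Θ τ ω, M.frozen ξ X Θ (n + 1) τ ω))
  rw [integral_sub i1 i2] at h2
  have h3 := (abs_le.1 (h2.trans h1.le)).1
  have h4 := hfrozen τ
  rw [add_assoc]
  linarith

/-- Mean square convergence of the parameters to the optimum. -/
theorem IsNoise.tendsto_integral_norm_sub_sq [IsProbabilityMeasure P] (hM : M.Regular)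
    (hξ : M.IsNoise P ξ) (hη : StepSize η) (hϑ₁ : ϑ₁ ∈ M.box) (hϑs : ϑs ∈ M.box) {K₀ : ℝ}
    (hK₀ : 0 < K₀)
    (hconv : ∀ ϑ ∈ M.box, K₀ * ‖ϑ - ϑs‖ ^ 2 ≤ inner ℝ (ϑ - ϑs) (M.gradObj ϑ)) :
    Tendsto (fun t => ∫ ω, ‖M.algParam η ϑ₁ ξ t ω - ϑs‖ ^ 2 ∂P) atTop (𝓝 0) := by
  obtain ⟨s, r, hd, hd2, -, -⟩ := hM.exists_drift_eight
  set Θ := M.algParam η ϑ₁ ξ with hΘdef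
  set X := M.algState η ϑ₁ ξ with hXdef
  have hX : M.Controlled ξ Θ X := hξ.controlled hM hϑ₁
  have hΘ : ∀ t, Measurable (Θ t) := fun t => (hX.measurable_param t).mono (hξ.past_le _) le_rfl
  have hXmeas : ∀ t, Measurable (X t) := fun t =>
    (hX.measurable_state t).mono (hξ.past_le _) le_rfl
  obtain ⟨C, hC, hex⟩ := hM.exists_abs_excess_le hd.s_pos hd.r_pos ϑs K₀
  obtain ⟨B, hB0, hB⟩ := M.exists_norm_sub_le ϑs
  obtain ⟨D, hD0, hH⟩ := hM.exists_norm_gradEst_le hd.s_pos hd.r_pos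
  set K := (1 - M.rate (2 * s) (2 * r))⁻¹ with hK
  set e : ℕ → ℝ := fun t => ∫ ω, M.excess ϑs K₀ (Θ t ω, X (t + 1) ω) ∂P with he
  have hpos : ∀ t, 0 < η (t + 1) := fun t => hη.pos _ (Nat.le_add_left 1 t)
  have hη0 : Tendsto (fun t => η (t + 1)) atTop (𝓝 0) :=
    (tendsto_add_atTop_iff_nat 1).2 hη.tendsto_zero
  have hsqi : ∀ t, Integrable (fun ω => ‖Θ t ω - ϑs‖ ^ 2) P := fun t => by
    refine Integrable.of_bound (C := B ^ 2)
      (((hΘ t).sub_const ϑs).norm.pow_const 2).aestronglyMeasurable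
      (Eventually.of_forall fun ω => ?_)
    rw [norm_pow, norm_norm]
    exact pow_le_pow_left₀ (norm_nonneg _) (hB _ (hX.param_mem t ω)) 2
  refine tendsto_zero_of_recursion (c := 2 * K₀) (h := fun t => η (t + 1))
    (b := fun t => -(2 * e t) + η (t + 1) * (D ^ 2 * K)) (by positivity)
    (fun t => integral_nonneg fun ω => sq_nonneg _) hpos hη0
    (by rw [summable_nat_add_iff 1]; exact hη.not_summable) (fun ε hε => ?_) fun t => ?_
  · have h1 := hη0.mul_const (D ^ 2 * K)
    rw [zero_mul] at h1
    filter_upwards [h1.eventually_lt_const (half_pos hε),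
      hξ.eventually_neg_le_excess hM hη hϑ₁ hconv (by positivity : 0 < ε / 4)] with t h2 h3
    have h4 : -(ε / 4) ≤ e t := h3
    linarith
  · have hmom := hX.moment hM hξ hd2 (t + 1)
    have hexi : Integrable (fun ω => M.excess ϑs K₀ (Θ t ω, X (t + 1) ω)) P := by
      refine (hmom.1.const_mul C).mono' ((hM.continuousOn_excess ϑs K₀).measurable_comp_of_mem
        ((hΘ t).prodMk (hXmeas _)) fun ω => ⟨hX.param_mem t ω, hX.state_mem _
          ω⟩).aestronglyMeasurable
        (Eventually.of_forall fun ω => (hex _ ⟨hX.param_mem t ω, hX.state_mem _ ω⟩).trans ?_)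
      have := one_le_wt hd.s_pos.le hd.r_pos.le (hX.state_mem (t + 1) ω)
      rw [wt_two]
      gcongr
      nlinarith
    have i1 := (hsqi t).const_mul (1 - 2 * K₀ * η (t + 1))
    have i2 := hexi.const_mul (-(2 * η (t + 1)))
    have i3 := hmom.1.const_mul (η (t + 1) ^ 2 * D ^ 2)
    have i12 : Integrable (fun ω => (1 - 2 * K₀ * η (t + 1)) * ‖Θ t ω - ϑs‖ ^ 2
      + -(2 * η (t + 1)) * M.excess ϑs K₀ (Θ t ω, X (t + 1) ω)) P := i1.add i2
    -- The Robbins–Monro expansion: the projection does not increase the distance to `ϑs`, and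
    -- expanding the square separates contraction, excess drift and a term of order `η²`.
    have hpt : ∀ ω, ‖Θ (t + 1) ω - ϑs‖ ^ 2 ≤ (1 - 2 * K₀ * η (t + 1)) * ‖Θ t ω - ϑs‖ ^ 2
        + -(2 * η (t + 1)) * M.excess ϑs K₀ (Θ t ω, X (t + 1) ω)
        + η (t + 1) ^ 2 * D ^ 2 * wt (2 * s) (2 * r) (X (t + 1) ω) := by
      intro ω
      set H := M.gradEst (Θ t ω) (X (t + 1) ω) with hHdef
      have h1 : ‖Θ (t + 1) ω - ϑs‖ ≤ ‖Θ t ω - η (t + 1) • H - ϑs‖ := by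
        rw [hΘdef, algParam_succ]
        exact norm_proj_sub_le hϑs
      have h2 : ‖Θ t ω - η (t + 1) • H - ϑs‖ ^ 2 = ‖Θ t ω - ϑs‖ ^ 2
          - 2 * (η (t + 1) * inner ℝ (Θ t ω - ϑs) H) + η (t + 1) ^ 2 * ‖H‖ ^ 2 := by
        rw [sub_right_comm, norm_sub_sq_real, inner_smul_right, norm_smul,
          Real.norm_of_nonneg (hpos t).le]
        ring
      have h3 : ‖H‖ ^ 2 ≤ D ^ 2 * wt (2 * s) (2 * r) (X (t + 1) ω) := by
        rw [wt_two, ← mul_pow]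
        exact pow_le_pow_left₀ (norm_nonneg _)
          (hH _ (hX.param_mem t ω) _ (hX.state_mem (t + 1) ω)) 2
      have h4 := pow_le_pow_left₀ (norm_nonneg _) h1 2
      have h5 := mul_le_mul_of_nonneg_left h3 (sq_nonneg (η (t + 1)))
      simp only [excess]
      rw [h2] at h4
      linarith
    have h1 := integral_mono (hsqi (t + 1)) (i12.add i3) hpt
    have h2 : ∫ ω, ((1 - 2 * K₀ * η (t + 1)) * ‖Θ t ω - ϑs‖ ^ 2
        + -(2 * η (t + 1)) * M.excess ϑs K₀ (Θ t ω, X (t + 1) ω)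
        + η (t + 1) ^ 2 * D ^ 2 * wt (2 * s) (2 * r) (X (t + 1) ω)) ∂P =
        (1 - 2 * K₀ * η (t + 1)) * ∫ ω, ‖Θ t ω - ϑs‖ ^ 2 ∂P + -(2 * η (t + 1)) * e t
        + η (t + 1) ^ 2 * D ^ 2 * ∫ ω, wt (2 * s) (2 * r) (X (t + 1) ω) ∂P := by
      rw [integral_add i12 i3, integral_add i1 i2, integral_const_mul, integral_const_mul,
        integral_const_mul]
    have h3 : η (t + 1) ^ 2 * D ^ 2 * ∫ ω, wt (2 * s) (2 * r) (X (t + 1) ω) ∂P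
        ≤ η (t + 1) ^ 2 * D ^ 2 * K := mul_le_mul_of_nonneg_left hmom.2 (by positivity)
    have h4 := h1.trans_eq h2
    linarith

end Algorithm

end GIGI1

/-! ### Averages of asymptotically uncorrelated variables -/

section WeakCorrelation

variable {Ω : Type*} {mΩ : MeasurableSpace Ω} {P : Measure Ω}

/-- If distant variables are asymptotically not positively correlated, then the second moment of
the sum is of smaller order than the square of the number of summands. -/
lemma tendsto_integral_sum_sq {A : ℕ → Ω → ℝ}
    (hint : ∀ i j, Integrable (fun ω => A i ω * A j ω) P) {D : ℝ}
    (hD : ∀ t, ∫ ω, A t ω * A t ω ∂P ≤ D)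
    (hcorr : ∀ ε > 0, ∃ n t₀ : ℕ, ∀ t ≥ t₀, ∀ i, i + n ≤ t → ∫ ω, A i ω * A t ω ∂P ≤ ε) :
    Tendsto (fun T : ℕ => ((T : ℝ)⁻¹) ^ 2 * ∫ ω, (∑ i ∈ Finset.range T, A i ω) ^ 2 ∂P) atTop
      (𝓝 0) := by
  have hD0 : 0 ≤ D := (integral_nonneg fun ω => mul_self_nonneg _).trans (hD 0)
  have hDD : ∀ i j, ∫ ω, A i ω * A j ω ∂P ≤ D := fun i j => by
    have h := integral_mono (hint i j) (((hint i i).add (hint j j)).div_const 2) fun ω => by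
      simp only [Pi.add_apply]
      nlinarith [sq_nonneg (A i ω - A j ω)]
    rw [integral_div, integral_add' (hint i i) (hint j j)] at h
    linarith [hD i, hD j]
  refine tendsto_order.2 ⟨fun v hv => Eventually.of_forall fun T =>
    hv.trans_le (mul_nonneg (sq_nonneg _) (integral_nonneg fun _ => sq_nonneg _)), fun v hv => ?_⟩
  obtain ⟨n, t₀, hn⟩ := hcorr (v / 2) (half_pos hv)
  set a : ℕ → ℝ := fun T => ∫ ω, (∑ i ∈ Finset.range T, A i ω) ^ 2 ∂P with ha
  set K : ℝ := 2 * (n * D) + D with hK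
  have hstep : ∀ T ≥ t₀, a (T + 1) ≤ a T + 2 * (T * (v / 2)) + K := by
    intro T hT
    -- At most `n` indices lie within the lag of `T`, each contributing at most `D`; all others
    -- contribute at most `v / 2`.
    have h1 : ∑ i ∈ Finset.range T, ∫ ω, A i ω * A T ω ∂P ≤ T * (v / 2) + n * D := by
      have h2 : ∀ i ∈ Finset.range T, ∫ ω, A i ω * A T ω ∂P
          ≤ v / 2 + if T < i + n then D else 0 := by
        intro i _
        split_ifs with h
        · linarith [hDD i T]
        · simpa using hn T hT i (not_lt.1 h)
      refine (Finset.sum_le_sum h2).trans ?_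
      rw [Finset.sum_add_distrib, Finset.sum_const, Finset.card_range, nsmul_eq_mul,
        ← Finset.sum_filter, Finset.sum_const, nsmul_eq_mul]
      have h3 : ((Finset.range T).filter fun i => T < i + n).card ≤ n := by
        calc _ ≤ (Finset.Ico (T - n) T).card := Finset.card_le_card fun i hi => by
                simp only [Finset.mem_filter, Finset.mem_range] at hi
                exact Finset.mem_Ico.2 ⟨by omega, hi.1⟩
          _ ≤ n := by rw [Nat.card_Ico]; omega
      have h4 : (((Finset.range T).filter fun i => T < i + n).card : ℝ) ≤ n := by exact_mod_cast h3
      nlinarith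
    simp only [ha]
    rw [(integral_sum_sq_succ hint T).2]
    linarith [hD T]
  -- The increments `v T + K` accumulate to at most `v T² / 2 + K T`, so the normalized second
  -- moment is eventually below `v`.
  have hbound : ∀ k : ℕ, a (t₀ + k) ≤ a t₀ + K * (t₀ + k : ℕ) + v / 2 * ((t₀ + k : ℕ) : ℝ) ^ 2 := by
    intro k
    induction k with
    | zero =>
      have : 0 ≤ K := by positivity
      have := mul_nonneg this (Nat.cast_nonneg (α := ℝ) t₀)
      have : 0 ≤ v / 2 * (t₀ : ℝ) ^ 2 := by positivity
      simp only [add_zero]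
      linarith
    | succ k ih =>
      have h := hstep (t₀ + k) (Nat.le_add_right _ _)
      rw [← add_assoc]
      push_cast at h ih ⊢
      nlinarith
  have hlim : Tendsto (fun T : ℕ => a t₀ * ((T : ℝ)⁻¹) ^ 2 + K * (T : ℝ)⁻¹ + v / 2) atTop
      (𝓝 (v / 2)) := by
    have h1 := tendsto_inv_atTop_nhds_zero_nat (𝕜 := ℝ)
    simpa using (((h1.pow 2).const_mul (a t₀)).add (h1.const_mul K)).add_const (v / 2)
  filter_upwards [hlim.eventually_lt_const (half_lt_self hv), eventually_ge_atTop t₀,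
    eventually_ge_atTop 1] with T h1 h2 h3
  obtain ⟨k, rfl⟩ := Nat.exists_eq_add_of_le h2
  refine lt_of_le_of_lt ?_ h1
  have hpos : (0 : ℝ) < ((t₀ + k : ℕ) : ℝ) := by exact_mod_cast h3
  refine (mul_le_mul_of_nonneg_left (hbound k) (sq_nonneg _)).trans_eq ?_
  field_simp

/-- Chebyshev's inequality. -/
lemma tendstoInMeasure_of_integral_sq [IsProbabilityMeasure P] {f : ℕ → Ω → ℝ} {l : ℝ}
    (hint : ∀ n, Integrable (fun ω => (f n ω - l) ^ 2) P)
    (hlim : Tendsto (fun n => ∫ ω, (f n ω - l) ^ 2 ∂P) atTop (𝓝 0)) :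
    TendstoInMeasure P f atTop fun _ => l := by
  rw [tendstoInMeasure_iff_measureReal_dist]
  intro ε hε
  refine squeeze_zero (fun n => measureReal_nonneg) (fun n => ?_)
    (by simpa using hlim.const_mul (ε ^ 2)⁻¹)
  have h := mul_meas_ge_le_integral_of_nonneg
    (Eventually.of_forall fun ω => sq_nonneg (f n ω - l)) (hint n) (ε ^ 2)
  have e : {ω | ε ≤ dist (f n ω) l} = {ω | ε ^ 2 ≤ (f n ω - l) ^ 2} := by
    ext ω
    rw [Set.mem_ofPred_eq, Set.mem_ofPred_eq, Real.dist_eq, sq_le_sq, abs_of_pos hε]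
  rw [e, ← div_eq_inv_mul, le_div_iff₀ (by positivity), mul_comm]
  exact h

end WeakCorrelation

/-! ### The law of large numbers along a controlled chain -/

namespace GIGI1

variable {M : GIGI1} {Ω : Type*} {mΩ : MeasurableSpace Ω} {P : Measure Ω} {ξ : ℕ → Ω → ℝ × ℝ}
  {Θ : ℕ → Ω → Param} {X : ℕ → Ω → ℝ × ℝ}

/-- From `a ≤ v / 2 + (2 / v) a²`, where the square has vanishing expectation and `v` is arbitrary.
-/
lemma Close.of_integral_norm_sub_sq [IsProbabilityMeasure P] {ϑs : Param}
    (hΘ : ∀ t, Measurable (Θ t)) {B : ℝ} (hB : ∀ t ω, ‖Θ t ω - ϑs‖ ≤ B)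
    (hlim : Tendsto (fun t => ∫ ω, ‖Θ t ω - ϑs‖ ^ 2 ∂P) atTop (𝓝 0)) :
    Close P Θ fun _ _ => ϑs := by
  refine tendsto_order.2 ⟨fun v hv => Eventually.of_forall fun T =>
    hv.trans_le (integral_nonneg fun _ => le_min zero_le_one dist_nonneg), fun v hv => ?_⟩
  have hlim' := hlim.const_mul (2 / v)
  rw [mul_zero] at hlim'
  filter_upwards [hlim'.eventually_lt_const (half_pos hv)] with t ht
  have hi : Integrable (fun ω => ‖Θ t ω - ϑs‖ ^ 2) P := by
    refine Integrable.of_bound (C := B ^ 2)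
      (((hΘ t).sub_const ϑs).norm.pow_const 2).aestronglyMeasurable
      (Eventually.of_forall fun ω => ?_)
    rw [norm_pow, norm_norm]
    exact pow_le_pow_left₀ (norm_nonneg _) (hB t ω) 2
  have hi' := hi.const_mul (2 / v)
  have hi2 : Integrable (fun ω => v / 2 + 2 / v * ‖Θ t ω - ϑs‖ ^ 2) P :=
    (integrable_const _).add hi'
  calc ∫ ω, min 1 (dist (Θ t ω) ϑs) ∂P
      ≤ ∫ ω, (v / 2 + 2 / v * ‖Θ t ω - ϑs‖ ^ 2) ∂P :=
        integral_mono_of_nonneg (Eventually.of_forall fun _ => le_min zero_le_one dist_nonneg)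
          hi2 (Eventually.of_forall fun ω => ?_)
    _ = v / 2 + 2 / v * ∫ ω, ‖Θ t ω - ϑs‖ ^ 2 ∂P := by
        rw [integral_add (integrable_const _) hi', integral_const_mul]
        simp
    _ < v := by linarith
  refine (min_le_right _ _).trans ?_
  rw [dist_eq_norm]
  have : v / 2 + 2 / v * ‖Θ t ω - ϑs‖ ^ 2 - ‖Θ t ω - ϑs‖
      = 2 / v * ((‖Θ t ω - ϑs‖ - v / 4) ^ 2 + 3 * v ^ 2 / 16) := by
    field_simp
    ring
  have h2 : 0 ≤ 2 / v * ((‖Θ t ω - ϑs‖ - v / 4) ^ 2 + 3 * v ^ 2 / 16) := by positivity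
  linarith

lemma wt_four (s r : ℝ) (x : ℝ × ℝ) : wt (4 * s) (4 * r) x = wt s r x ^ 4 := by
  have := wt_pow s r 4 x
  push_cast at this
  exact this.symm

/-- Law of large numbers for a controlled chain whose parameters converge. -/
theorem Controlled.tendstoInMeasure_average [IsProbabilityMeasure P] (hM : M.Regular)
    (hξ : M.IsNoise P ξ) (hX : M.Controlled ξ Θ X) {ϑs : Param} (hϑs : ϑs ∈ M.box)
    (hclose : Close P Θ fun _ _ => ϑs) {s r C : ℝ} (hd : M.Drift s r)
    (hd2 : M.Drift (2 * s) (2 * r)) (hd4 : M.Drift (4 * s) (4 * r))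
    {g : Param → ℝ × ℝ → ℝ} (hg : M.Tame s r C g) :
    TendstoInMeasure P (fun (T : ℕ) ω => (T : ℝ)⁻¹ * ∑ t ∈ Finset.range T, g (Θ t ω) (X t ω))
      atTop fun _ => M.statMean ϑs (g ϑs) := by
  set v := M.statMean ϑs (g ϑs) with hv
  set A : ℕ → Ω → ℝ := fun t ω => g (Θ t ω) (X t ω) - v with hA
  have hC : 0 ≤ C := hg.nonneg hϑs
  set B := C + |v| with hB
  set κ := M.rate s r with hκ
  set K := (1 - M.rate (2 * s) (2 * r))⁻¹ with hK
  have hK1 : 1 ≤ K := hd2.one_le_inv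
  have hκ1 := sub_pos.2 hd.rate_lt
  have hκ0 := rate_nonneg (M := M) s r
  have hAmeas : ∀ t, Measurable[past ξ (t + 1)] (A t) := fun t =>
    (hg.cont.measurable_comp_of_mem ((hX.measurable_param t).prodMk (hX.measurable_state t))
      fun ω => ⟨hX.param_mem t ω, hX.state_mem t ω⟩).sub_const v
  have hAmeas' : ∀ t, Measurable (A t) := fun t => (hAmeas t).mono (hξ.past_le _) le_rfl
  have hwt : ∀ t ω, 1 ≤ wt s r (X t ω) := fun t ω =>
    one_le_wt hd.s_pos.le hd.r_pos.le (hX.state_mem t ω)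
  have hAle : ∀ t ω, |A t ω| ≤ B * wt s r (X t ω) := fun t ω => by
    have h1 := hg.bound _ (hX.param_mem t ω) _ (hX.state_mem t ω)
    have h2 := abs_sub (g (Θ t ω) (X t ω)) v
    have h3 := le_mul_of_one_le_right (abs_nonneg v) (hwt t ω)
    simp only [hA, hB]
    rw [add_mul]
    linarith
  have hmom := fun t => hX.moment hM hξ hd2 t
  have hwprod : ∀ i j, Integrable (fun ω => wt s r (X i ω) * wt s r (X j ω)) P ∧
      ∫ ω, wt s r (X i ω) * wt s r (X j ω) ∂P ≤ K := fun i j => by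
    have i1 : Integrable (fun ω => (wt (2 * s) (2 * r) (X i ω) + wt (2 * s) (2 * r) (X j ω)) / 2)
        P := ((hmom i).1.add (hmom j).1).div_const 2
    have hle : ∀ ω, wt s r (X i ω) * wt s r (X j ω)
        ≤ (wt (2 * s) (2 * r) (X i ω) + wt (2 * s) (2 * r) (X j ω)) / 2 := fun ω => by
      rw [wt_two, wt_two]
      nlinarith [sq_nonneg (wt s r (X i ω) - wt s r (X j ω))]
    have hm : ∀ t, Measurable fun ω => wt s r (X t ω) := fun t =>
      (continuous_wt s r).measurable.comp ((hX.measurable_state t).mono (hξ.past_le _) le_rfl)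
    have i2 : Integrable (fun ω => wt s r (X i ω) * wt s r (X j ω)) P := by
      refine i1.mono' ((hm i).mul (hm j)).aestronglyMeasurable (Eventually.of_forall fun ω => ?_)
      rw [Real.norm_of_nonneg (mul_pos (wt_pos _ _ _) (wt_pos _ _ _)).le]
      exact hle ω
    refine ⟨i2, (integral_mono i2 i1 hle).trans ?_⟩
    rw [integral_div, integral_add (hmom i).1 (hmom j).1]
    linarith [(hmom i).2, (hmom j).2]
  have hB0 : 0 ≤ B := by positivity
  have hAA : ∀ i j, Integrable (fun ω => A i ω * A j ω) P := fun i j => by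
    refine ((hwprod i j).1.const_mul (B * B)).mono'
      ((hAmeas' i).mul (hAmeas' j)).aestronglyMeasurable (Eventually.of_forall fun ω => ?_)
    rw [norm_mul, mul_mul_mul_comm]
    exact mul_le_mul (hAle i ω) (hAle j ω) (abs_nonneg _)
      (mul_nonneg hB0 (wt_pos _ _ _).le)
  have hAAle : ∀ t, ∫ ω, A t ω * A t ω ∂P ≤ B * B * K := fun t => by
    refine (integral_mono (hAA t t) ((hwprod t t).1.const_mul (B * B)) fun ω => ?_).trans ?_
    · simp only
      rw [mul_mul_mul_comm, ← abs_mul_abs_self]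
      exact mul_self_le_mul_self (abs_nonneg _) (hAle t ω)
    · rw [integral_const_mul]
      exact mul_le_mul_of_nonneg_left (hwprod t t).2 (by positivity)
  -- distant summands are almost uncorrelated
  have hcorr : ∀ ε > 0, ∃ n t₀ : ℕ, ∀ t ≥ t₀, ∀ i, i + n ≤ t →
      ∫ ω, A i ω * A t ω ∂P ≤ ε := by
    intro ε hε
    obtain ⟨n, hn⟩ : ∃ n, 6 * C / (1 - κ) * κ ^ n * (B * K) < ε / 3 := by
      have h0 := ((tendsto_pow_atTop_nhds_zero_of_lt_one hκ0
        hd.rate_lt).const_mul (6 * C / (1 - κ))).mul_const (B * K)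
      rw [mul_zero, zero_mul] at h0
      exact (h0.eventually_lt_const (by positivity)).exists
    -- The chain is frozen at the limit `ϑs` itself, which convergence of the parameters allows, so
    -- it is centered by the constant `v`.
    set Y := M.frozen ξ X (fun _ _ => ϑs) n with hY
    have hcl : ∀ k, Close P (fun τ => Θ (τ + k)) fun _ _ => ϑs := fun k =>
      (tendsto_add_atTop_iff_nat k).2 hclose
    have hΘ : ∀ t, Measurable (Θ t) := fun t => (hX.measurable_param t).mono (hξ.past_le _) le_rfl
    have hq := hX.tight hM hξ hd4 n (ϑ := fun τ => Θ (τ + n)) (fun τ => hΘ _)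
      (fun τ => hX.param_mem _)
    have hq' := hX.tight_frozen hM hξ hd4 (ϑ := fun _ _ => ϑs) (fun _ => measurable_const)
      (fun _ _ => hϑs) n
    have hclq : Close P (fun τ ω => (Θ (τ + n) ω, X (τ + n) ω)) fun τ ω => (ϑs, Y τ ω) :=
      Close.prodMk (fun τ => hΘ _) (fun _ => measurable_const)
        (fun τ => (hX.measurable_state _).mono (hξ.past_le _) le_rfl)
        (fun τ => (hX.measurable_frozen hM (fun _ => measurable_const) (fun _ _ => hϑs) _ τ).mono
          (hξ.past_le _) le_rfl) (hcl n)
        (hX.close_frozen hM hξ (fun _ => measurable_const) (fun _ _ => hϑs) hcl n)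
    have hcont : ContinuousOn (fun q : Param × (ℝ × ℝ) => g q.1 q.2) M.pairs := hg.cont
    have hcont' : ContinuousOn (Function.uncurry fun q q' : Param × (ℝ × ℝ) =>
        (g q.1 q.2 - g q'.1 q'.2) ^ 2) (M.pairs ×ˢ M.pairs) :=
      ((hcont.comp continuousOn_fst fun z hz => hz.1).sub
        (hcont.comp continuousOn_snd fun z hz => hz.2)).pow 2
    -- Closeness in mean square is needed, so the comparison is applied to the squared difference.
    -- The square of that is at most `8 (g⁴ + g'⁴)`, which accounts for the quadrupled exponents.
    have hlim := hclq.tendsto_integral_abs (C := 8 * C ^ 4) hd4.s_pos hd4.r_pos hcont'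
      (fun q _ => by simp) (fun q hq q' hq' => by
        have h1 := hg.bound q.1 hq.1 q.2 hq.2
        have h2 := hg.bound q'.1 hq'.1 q'.2 hq'.2
        have h3 := pow_le_pow_left₀ (abs_nonneg _) h1 4
        have h4 := pow_le_pow_left₀ (abs_nonneg _) h2 4
        rw [pow_abs, abs_of_nonneg (by positivity), mul_pow] at h3 h4
        rw [wt_four, wt_four]
        nlinarith [sq_nonneg (g q.1 q.2 + g q'.1 q'.2), sq_nonneg (g q.1 q.2 - g q'.1 q'.2),
          sq_nonneg (g q.1 q.2 ^ 2 - g q'.1 q'.2 ^ 2),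
          sq_nonneg ((g q.1 q.2 - g q'.1 q'.2) ^ 2 - (g q.1 q.2 + g q'.1 q'.2) ^ 2),
          mul_nonneg (sq_nonneg (g q.1 q.2 + g q'.1 q'.2))
            (sq_nonneg (g q.1 q.2 - g q'.1 q'.2)),
          sq_nonneg ((g q.1 q.2 + g q'.1 q'.2) ^ 2)]) hq hq'
    simp only [abs_sq] at hlim
    -- The parameter of the inequality `p z ≤ δ p² + δ⁻¹ z²`, small enough that the first term costs
    -- at most `ε / 3` in mean.
    set δ := ε / (3 * (B * B * K + 1)) with hδ
    have hδ0 : 0 < δ := by positivity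
    obtain ⟨τ₀, hτ₀⟩ := eventually_atTop.1
      (hlim.eventually_lt_const (mul_pos hδ0 (by positivity : 0 < ε / 3)))
    refine ⟨n, τ₀ + n, fun t ht i hi => ?_⟩
    obtain ⟨τ, rfl⟩ : ∃ τ, t = τ + n := ⟨t - n, by omega⟩
    -- The lag guarantees that the summand with index `i` is already determined when the freezing
    -- starts at `τ`.
    have hiτ : i ≤ τ := by omega
    have hAi : Measurable[past ξ (τ + 1)] (A i) := (hAmeas i).mono (past_mono (by omega)) le_rfl
    have hAw : Integrable (fun ω => A i ω * wt s r (X τ ω)) P := by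
      refine ((hwprod i τ).1.const_mul B).mono' ((hAmeas' i).mul ((continuous_wt s r).measurable.comp
        ((hX.measurable_state τ).mono (hξ.past_le _) le_rfl))).aestronglyMeasurable
        (Eventually.of_forall fun ω => ?_)
      rw [norm_mul, ← mul_assoc, Real.norm_of_nonneg (wt_pos s r (X τ ω)).le]
      exact mul_le_mul_of_nonneg_right (hAle i ω) (wt_pos _ _ _).le
    have hAwle : ∫ ω, |A i ω| * wt s r (X τ ω) ∂P ≤ B * K := by
      calc _ ≤ ∫ ω, B * (wt s r (X i ω) * wt s r (X τ ω)) ∂P :=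
            integral_mono_of_nonneg (Eventually.of_forall fun ω =>
              mul_nonneg (abs_nonneg _) (wt_pos _ _ _).le) ((hwprod i τ).1.const_mul B)
              (Eventually.of_forall fun ω => by
                simp only
                rw [← mul_assoc]
                exact mul_le_mul_of_nonneg_right (hAle i ω) (wt_pos _ _ _).le)
        _ ≤ _ := by
            rw [integral_const_mul]
            exact mul_le_mul_of_nonneg_left (hwprod i τ).2 hB0
    have h1 := IsNoise.abs_integral_mul_path_le hM hξ hd hg (measurable_const (a := ϑs))
      (fun _ => hϑs) (hX.measurable_state τ) (hX.state_mem τ) hAi hAw n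
    have h1' : ∫ ω, A i ω * (g ϑs (Y τ ω) - v) ∂P ≤ ε / 3 := by
      refine (le_abs_self _).trans (h1.trans ((mul_le_mul_of_nonneg_left hAwle ?_).trans hn.le))
      positivity
    have i1 : Integrable (fun ω => A i ω * (g ϑs (Y τ ω) - v)) P := by
      have i2 := IsNoise.integrable_mul_path hM hξ hd hg (measurable_const (a := ϑs))
        (fun _ => hϑs) (hX.measurable_state τ) (hX.state_mem τ) hAi hAw n
      have i3 : Integrable (A i) P := by
        refine hAw.mono (hAmeas' i).aestronglyMeasurable (Eventually.of_forall fun ω => ?_)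
        rw [norm_mul, Real.norm_of_nonneg (wt_pos s r (X τ ω)).le]
        exact le_mul_of_one_le_right (norm_nonneg _) (hwt τ ω)
      simp only [mul_sub]
      exact i2.sub (i3.mul_const v)
    have hYm : Measurable fun ω => g ϑs (Y τ ω) :=
      hg.cont.measurable_comp_of_mem (hq'.measurable τ) (hq'.mem τ)
    have hgm : Measurable fun ω => g (Θ (τ + n) ω) (X (τ + n) ω) :=
      hg.cont.measurable_comp_of_mem (hq.measurable τ) (hq.mem τ)
    have i4 : Integrable (fun ω => (g (Θ (τ + n) ω) (X (τ + n) ω) - g ϑs (Y τ ω)) ^ 2) P := by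
      refine (((hq.integrable τ).add (hq'.integrable τ)).const_mul (2 * C ^ 2)).mono'
        ((hgm.sub hYm).pow_const 2).aestronglyMeasurable (Eventually.of_forall fun ω => ?_)
      rw [Real.norm_of_nonneg (sq_nonneg _)]
      have h1 := sq_le_sq' (abs_le.1 (hg.bound _ (hX.param_mem (τ + n) ω) _
        (hX.state_mem (τ + n) ω))).1 (abs_le.1 (hg.bound _ (hX.param_mem (τ + n) ω) _
        (hX.state_mem (τ + n) ω))).2
      have h2 := sq_le_sq' (abs_le.1 (hg.bound _ hϑs _ (hq'.mem τ ω).2)).1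
        (abs_le.1 (hg.bound _ hϑs _ (hq'.mem τ ω).2)).2
      have hsq : ∀ x ∈ stateSpace, wt s r x ^ 2 ≤ wt (4 * s) (4 * r) x := fun x hx => by
        rw [wt_four]
        exact pow_le_pow_right₀ (one_le_wt hd.s_pos.le hd.r_pos.le hx) (by norm_num)
      have h3 := mul_le_mul_of_nonneg_left (hsq _ (hX.state_mem (τ + n) ω)) (sq_nonneg C)
      have h4 := mul_le_mul_of_nonneg_left (hsq _ (hq'.mem τ ω).2) (sq_nonneg C)
      simp only [Pi.add_apply, mul_pow] at h1 h2 ⊢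
      nlinarith [sq_nonneg (g (Θ (τ + n) ω) (X (τ + n) ω) + g ϑs (Y τ ω))]
    have i5 : Integrable (fun ω => δ * (A i ω * A i ω) + δ⁻¹ *
        (g (Θ (τ + n) ω) (X (τ + n) ω) - g ϑs (Y τ ω)) ^ 2) P :=
      ((hAA i i).const_mul δ).add (i4.const_mul δ⁻¹)
    have h2 : ∫ ω, A i ω * A (τ + n) ω ∂P ≤ ∫ ω, (A i ω * (g ϑs (Y τ ω) - v) +
        (δ * (A i ω * A i ω) + δ⁻¹ *
        (g (Θ (τ + n) ω) (X (τ + n) ω) - g ϑs (Y τ ω)) ^ 2)) ∂P := by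
      refine integral_mono (hAA i _) (i1.add i5) fun ω => ?_
      simp only [hA]
      set p := g (Θ i ω) (X i ω) - v
      set z := g (Θ (τ + n) ω) (X (τ + n) ω) - g ϑs (Y τ ω) with hz
      have e : p * (g (Θ (τ + n) ω) (X (τ + n) ω) - v) = p * (g ϑs (Y τ ω) - v) + p * z := by
        rw [hz]; ring
      have e2 : δ * (p * p) + δ⁻¹ * z ^ 2 - p * z
          = δ⁻¹ * ((δ * p - z / 2) ^ 2 + 3 / 4 * z ^ 2) := by
        field_simp
        ring
      have h5 : 0 ≤ δ⁻¹ * ((δ * p - z / 2) ^ 2 + 3 / 4 * z ^ 2) := by positivity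
      rw [e]
      linarith
    rw [integral_add i1 i5, integral_add ((hAA i i).const_mul δ) (i4.const_mul δ⁻¹),
      integral_const_mul, integral_const_mul] at h2
    have h3 : δ * ∫ ω, A i ω * A i ω ∂P ≤ ε / 3 := by
      calc _ ≤ δ * (B * B * K + 1) :=
            mul_le_mul_of_nonneg_left (by linarith [hAAle i]) hδ0.le
        _ = ε / 3 := by
            rw [hδ]
            have : B * B * K + 1 ≠ 0 := by positivity
            field_simp
    have h4 := mul_le_mul_of_nonneg_left (hτ₀ τ (by omega)).le (inv_pos.2 hδ0).le
    rw [inv_mul_cancel_left₀ hδ0.ne'] at h4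
    have h5 : δ⁻¹ * ∫ ω, (g (Θ (τ + n) ω) (X (τ + n) ω) - g ϑs (Y τ ω)) ^ 2 ∂P ≤ ε / 3 := h4
    linarith
  have hmain := tendsto_integral_sum_sq hAA hAAle hcorr
  have hae : ∀ᶠ T : ℕ in atTop, ∀ ω, ((T : ℝ)⁻¹) ^ 2 * (∑ i ∈ Finset.range T, A i ω) ^ 2
      = ((T : ℝ)⁻¹ * ∑ t ∈ Finset.range T, g (Θ t ω) (X t ω) - v) ^ 2 := by
    filter_upwards [eventually_ge_atTop 1] with T hT ω
    have hT0 : (T : ℝ) ≠ 0 := by positivity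
    rw [← mul_pow]
    simp only [hA, Finset.sum_sub_distrib, Finset.sum_const, Finset.card_range, nsmul_eq_mul,
      mul_sub]
    rw [inv_mul_cancel_left₀ hT0]
  have hint : ∀ T : ℕ, Integrable (fun ω =>
      ((T : ℝ)⁻¹ * ∑ t ∈ Finset.range T, g (Θ t ω) (X t ω) - v) ^ 2) P := fun T => by
    rcases Nat.eq_zero_or_pos T with rfl | hT
    · simp
    · have hT0 : (T : ℝ) ≠ 0 := by positivity
      refine (((integral_sum_sq_succ hAA T).1).const_mul (((T : ℝ)⁻¹) ^ 2)).congr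
        (Eventually.of_forall fun ω => ?_)
      simp only
      rw [← mul_pow]
      simp only [hA, Finset.sum_sub_distrib, Finset.sum_const, Finset.card_range, nsmul_eq_mul,
        mul_sub]
      rw [inv_mul_cancel_left₀ hT0]
  refine tendstoInMeasure_of_integral_sq hint (hmain.congr' ?_)
  filter_upwards [hae] with T hT
  rw [← integral_const_mul]
  exact integral_congr_ae (Eventually.of_forall hT)

end GIGI1

/-! ### Transfer to the driving sequences of the statement -/

lemma MeasureTheory.TendstoInMeasure.mul_const_real {Ω : Type*} {mΩ : MeasurableSpace Ω}
    {P : Measure Ω} {f : ℕ → Ω → ℝ} {g : Ω → ℝ} (h : TendstoInMeasure P f atTop g) (c : ℝ) :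
    TendstoInMeasure P (fun n ω => f n ω * c) atTop fun ω => g ω * c := by
  rw [tendstoInMeasure_iff_norm] at h ⊢
  intro ε hε
  refine tendsto_of_tendsto_of_tendsto_of_le_of_le tendsto_const_nhds
    (h (ε / (|c| + 1)) (by positivity)) (fun _ => zero_le) fun n => measure_mono fun ω hω => ?_
  rw [Set.mem_ofPred_eq, ← sub_mul, norm_mul] at hω
  rw [Set.mem_ofPred_eq, div_le_iff₀ (by positivity)]
  rw [Real.norm_eq_abs c] at hω
  nlinarith [norm_nonneg (f n ω - g ω)]

/-- Grouping the members of two independent families into pairs preserves independence. -/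
lemma iIndepFun_prodMk_of_sumElim {Ω ι E : Type*} {mΩ : MeasurableSpace Ω} {P : Measure Ω}
    [MeasurableSpace E] {U V : ι → Ω → E} (hU : ∀ i, Measurable (U i)) (hV : ∀ i, Measurable (V i))
    (h : iIndepFun (Sum.elim U V) P) : iIndepFun (fun i ω => (U i ω, V i ω)) P := by
  have := h.isProbabilityMeasure
  let X : ι → Bool → Ω → E := fun i b => Sum.elim U V (Equiv.boolProdEquivSum ι (b, i))
  have hX : ∀ i b, Measurable (X i b) := fun i b => by
    cases b
    · exact hU i
    · exact hV i
  have hinj : Function.Injective fun p : Σ _ : ι, Bool => Equiv.boolProdEquivSum ι (p.2, p.1) :=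
    (Equiv.boolProdEquivSum ι).injective.comp fun p q hpq => by
      rcases p with ⟨i, b⟩
      rcases q with ⟨j, c⟩
      simp only [Prod.mk.injEq] at hpq
      rw [hpq.1, hpq.2]
  have h1 : iIndepFun (fun (p : Σ _ : ι, Bool) ω => X p.1 p.2 ω) P := h.precomp hinj
  have hrow : ∀ i, iIndepFun (X i) P := fun i =>
    h1.precomp (g := fun b => (⟨i, b⟩ : Σ _ : ι, Bool)) fun b c hbc => by simpa using hbc
  have hprob : ∀ i b, IsProbabilityMeasure (P.map (X i b)) := fun i b =>
    Measure.isProbabilityMeasure_map (hX i b).aemeasurable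
  have h2 := h1.map_fun_eq_infinitePi_map (fun p : Σ _ : ι, Bool => hX p.1 p.2)
  -- Currying the product law of the whole family exhibits it as a product over the pairs of the
  -- product laws within each pair.
  have h3 := congrArg (Measure.map (MeasurableEquiv.piCurry fun (_ : ι) (_ : Bool) => E)) h2
  rw [Measure.map_map (by fun_prop) (by fun_prop),
    Measure.infinitePi_map_piCurry fun i b => P.map (X i b)] at h3
  have h4 : iIndepFun (fun i ω b => X i b ω) P := by
    rw [iIndepFun_iff_map_fun_eq_infinitePi_map (by fun_prop)]
    refine h3.trans ?_
    congr 1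
    funext i
    exact ((hrow i).map_fun_eq_infinitePi_map (hX i)).symm
  exact h4.comp (fun _ (f : Bool → E) => (f false, f true)) fun _ => by fun_prop

namespace GIGI1

variable {M : GIGI1} {Ω : Type*} {mΩ : MeasurableSpace Ω} {P : Measure Ω}

/-- An interior point can be moved a little in each positive coordinate direction, so the box cannot
be degenerate. This supplies the strict inequalities in `Regular`. -/
lemma lt_of_mem_interior_box {ϑs : Param} (h : ϑs ∈ interior M.box) :
    M.muLo < M.muHi ∧ M.pLo < M.pHi := by
  have key : ∀ i : Fin 2, ∃ t > (0 : ℝ), ϑs + t • EuclideanSpace.single i 1 ∈ M.box := fun i => by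
    have hc : Tendsto (fun t : ℝ => ϑs + t • (EuclideanSpace.single i 1 : Param)) (𝓝[>] 0)
        (𝓝 ϑs) := by
      have : Continuous fun t : ℝ => ϑs + t • (EuclideanSpace.single i 1 : Param) := by fun_prop
      have h0 := this.tendsto 0
      simp only [zero_smul, add_zero] at h0
      exact h0.mono_left nhdsWithin_le_nhds
    obtain ⟨t, ht, ht0⟩ := ((hc.eventually (mem_interior_iff_mem_nhds.1 h)).and
      self_mem_nhdsWithin).exists
    exact ⟨t, ht0, ht⟩
  have hmem := interior_subset h
  obtain ⟨t, ht, h0⟩ := key 0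
  obtain ⟨t', ht', h1⟩ := key 1
  have e0 := h0.1.2
  have e1 := h1.2.2
  simp at e0 e1
  exact ⟨by linarith [hmem.1.1], by linarith [hmem.2.1]⟩

/-- The driving sequences of the algorithm agree almost surely with a noise sequence. -/
lemma Regular.exists_isNoise [IsProbabilityMeasure P] (hM : M.Regular) {U V : ℕ → Ω → ℝ}
    (hU : ∀ t, HasLaw (U t) M.lawU P) (hV : ∀ t, HasLaw (V t) M.lawV P)
    (hind : iIndepFun (Sum.elim U V) P) :
    ∃ ξ : ℕ → Ω → ℝ × ℝ, M.IsNoise P ξ ∧ ∀ᵐ ω ∂P, ∀ t, (U t ω, V t ω) = ξ t ω := by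
  -- The given sequences are only almost everywhere measurable, so they are replaced by measurable
  -- versions, and by positive parts further below.
  set U' : ℕ → Ω → ℝ := fun t => (hU t).aemeasurable.mk (U t) with hU'
  set V' : ℕ → Ω → ℝ := fun t => (hV t).aemeasurable.mk (V t) with hV'
  have mU : ∀ t, Measurable (U' t) := fun t => (hU t).aemeasurable.measurable_mk
  have mV : ∀ t, Measurable (V' t) := fun t => (hV t).aemeasurable.measurable_mk
  have eU : ∀ t, U t =ᵐ[P] U' t := fun t => (hU t).aemeasurable.ae_eq_mk
  have eV : ∀ t, V t =ᵐ[P] V' t := fun t => (hV t).aemeasurable.ae_eq_mk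
  have hind' : iIndepFun (Sum.elim U' V') P := hind.congr fun i => by
    cases i with
    | inl t => exact eU t
    | inr t => exact eV t
  have hpair := iIndepFun_prodMk_of_sumElim mU mV hind'
  have hlaw : ∀ t, P.map (fun ω => (U' t ω, V' t ω)) = M.noise := fun t => by
    have h1 : IndepFun (U' t) (V' t) P :=
      hind'.indepFun (i := Sum.inl t) (j := Sum.inr t) Sum.inl_ne_inr
    rw [(indepFun_iff_map_prod_eq_prod_map_map (mU t).aemeasurable (mV t).aemeasurable).1 h1,
      ← Measure.map_congr (eU t), ← Measure.map_congr (eV t), (hU t).map_eq, (hV t).map_eq]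
  have hpos : Measurable fun uv : ℝ × ℝ => (max uv.1 0, max uv.2 0) := by fun_prop
  refine ⟨fun t ω => (max (U' t ω) 0, max (V' t ω) 0), ⟨fun t => ?_, fun t ω =>
    ⟨le_max_right _ _, le_max_right _ _⟩, fun t => ?_, ?_⟩, ae_all_iff.2 fun t => ?_⟩
  · exact hpos.comp ((mU t).prodMk (mV t))
  · have h1 := hM.map_pos_noise
    nth_rw 1 [← hlaw t] at h1
    rw [Measure.map_map hpos ((mU t).prodMk (mV t))] at h1
    exact h1
  · exact hpair.comp (fun _ uv => (max uv.1 0, max uv.2 0)) fun _ => hpos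
  · have h1 := hM.noise_nonneg
    rw [← hlaw t] at h1
    filter_upwards [eU t, eV t, ae_of_ae_map ((mU t).prodMk (mV t)).aemeasurable h1]
      with ω h2 h3 h4
    rw [h2, h3, max_eq_left h4.1, max_eq_left h4.2]

lemma posSemidef_smul_outer {v : ℝ} (hv : 0 ≤ v) (b : Param) :
    (Matrix.of fun i j => v * (b i * b j) : Matrix (Fin 2) (Fin 2) ℝ).PosSemidef := by
  have h := (Matrix.posSemidef_vecMulVec_self_star (fun i => b i : Fin 2 → ℝ)).smul hv
  convert h using 1
  ext i j
  simp [Matrix.vecMulVec_apply]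

end GIGI1

end

theorem proposition3 (M : GIGI1) (hstable : M.UniformlyStable) (hlight : M.LightTailed)
    (ϑstar : Param) (K₀ K₁ : ℝ) (hconvex : M.ConvexSmooth ϑstar K₀ K₁)
    (G : Matrix (Fin 2) (Fin 2) ℝ) (L δ : ℝ) (hlin : M.LocallyLinear ϑstar G L δ) :
    -- the Poisson equation at `ϑ⋆` is solved by a convergent series, and the conditional
    -- covariances below are those of square integrable functions
    (∀ x ∈ stateSpace, Summable (M.bias ϑstar x) ∧
      M.gradEst ϑstar x - M.gradObj ϑstar =
        M.poissonSol ϑstar x - M.transOp ϑstar (M.poissonSol ϑstar) x) ∧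
    (∀ ϑ ∈ M.box, ∀ x ∈ stateSpace, MemLp (M.poissonSol ϑstar) 2 (M.trans ϑ x)) ∧
    -- convergence in probability of the averaged conditional covariances
    ∃ S : Matrix (Fin 2) (Fin 2) ℝ, S.PosSemidef ∧
      ∀ η : ℕ → ℝ, StepSize η → ∀ ϑ₁ ∈ M.box,
      ∀ (Ω : Type*) [MeasurableSpace Ω] (P : Measure Ω) [IsProbabilityMeasure P]
        (U V : ℕ → Ω → ℝ),
        (∀ t, HasLaw (U t) M.lawU P) → (∀ t, HasLaw (V t) M.lawV P) →
        iIndepFun (Sum.elim U V) P →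
        ∀ i j, TendstoInMeasure P
          (fun T ω => M.avgCondCov ϑstar η ϑ₁ (fun t => (U t ω, V t ω)) T i j)
          atTop (fun _ => S i j) := by
  obtain ⟨hmu, hp⟩ := GIGI1.lt_of_mem_interior_box hconvex.mem_interior
  have hM : M.Regular := ⟨hstable, hlight, hmu, hp⟩
  have hs : ϑstar ∈ M.box := interior_subset hconvex.mem_interior
  obtain ⟨s, r, hd, hd2, hd4, hd8⟩ := hM.exists_drift_eight
  obtain ⟨C, hg⟩ := hM.exists_tame_condVar hd hd2 hs
  -- The exponents are expressed relative to `2 s, 2 r`, the weight of the conditional variance.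
  rw [show (4 : ℝ) * s = 2 * (2 * s) by ring, show (4 : ℝ) * r = 2 * (2 * r) by ring] at hd4
  rw [show (8 : ℝ) * s = 4 * (2 * s) by ring, show (8 : ℝ) * r = 4 * (2 * r) by ring] at hd8
  -- The scalar factor of the limit is the stationary mean of the conditional variance at the
  -- optimum; it is fixed before the step sizes and the initial parameter are introduced.
  set v := M.statMean ϑstar (M.condVar ϑstar ϑstar) with hv
  have hv0 : 0 ≤ v := hM.statMean_nonneg hd2
    (GIGI1.Tame.of_const (hg.section hs) (hg.bound ϑstar hs))
    (fun x hx => hM.condVar_nonneg hs hs hx) hs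
  refine ⟨fun x hx => ⟨hM.summable_bias hs hx, hM.gradEst_sub_gradObj hs hx⟩,
    fun ϑ hϑ x hx => hM.memLp_poissonSol hs hϑ hx,
    Matrix.of fun i j => v * (M.slope ϑstar i * M.slope ϑstar j),
    GIGI1.posSemidef_smul_outer hv0 _, ?_⟩
  intro η hη ϑ₁ hϑ₁ Ω _ P _ U V hU hV hind i j
  obtain ⟨ξ, hξ, hae⟩ := hM.exists_isNoise hU hV hind
  have hX : M.Controlled ξ (M.algParam η ϑ₁ ξ) (M.algState η ϑ₁ ξ) := hξ.controlled hM hϑ₁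
  obtain ⟨B, -, hB⟩ := M.exists_norm_sub_le ϑstar
  have hclose := GIGI1.Close.of_integral_norm_sub_sq
    (fun t => (hX.measurable_param t).mono (hξ.past_le _) le_rfl)
    (fun t ω => hB _ (hX.param_mem t ω))
    (hξ.tendsto_integral_norm_sub_sq hM hη hϑ₁ hs hconvex.K₀_pos hconvex.convex)
  have hlim := hX.tendstoInMeasure_average hM hξ hs hclose hd2 hd4 hd8 hg
  have hlim' := hlim.mul_const_real (M.slope ϑstar i * M.slope ϑstar j)
  refine hlim'.congr_left (fun T => ?_)
  filter_upwards [hae] with ω hω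
  rw [show (fun t => (U t ω, V t ω)) = fun t => ξ t ω from funext hω]
  simp only [GIGI1.avgCondCov, Matrix.smul_apply, Matrix.sum_apply, smul_eq_mul]
  rw [mul_assoc, Finset.sum_mul]
  congr 1
  exact Finset.sum_congr rfl fun t _ =>
    (hM.condCov_eq hs (hX.param_mem t ω) (hX.state_mem t ω) i j).symm
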